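/- **Theorem B.** Let $G=\langle s_1,\dots,s_r\rangle$ be the free group of rank $r\ge 1$ with identity $e$, acting by measure-preserving transformations $T=(T_g)_{g\in G}$ on a probability space $(X,\mu)$, and let $\alpha:X\to\mathtt A$, $\beta:X\to\mathtt B$ be measurable maps to finite sets (finite observables); write $\alpha\beta=(\alpha,\beta)$. *Notation.* For $H\subseteq G$ let $\alpha^H(x)=(\alpha(T_gx))_{g\in H}$. With $|\cdot|$ the word length, let $B(h,k)=\{g\in G:|gh^{-1}|\le k\}$ and $\alpha^k=\alpha^{B(e,k)}$. With $\mathrm H_\mu$ the Shannon entropy (natural logarithm), put $$F_\mu(T,\alpha)=(1-2r)\,\mathrm H_\mu(\alpha)+\sum_{i=1}^r \mathrm H_\mu(\alpha^{\{e,s_i\}}),\qquad f_\mu(T,\alpha)=\inf_{k\in\mathbb N}F_\mu(T,\alpha^k),$$ $$F_\mu(T,\alpha\mid\beta)=F_\mu(T,\alpha\beta)-F_\mu(T,\beta),\qquad f_\mu(T,\alpha\mid\beta)=\inf_{k_1\in\mathbb N}\ \limsup_{k_2\to\infty}F_\mu(T,\alpha^{k_1}\mid\beta^{k_2}),$$ where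 $f_\mu$ takes values in $[-\infty,\infty]$. For probability measures $P,Q$ on $\mathtt A^G$ let $d^*_k(P,Q)=\sum_{i=1}^r d^{B(e,k)\cup B(s_i,k)}(P,Q)$, where $d^H(P,Q)$ is the total variation distance (half the $\ell^1$-distance) between the marginals on $\mathtt A^H$. For $\sigma\in\mathrm{Hom}(G,\mathrm{Sym}(n))$ and $\mathbf x\in\mathtt A^n$, let $P^\sigma_{\mathbf x}$ be the law of $(\mathbf x(\sigma(g)j))_{g\in G}$ for $j$ uniform in $\{1,\dots,n\}$, and for $\mathcal O\subseteq\mathrm{Prob}(\mathtt A^G)$ let $\Omega(\sigma,\mathcal O)=\{\mathbf x\in\mathtt A^n: P^\sigma_{\mathbf x}\in\mathcal O\}$. The same notation is used for the alphabets $\mathtt B$ and $\mathtt A\times\mathtt B$. For $\sigma_0\in\mathrm{Hom}(G,\mathrm{Sym}(n))$, $\mathbf y_0\in\mathtt B^n$ and $k\in\mathbb N$, let $\mathrm{SBM}(\sigma_0,\mathbf y_0,k)$ be the uniform distribution on $\{\sigma\in\mathrm{Hom}(G,\mathrm{Sym}(n)): d^*_k(P^{\sigma}_{\mathbf y_0},P^{\sigma_0}_{\mathbf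 y_0})=0\}$. *Statement.* Let $m_n\in\mathbb N$ satisfy $m_n\to\infty$ and $m_n=o(\log\log n)$. For each $n$ let $\mathbf y_n\in\mathtt B^n$ and $\sigma_n\in\mathrm{Hom}(G,\mathrm{Sym}(n))$ be such that $d^*_{m_n}(P^{\sigma_n}_{\mathbf y_n},\beta^G_*\mu)=O(1/\log n)$. Suppose that $f_\mu(T,\beta)>-\infty$. Then, with $\mu_n=\mathrm{SBM}(\sigma_n,\mathbf y_n,m_n)$, $$f_\mu(T,\alpha\mid\beta)=\inf_{\mathcal O\ni(\alpha\beta)^G_*\mu}\ \limsup_{n\to\infty}\frac1n\log\mathbb E_{\sigma\sim\mu_n}\bigl|\{\mathbf x\in\mathtt A^n:(\mathbf x,\mathbf y_n)\in\Omega(\sigma,\mathcal O)\}\bigr|,$$ and the same equality holds with $\limsup_{n\to\infty}$ replaced by $\liminf_{n\to\infty}$. Here the infimum is over all weak$^*$-open neighborhoods $\mathcal O$ of $(\alpha\beta)^G_*\mu$ in $\mathrm{Prob}((\mathtt A\times\mathtt B)^G)$, and $\log 0=-\infty$. -/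

import Mathlib

open MeasureTheory Filter Topology

noncomputable section

namespace RelF

/-! ### The free group and its balls -/

/-- The free group of rank `r`, with free generators `FreeGroup.of i`, `i : Fin r`. -/
abbrev Gp (r : ℕ) : Type := FreeGroup (Fin r)

theorem finite_ball {r : ℕ} (h : Gp r) (k : ℕ) :
    {g : Gp r | FreeGroup.norm (g * h⁻¹) ≤ k}.Finite := by
  have hf : {l : List (Fin r × Bool) | l.length ≤ k}.Finite := List.finite_length_le _ _
  have hi : Function.Injective (fun g : Gp r => (g * h⁻¹).toWord) :=
    FreeGroup.toWord_injective.comp (mul_left_injective h⁻¹)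
  exact hf.preimage hi.injOn

/-- The closed ball of radius `k` around `h` for the right-invariant word metric
`d(g, h) = |g h⁻¹|`; thus `ball h k = (ball 1 k) h`. -/
def ball {r : ℕ} (h : Gp r) (k : ℕ) : Finset (Gp r) := (finite_ball h k).toFinset

/-! ### Itineraries, entropy and the `f`-invariant -/

section Systems

variable {r : ℕ} {X A B : Type*}

/-- The itinerary `α^G : X → A^G` of an observable `α` under the action `T`. -/
def itin (T : Gp r →* Equiv.Perm X) (α : X → A) (x : X) : Gp r → A :=
  fun g => α (T g x)

/-- The partial itinerary `α^H : X → A^H`, for a finite set `H` of group elements. -/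
def itinOn (T : Gp r →* Equiv.Perm X) (α : X → A) (H : Finset (Gp r)) (x : X) : H → A :=
  fun g => α (T g x)

/-- `α^k`, the partial itinerary over the ball of radius `k` around the identity. -/
def itinBall (T : Gp r →* Equiv.Perm X) (α : X → A) (k : ℕ) : X → (ball (1 : Gp r) k → A) :=
  itinOn T α (ball 1 k)

/-- The joint observable `αβ`. -/
def joint (α : X → A) (β : X → B) (x : X) : A × B := (α x, β x)

variable [MeasurableSpace X] [MeasurableSpace A] [MeasurableSpace B]

/-- Shannon entropy (natural logarithm, `0 log 0 = 0`) of a finite observable. -/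
def shannon [Fintype A] (μ : Measure X) (α : X → A) : ℝ :=
  ∑ a : A, Real.negMulLog ((μ.map α).real {a})

/-- `F_μ(T, α) = (1 - 2r) H(α) + ∑ᵢ H(α^{e, sᵢ})`. -/
def bigF [Fintype A] (μ : Measure X) (T : Gp r →* Equiv.Perm X) (α : X → A) : ℝ :=
  (1 - 2 * (r : ℝ)) * shannon μ α
    + ∑ i : Fin r, shannon μ (itinOn T α {1, FreeGroup.of i})

/-- The `f`-invariant `f_μ(T, α) = inf_k F_μ(T, α^k)`, with values in `[-∞, ∞]`. -/
def fInv [Fintype A] (μ : Measure X) (T : Gp r →* Equiv.Perm X) (α : X → A) : EReal :=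
  ⨅ k : ℕ, ((bigF μ T (itinBall T α k) : ℝ) : EReal)

/-- The relative version `F_μ(T, α | β) = F_μ(T, αβ) - F_μ(T, β)`. -/
def bigFRel [Fintype A] [Fintype B] (μ : Measure X) (T : Gp r →* Equiv.Perm X)
    (α : X → A) (β : X → B) : ℝ :=
  bigF μ T (joint α β) - bigF μ T β

/-- The relative `f`-invariant, as the iterated limit (`k₂ → ∞` first, then `k₁ → ∞`) of
`F_μ(T, α^{k₁} | β^{k₂})`, with values in `[-∞, ∞]`. The limit in `k₂` is written as an upper
limit, and the one in `k₁` as an infimum, so that the expression is defined unconditionally. -/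
def fRel [Fintype A] [Fintype B] (μ : Measure X) (T : Gp r →* Equiv.Perm X)
    (α : X → A) (β : X → B) : EReal :=
  ⨅ k₁ : ℕ, limsup
    (fun k₂ : ℕ => ((bigFRel μ T (itinBall T α k₁) (itinBall T β k₂) : ℝ) : EReal)) atTop

end Systems

/-! ### Pseudometrics on laws of itineraries -/

section Laws

variable {r : ℕ} {A : Type*} [MeasurableSpace A]

/-- `d^H`: total variation distance (half the `ℓ¹` distance) of the marginals on `A^H`. -/
def dOn [Fintype A] (H : Finset (Gp r)) (P Q : Measure (Gp r → A)) : ℝ :=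
  (1 / 2) * ∑ a : H → A,
    |(P.map H.restrict).real {a} - (Q.map H.restrict).real {a}|

/-- `d*_k = ∑ᵢ d^{B(e,k) ∪ B(sᵢ,k)}`. -/
def dStar [Fintype A] (k : ℕ) (P Q : Measure (Gp r → A)) : ℝ :=
  ∑ i : Fin r, dOn (ball 1 k ∪ ball (FreeGroup.of i) k) P Q

/-- The empirical distribution of a labeling `x ∈ A^n` over a homomorphism `σ`: the law of its
itinerary under the uniform distribution on `Fin n` (a probability measure when `0 < n`). -/
def empirical {n : ℕ} (σ : Gp r →* Equiv.Perm (Fin n)) (x : Fin n → A) : Measure (Gp r → A) :=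
  (ProbabilityTheory.uniformOn (Set.univ : Set (Fin n))).map (itin σ x)

/-- `Ω(σ, O)`: the labelings whose empirical distribution is a member of `O`. -/
def goodModels {n : ℕ} (σ : Gp r →* Equiv.Perm (Fin n))
    (O : Set (ProbabilityMeasure (Gp r → A))) : Set (Fin n → A) :=
  {x | ∃ P ∈ O, (P : Measure (Gp r → A)) = empirical σ x}

end Laws

/-! ### The stochastic block model -/

section SBM

variable {r : ℕ} {A B : Type*}

/-- The finite set `Hom(G, Sym(n))` carries the discrete σ-algebra. -/
instance instMeasurableSpaceHom (r n : ℕ) : MeasurableSpace (Gp r →* Equiv.Perm (Fin n)) := ⊤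

variable [MeasurableSpace A] [MeasurableSpace B]

/-- `SBM(σ₀, y₀, k)`: the uniform distribution on the (finite, nonempty) set of all
`σ ∈ Hom(G, Sym(n))` with `d*_k(P^σ_{y₀}, P^{σ₀}_{y₀}) = 0`. -/
def sbm [Fintype B] {n : ℕ} (σ₀ : Gp r →* Equiv.Perm (Fin n)) (y₀ : Fin n → B) (k : ℕ) :
    Measure (Gp r →* Equiv.Perm (Fin n)) :=
  ProbabilityTheory.uniformOn {σ | dStar k (empirical σ y₀) (empirical σ₀ y₀) = 0}

/-- `E_{σ ∼ ν} |{x ∈ A^n : (x, y) ∈ Ω(σ, O)}|`. -/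
def expectedExtensions {n : ℕ} (ν : Measure (Gp r →* Equiv.Perm (Fin n))) (y : Fin n → B)
    (O : Set (ProbabilityMeasure (Gp r → A × B))) : ENNReal :=
  ∫⁻ σ, (({x : Fin n → A | joint x y ∈ goodModels σ O}.ncard : ℕ) : ENNReal) ∂ν

end SBM

end RelF

end

/-! The expectation is a ratio of two cardinalities, both of which are counted exactly and compared
by Stirling's formula. Simultaneously conjugating `σ` and relabeling by a permutation preserves
empirical distributions and acts transitively on the labelings `y` with given value counts. Hence
fixing `y_n` or letting `y` vary over all labelings with the same statistics changes the number of
pairs by a common factor, and the expectation equals `|goodPairs| / |statPairs|`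
(`expectedExtensions_eq`).

The basic count is that of an edge class: the pairs `(σ, z)` for which every edge labeling `j ↦ (z
j, z (σ(sᵢ) j))` has prescribed value counts. Since the group is free, the images of the generators
are chosen independently, and the number is a quotient of factorials (`card_edgeClass_mul`); its
logarithm is `r (n log n - n) + n F(σ, z)` up to a small error (`abs_log_card_edgeClass_sub_le`).
Replacing a labeling by its patterns on balls turns a condition on `dStar` into a condition on edge
counts, so the denominator is exactly an edge class, of exponent `F_μ(T, β^{m_n}) + o(1)` after
removal of the common main term. The hypothesis `m_n = o(log log n)` keeps the alphabet of ball
patterns below `exp (c √(log n))`, and an error `O(1 / log n)` in the statistics then moves `F` by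
only `o(1)`.

Upper bound on the numerator (`card_goodPairs_le`): a good pair lifts to a labeling by patterns of
`α^{k₁}` and `β^{k₂}` whose `F` is near `F_μ(T, α^{k₁} β^{k₂})`, and there are only polynomially
many edge classes over this fixed alphabet. Lower bound (`le_card_goodPairs`):
`exists_edge_extension` produces a finite model of `(α^k, β^{m_n})` with exactly the given
statistics in the second coordinate. All members of its edge class are, up to few errors, lifts of
good pairs, and each good pair arises from at most a Hamming ball of members.

The rate thus lies asymptotically between `F_μ(T, α^k β^{m_n}) - F_μ(T, β^{m_n})` and `F_μ(T, α^{k₁}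
β^{k₂}) - F_μ(T, β^{m_n})`. Enlarging the ball in the `β` coordinate is a sequence of splittings,
which do not increase `F` (`bigF_le_of_splitting`). As `f_μ(T, β) > -∞`, the numbers `F_μ(T, β^k)`
decrease to a finite limit, and both bounds become the relative invariant. -/

noncomputable section

namespace RelF

/-! ### Laws of finite observables -/

section Law

variable {X Z Λ Λ' : Type*} [MeasurableSpace X] [MeasurableSpace Z]
  [MeasurableSpace Λ] [MeasurableSpace Λ']

/-- The probability mass function of a finite observable. -/
def law (μ : Measure X) (γ : X → Λ) (a : Λ) : ℝ := (μ.map γ).real {a}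

theorem law_nonneg (μ : Measure X) (γ : X → Λ) (a : Λ) : 0 ≤ law μ γ a := measureReal_nonneg

theorem law_eq [MeasurableSingletonClass Λ] {μ : Measure X} {γ : X → Λ} (hγ : Measurable γ)
    (a : Λ) : law μ γ a = μ.real (γ ⁻¹' {a}) :=
  map_measureReal_apply hγ (measurableSet_singleton a)

theorem law_comp [Fintype Λ] [MeasurableSingletonClass Λ] [MeasurableSingletonClass Λ']
    [DecidableEq Λ'] {μ : Measure X} [IsFiniteMeasure μ] {γ : X → Λ} (hγ : Measurable γ)
    (φ : Λ → Λ') (b : Λ') :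
    law μ (φ ∘ γ) b = ∑ a with φ a = b, law μ γ a := by
  have hφ : Measurable φ := measurable_of_finite φ
  have h1 : ∀ a, law μ γ a = μ.real (γ ⁻¹' {a}) := fun a => law_eq hγ a
  rw [law_eq (hφ.comp hγ), Finset.sum_congr rfl fun a _ => h1 a,
    sum_measureReal_preimage_singleton _ fun a _ => hγ (measurableSet_singleton a)]
  congr 1
  ext x
  simp

theorem sum_law [Fintype Λ] [MeasurableSingletonClass Λ] {μ : Measure X} [IsProbabilityMeasure μ]
    {γ : X → Λ} (hγ : Measurable γ) : ∑ a, law μ γ a = 1 := by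
  rw [Finset.sum_congr rfl fun a _ => law_eq hγ a,
    sum_measureReal_preimage_singleton _ fun a _ => hγ (measurableSet_singleton a)]
  simp

theorem law_le_one [MeasurableSingletonClass Λ] {μ : Measure X} [IsProbabilityMeasure μ]
    {γ : X → Λ} (hγ : Measurable γ) (a : Λ) : law μ γ a ≤ 1 := by
  rw [law_eq hγ]; exact measureReal_le_one

theorem law_comp_measurePreserving [MeasurableSingletonClass Λ] {μ : Measure X} {γ : X → Λ}
    (hγ : Measurable γ) {τ : X → X} (hτ : MeasurePreserving τ μ μ) (a : Λ) :
    law μ (γ ∘ τ) a = law μ γ a := by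
  unfold law
  rw [← Measure.map_map hγ hτ.measurable, hτ.map_eq]

theorem law_pos_imp [MeasurableSingletonClass Λ] {μ : Measure X} {γ : X → Λ} (hγ : Measurable γ)
    {a : Λ} (h : law μ γ a ≠ 0) : ∃ x, γ x = a := by
  by_contra! hc
  apply h
  rw [law_eq hγ]
  have : γ ⁻¹' {a} = ∅ := by ext x; simp [hc x]
  simp [this]

/-- The `ℓ¹` distance of the laws of two observables. -/
def lawDist [Fintype Λ] (μ : Measure X) (γ : X → Λ) (ν : Measure Z) (δ : Z → Λ) : ℝ :=
  ∑ a, |law μ γ a - law ν δ a|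

theorem lawDist_nonneg [Fintype Λ] (μ : Measure X) (γ : X → Λ) (ν : Measure Z) (δ : Z → Λ) :
    0 ≤ lawDist μ γ ν δ := Finset.sum_nonneg fun _ _ => abs_nonneg _

theorem lawDist_comm [Fintype Λ] (μ : Measure X) (γ : X → Λ) (ν : Measure Z) (δ : Z → Λ) :
    lawDist μ γ ν δ = lawDist ν δ μ γ := by
  simp only [lawDist, abs_sub_comm]

theorem lawDist_triangle {Y : Type*} [MeasurableSpace Y] [Fintype Λ] (μ : Measure X) (γ : X → Λ)
    (ν : Measure Z) (δ : Z → Λ) (ρ : Measure Y) (ε : Y → Λ) :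
    lawDist μ γ ρ ε ≤ lawDist μ γ ν δ + lawDist ν δ ρ ε := by
  unfold lawDist
  rw [← Finset.sum_add_distrib]
  exact Finset.sum_le_sum fun _ _ => abs_sub_le _ _ _

theorem lawDist_comp_le [Fintype Λ] [Fintype Λ'] [MeasurableSingletonClass Λ]
    [MeasurableSingletonClass Λ'] {μ : Measure X} [IsFiniteMeasure μ] {ν : Measure Z}
    [IsFiniteMeasure ν] {γ : X → Λ} (hγ : Measurable γ) {δ : Z → Λ} (hδ : Measurable δ)
    (φ : Λ → Λ') : lawDist μ (φ ∘ γ) ν (φ ∘ δ) ≤ lawDist μ γ ν δ := by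
  classical
  unfold lawDist
  calc ∑ b, |law μ (φ ∘ γ) b - law ν (φ ∘ δ) b|
      = ∑ b, |∑ a with φ a = b, (law μ γ a - law ν δ a)| := by
        refine Finset.sum_congr rfl fun b _ => ?_
        rw [law_comp hγ, law_comp hδ, Finset.sum_sub_distrib]
    _ ≤ ∑ b, ∑ a with φ a = b, |law μ γ a - law ν δ a| :=
        Finset.sum_le_sum fun b _ => Finset.abs_sum_le_sum_abs _ _
    _ = ∑ a, |law μ γ a - law ν δ a| := Finset.sum_fiberwise _ _ _

end Law

/-! ### Shannon entropy -/

section Entropy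

variable {X Z Λ Λ' Λ'' : Type*} [Fintype Λ] [Fintype Λ'] [Fintype Λ'']

/-- Strong subadditivity of entropy. With marginals `q`, `s`, `w`, the inequality `log x ≤ x - 1` at
`x = q s / (w p)` bounds each term by `q s / w - p`, and these bounds sum to zero. -/
theorem negMulLog_submodular (p : Λ → Λ' → Λ'' → ℝ) (hp : ∀ a b c, 0 ≤ p a b c) :
    ∑ a, ∑ b, ∑ c, Real.negMulLog (p a b c) + ∑ c, Real.negMulLog (∑ a, ∑ b, p a b c) ≤
      ∑ a, ∑ c, Real.negMulLog (∑ b, p a b c) + ∑ b, ∑ c, Real.negMulLog (∑ a, p a b c) := by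
  set q : Λ → Λ'' → ℝ := fun a c => ∑ b, p a b c with hq
  set s : Λ' → Λ'' → ℝ := fun b c => ∑ a, p a b c with hs
  set w : Λ'' → ℝ := fun c => ∑ a, ∑ b, p a b c with hw
  have hq0 : ∀ a c, 0 ≤ q a c := fun a c => Finset.sum_nonneg fun b _ => hp a b c
  have hs0 : ∀ b c, 0 ≤ s b c := fun b c => Finset.sum_nonneg fun a _ => hp a b c
  have hw0 : ∀ c, 0 ≤ w c := fun c => Finset.sum_nonneg fun a _ => hq0 a c
  have hws : ∀ c, w c = ∑ b, s b c := fun c => Finset.sum_comm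
  have e1 : ∑ c, Real.negMulLog (w c) = ∑ a, ∑ b, ∑ c, -(p a b c * Real.log (w c)) := by
    rw [Finset.sum_congr rfl fun a _ => Finset.sum_comm, Finset.sum_comm]
    refine Finset.sum_congr rfl fun c _ => ?_
    simp only [Finset.sum_neg_distrib, ← Finset.sum_mul, Real.negMulLog, hw, neg_mul]
  have e2 : ∑ a, ∑ c, Real.negMulLog (q a c) = ∑ a, ∑ b, ∑ c, -(p a b c * Real.log (q a c)) := by
    refine Finset.sum_congr rfl fun a _ => ?_
    rw [Finset.sum_comm]
    refine Finset.sum_congr rfl fun c _ => ?_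
    simp only [Finset.sum_neg_distrib, ← Finset.sum_mul, Real.negMulLog, hq, neg_mul]
  have e3 : ∑ b, ∑ c, Real.negMulLog (s b c) = ∑ a, ∑ b, ∑ c, -(p a b c * Real.log (s b c)) := by
    rw [Finset.sum_comm (γ := Λ)]
    refine Finset.sum_congr rfl fun b _ => ?_
    rw [Finset.sum_comm]
    refine Finset.sum_congr rfl fun c _ => ?_
    simp only [Finset.sum_neg_distrib, ← Finset.sum_mul, Real.negMulLog, hs, neg_mul]
  have key : ∀ a b c, Real.negMulLog (p a b c) + -(p a b c * Real.log (w c)) -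
      -(p a b c * Real.log (q a c)) - -(p a b c * Real.log (s b c)) ≤
      q a c * s b c / w c - p a b c := by
    intro a b c
    rcases (hp a b c).eq_or_lt with h0 | hpos
    · rw [← h0]
      simpa using div_nonneg (mul_nonneg (hq0 a c) (hs0 b c)) (hw0 c)
    · have hqp : 0 < q a c := hpos.trans_le
        (Finset.single_le_sum (f := fun b => p a b c) (fun b _ => hp a b c) (Finset.mem_univ b))
      have hsp : 0 < s b c := hpos.trans_le
        (Finset.single_le_sum (f := fun a => p a b c) (fun a _ => hp a b c) (Finset.mem_univ a))
      have hwp : 0 < w c := hqp.trans_le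
        (Finset.single_le_sum (f := fun a => q a c) (fun a _ => hq0 a c) (Finset.mem_univ a))
      have hl := Real.log_le_sub_one_of_pos
        (x := q a c * s b c / (w c * p a b c)) (by positivity)
      rw [Real.log_div (by positivity) (by positivity), Real.log_mul hqp.ne' hsp.ne',
        Real.log_mul hwp.ne' hpos.ne'] at hl
      have := mul_le_mul_of_nonneg_left hl hpos.le
      have h2 : p a b c * (q a c * s b c / (w c * p a b c) - 1) =
          q a c * s b c / w c - p a b c := by field_simp
      rw [h2] at this
      refine le_trans (le_of_eq ?_) this
      rw [Real.negMulLog]; ring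
  have htot : ∑ a, ∑ b, ∑ c, (q a c * s b c / w c - p a b c) = 0 := by
    rw [Finset.sum_congr rfl fun a _ => Finset.sum_comm, Finset.sum_comm]
    refine Finset.sum_eq_zero fun c _ => ?_
    have : ∑ a, ∑ b, q a c * s b c / w c = w c * w c / w c := by
      conv_rhs => rw [show w c * w c = (∑ a, q a c) * ∑ b, s b c by rw [← hws]]
      rw [Finset.sum_mul_sum, Finset.sum_div]
      simp only [Finset.sum_div]
    simp only [Finset.sum_sub_distrib, this]
    -- Valid also when `w c = 0`, because division by zero gives zero.
    rw [mul_self_div_self]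
    simp [hw]
  have hsum := Finset.sum_le_sum fun a (_ : a ∈ Finset.univ) => Finset.sum_le_sum
    fun b (_ : b ∈ Finset.univ) => Finset.sum_le_sum fun c (_ : c ∈ Finset.univ) => key a b c
  rw [htot] at hsum
  simp only [Finset.sum_sub_distrib, Finset.sum_add_distrib] at hsum
  rw [e1, e2, e3]
  linarith

variable [MeasurableSpace X] [MeasurableSpace Z]
  [MeasurableSpace Λ] [MeasurableSpace Λ'] [MeasurableSpace Λ'']

theorem shannon_eq_sum_law (μ : Measure X) (γ : X → Λ) :
    shannon μ γ = ∑ a, Real.negMulLog (law μ γ a) := rfl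

variable [MeasurableSingletonClass Λ] [MeasurableSingletonClass Λ']
  [MeasurableSingletonClass Λ'']

theorem shannon_joint_of_factor {μ : Measure X} {γ : X → Λ} {δ : X → Λ'}
    (hγ : Measurable γ) (hδ : Measurable δ) (h : ∀ x y, γ x = γ y → δ x = δ y) :
    shannon μ (joint γ δ) = shannon μ γ := by
  have hm : Measurable (joint γ δ) := hγ.prodMk hδ
  simp only [shannon_eq_sum_law, Fintype.sum_prod_type]
  refine Finset.sum_congr rfl fun a _ => ?_
  by_cases ha : ∃ x, γ x = a
  · obtain ⟨x, rfl⟩ := ha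
    rw [Finset.sum_eq_single (δ x)]
    · congr 1
      rw [law_eq hm, law_eq hγ]
      congr 1
      ext z
      simp only [joint, Set.mem_preimage, Set.mem_singleton_iff, Prod.mk.injEq]
      exact ⟨fun h => h.1, fun hz => ⟨hz, h _ _ hz⟩⟩
    · intro b _ hb
      rw [law_eq hm]
      have : joint γ δ ⁻¹' {(γ x, b)} = ∅ := by
        ext z
        simp only [joint, Set.mem_preimage, Set.mem_singleton_iff, Prod.mk.injEq,
          Set.mem_empty_iff_false, iff_false, not_and]
        rintro hz rfl
        exact hb (h _ _ hz)
      simp [this]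
    · simp
  · push Not at ha
    have h1 : law μ γ a = 0 := by
      by_contra hc
      obtain ⟨x, hx⟩ := law_pos_imp hγ hc
      exact ha x hx
    rw [h1, Real.negMulLog_zero]
    refine Finset.sum_eq_zero fun b _ => ?_
    have h2 : law μ (joint γ δ) (a, b) = 0 := by
      by_contra hc
      obtain ⟨x, hx⟩ := law_pos_imp hm hc
      exact ha x (congrArg Prod.fst hx)
    rw [h2, Real.negMulLog_zero]

theorem shannon_joint_comm {μ : Measure X} {γ : X → Λ} {δ : X → Λ'}
    (hγ : Measurable γ) (hδ : Measurable δ) :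
    shannon μ (joint γ δ) = shannon μ (joint δ γ) := by
  have hm : Measurable (joint γ δ) := hγ.prodMk hδ
  have hm' : Measurable (joint δ γ) := hδ.prodMk hγ
  simp only [shannon_eq_sum_law, Fintype.sum_prod_type]
  rw [Finset.sum_comm]
  refine Finset.sum_congr rfl fun b _ => Finset.sum_congr rfl fun a _ => ?_
  rw [law_eq hm, law_eq hm']
  congr 2
  ext z
  simp [joint, and_comm]

/-- Entropy only depends on the partition generated by an observable. -/
theorem shannon_congr {μ : Measure X} {γ : X → Λ} {δ : X → Λ'}
    (hγ : Measurable γ) (hδ : Measurable δ) (h : ∀ x y, γ x = γ y ↔ δ x = δ y) :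
    shannon μ γ = shannon μ δ := by
  rw [← shannon_joint_of_factor hγ hδ fun x y => (h x y).1, shannon_joint_comm hγ hδ,
    shannon_joint_of_factor hδ hγ fun x y => (h x y).2]

theorem shannon_submodular {μ : Measure X} [IsFiniteMeasure μ] {γ : X → Λ} {δ : X → Λ'}
    {ε : X → Λ''} (hγ : Measurable γ) (hδ : Measurable δ) (hε : Measurable ε) :
    shannon μ (joint γ (joint δ ε)) + shannon μ ε ≤
      shannon μ (joint γ ε) + shannon μ (joint δ ε) := by
  classical
  have hm : Measurable (joint γ (joint δ ε)) := hγ.prodMk (hδ.prodMk hε)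
  have := negMulLog_submodular (fun a b c => law μ (joint γ (joint δ ε)) (a, b, c))
    fun a b c => law_nonneg _ _ _
  have h1 : ∀ c, law μ ε c = ∑ a, ∑ b, law μ (joint γ (joint δ ε)) (a, b, c) := by
    intro c
    have : law μ ε c = _ := law_comp hm (fun z : Λ × Λ' × Λ'' => z.2.2) c (μ := μ)
    rw [Finset.sum_filter] at this
    simpa [Fintype.sum_prod_type] using this
  have h2 : ∀ a c, law μ (joint γ ε) (a, c) =
      ∑ b, law μ (joint γ (joint δ ε)) (a, b, c) := by
    intro a c
    have : law μ (joint γ ε) (a, c) = _ :=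
      law_comp hm (fun z : Λ × Λ' × Λ'' => (z.1, z.2.2)) (a, c) (μ := μ)
    rw [Finset.sum_filter] at this
    simpa [Fintype.sum_prod_type, ite_and] using this
  have h3 : ∀ b c, law μ (joint δ ε) (b, c) =
      ∑ a, law μ (joint γ (joint δ ε)) (a, b, c) := by
    intro b c
    have : law μ (joint δ ε) (b, c) = _ :=
      law_comp hm (fun z : Λ × Λ' × Λ'' => (z.2.1, z.2.2)) (b, c) (μ := μ)
    rw [Finset.sum_filter] at this
    simpa [Fintype.sum_prod_type, ite_and] using this
  simp only [shannon_eq_sum_law, Fintype.sum_prod_type, h1, h2, h3]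
  exact this

/-- A modulus of continuity for `negMulLog`. -/
theorem abs_negMulLog_sub_le {x y : ℝ} (hx : 0 ≤ x) (hx1 : x ≤ 1) (hy : 0 ≤ y) (hy1 : y ≤ 1)
    (L : ℝ) :
    |Real.negMulLog x - Real.negMulLog y| ≤ L * |x - y| + Real.exp (-L) := by
  wlog hxy : y ≤ x generalizing x y
  · rw [abs_sub_comm, abs_sub_comm x]
    exact this hy hy1 hx hx1 (le_of_not_ge hxy)
  obtain ⟨d, rfl⟩ : ∃ d, x = y + d := ⟨x - y, by ring⟩
  have hd : 0 ≤ d := by linarith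
  rw [show y + d - y = d by ring, abs_of_nonneg hd]
  -- An increase of `negMulLog` over a step `d` is at most `negMulLog d`, a decrease at most `d`, so
  -- one bound on the sum serves both. It is `log x ≤ x - 1` at `x = exp (-L) / d`.
  have hdL : Real.negMulLog d + d ≤ L * d + Real.exp (-L) := by
    rcases hd.eq_or_lt with rfl | hpos
    · simp [Real.exp_nonneg]
    · have h := Real.log_le_sub_one_of_pos (x := Real.exp (-L) / d) (by positivity)
      rw [Real.log_div (by positivity) hpos.ne', Real.log_exp] at h
      have := mul_le_mul_of_nonneg_left h hpos.le
      have h2 : d * (Real.exp (-L) / d - 1) = Real.exp (-L) - d := by field_simp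
      rw [h2] at this
      rw [Real.negMulLog]
      linarith
  have hd1 : 0 ≤ Real.negMulLog d := Real.negMulLog_nonneg hd (by linarith)
  rw [abs_le]
  constructor
  · -- `η y - η (y + d) ≤ d`
    have : Real.negMulLog y - Real.negMulLog (y + d) ≤ d := by
      rcases hy.eq_or_lt with rfl | hpos
      · have := Real.negMulLog_nonneg hx hx1
        simp only [Real.negMulLog_zero]
        linarith
      · have h := Real.log_le_sub_one_of_pos (x := (y + d) / y) (by positivity)
        rw [Real.log_div (by positivity) hpos.ne'] at h
        have h1 := mul_le_mul_of_nonneg_left h hpos.le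
        have h2 : y * ((y + d) / y - 1) = d := by field_simp; ring
        have h3 : Real.log (y + d) ≤ 0 := Real.log_nonpos hx hx1
        rw [h2] at h1
        simp only [Real.negMulLog]
        nlinarith
    linarith
  · have : Real.negMulLog (y + d) - Real.negMulLog y ≤ Real.negMulLog d := by
      rcases hy.eq_or_lt with rfl | hypos
      · simp
      rcases hd.eq_or_lt with rfl | hpos
      · simp
      have h1 : Real.log y ≤ Real.log (y + d) := Real.log_le_log hypos (by linarith)
      have h2 : Real.log d ≤ Real.log (y + d) := Real.log_le_log hpos (by linarith)
      simp only [Real.negMulLog]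
      nlinarith
    linarith

/-- The parameter `L` is left free: a large `L` suppresses the size of the alphabet at the price of
a factor on the distance. It is taken of order `√(log n)` when the alphabet grows with `n`. -/
theorem abs_shannon_sub_le {μ : Measure X} [IsProbabilityMeasure μ] {ν : Measure Z}
    [IsProbabilityMeasure ν] {γ : X → Λ} (hγ : Measurable γ) {δ : Z → Λ} (hδ : Measurable δ)
    (L : ℝ) :
    |shannon μ γ - shannon ν δ| ≤ L * lawDist μ γ ν δ + Fintype.card Λ * Real.exp (-L) := by
  simp only [shannon_eq_sum_law, lawDist]
  rw [← Finset.sum_sub_distrib, Finset.mul_sum]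
  refine (Finset.abs_sum_le_sum_abs _ _).trans ?_
  refine (Finset.sum_le_sum fun a _ => abs_negMulLog_sub_le (law_nonneg _ _ _)
    (law_le_one hγ a) (law_nonneg _ _ _) (law_le_one hδ a) L).trans ?_
  rw [Finset.sum_add_distrib]
  simp

end Entropy

/-! ### Edge observables -/

section Edge

variable {r : ℕ} {X Z Λ Λ' : Type*}

/-- The pair observable `x ↦ (γ x, γ (sᵢ x))`. -/
def edge (T : Gp r →* Equiv.Perm X) (γ : X → Λ) (i : Fin r) (x : X) : Λ × Λ :=
  (γ x, γ (T (FreeGroup.of i) x))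

theorem edge_comp (T : Gp r →* Equiv.Perm X) (γ : X → Λ) (φ : Λ → Λ') (i : Fin r) :
    edge T (φ ∘ γ) i = Prod.map φ φ ∘ edge T γ i := rfl

variable [MeasurableSpace X] [MeasurableSpace Z] [MeasurableSpace Λ] [MeasurableSpace Λ']

theorem measurable_edge {T : Gp r →* Equiv.Perm X} (hT : ∀ g, Measurable (T g)) {γ : X → Λ}
    (hγ : Measurable γ) (i : Fin r) : Measurable (edge T γ i) :=
  hγ.prodMk (hγ.comp (hT _))

theorem measurable_itinOn {T : Gp r →* Equiv.Perm X} (hT : ∀ g, Measurable (T g)) {γ : X → Λ}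
    (hγ : Measurable γ) (H : Finset (Gp r)) : Measurable (itinOn T γ H) :=
  measurable_pi_lambda _ fun g => hγ.comp (hT g)

theorem measurable_itin {T : Gp r →* Equiv.Perm X} (hT : ∀ g, Measurable (T g)) {γ : X → Λ}
    (hγ : Measurable γ) : Measurable (itin T γ) :=
  measurable_pi_lambda _ fun g => hγ.comp (hT g)

theorem measurable_joint {γ : X → Λ} {δ : X → Λ'} (hγ : Measurable γ) (hδ : Measurable δ) :
    Measurable (joint γ δ) := hγ.prodMk hδ

variable [Fintype Λ] [Fintype Λ'] [MeasurableSingletonClass Λ] [MeasurableSingletonClass Λ']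

theorem shannon_itinOn_pair {μ : Measure X} {T : Gp r →* Equiv.Perm X}
    (hT : ∀ g, Measurable (T g)) {γ : X → Λ} (hγ : Measurable γ) (i : Fin r) :
    shannon μ (itinOn T γ {1, FreeGroup.of i}) = shannon μ (edge T γ i) := by
  refine shannon_congr (measurable_itinOn hT hγ _) (measurable_edge hT hγ i) fun x y => ?_
  simp [itinOn, edge, funext_iff]

theorem bigF_eq {μ : Measure X} {T : Gp r →* Equiv.Perm X}
    (hT : ∀ g, Measurable (T g)) {γ : X → Λ} (hγ : Measurable γ) :
    bigF μ T γ = (1 - 2 * (r : ℝ)) * shannon μ γ + ∑ i, shannon μ (edge T γ i) := by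
  simp only [bigF, shannon_itinOn_pair hT hγ]

theorem bigF_congr {μ : Measure X} {T : Gp r →* Equiv.Perm X}
    (hT : ∀ g, Measurable (T g)) {γ : X → Λ} (hγ : Measurable γ) {δ : X → Λ'} (hδ : Measurable δ)
    (h : ∀ x y, γ x = γ y ↔ δ x = δ y) : bigF μ T γ = bigF μ T δ := by
  rw [bigF_eq hT hγ, bigF_eq hT hδ, shannon_congr hγ hδ h]
  congr 1
  refine Finset.sum_congr rfl fun i _ => ?_
  refine shannon_congr (measurable_edge hT hγ i) (measurable_edge hT hδ i) fun x y => ?_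
  simp [edge, h]

/-- Vertex laws are marginals of edge laws, so closeness on edges suffices. The vertex term has
weight at most `2 r + 1` and the edges contribute `r`. The square is the size of the edge alphabet.
-/
theorem abs_bigF_sub_le (hr : 1 ≤ r) {μ : Measure X} [IsProbabilityMeasure μ] {ν : Measure Z}
    [IsProbabilityMeasure ν] {T : Gp r →* Equiv.Perm X} (hT : ∀ g, Measurable (T g))
    {S : Gp r →* Equiv.Perm Z} (hS : ∀ g, Measurable (S g))
    {γ : X → Λ} (hγ : Measurable γ) {δ : Z → Λ} (hδ : Measurable δ) {D : ℝ}
    (hD : ∀ i, lawDist μ (edge T γ i) ν (edge S δ i) ≤ D) {L : ℝ} (hL : 0 ≤ L) :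
    |bigF μ T γ - bigF ν S δ| ≤
      (3 * r + 1) * (L * D + (Fintype.card Λ : ℝ) ^ 2 * Real.exp (-L)) := by
  set E := L * D + (Fintype.card Λ : ℝ) ^ 2 * Real.exp (-L) with hE
  have hedge : ∀ i, |shannon μ (edge T γ i) - shannon ν (edge S δ i)| ≤ E := by
    intro i
    refine (abs_shannon_sub_le (measurable_edge hT hγ i) (measurable_edge hS hδ i) L).trans ?_
    rw [hE, Fintype.card_prod, Nat.cast_mul, ← sq]
    gcongr
    exact hD i
  have hvert : |shannon μ γ - shannon ν δ| ≤ E := by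
    refine (abs_shannon_sub_le hγ hδ L).trans ?_
    have h1 : lawDist μ γ ν δ ≤ D :=
      (lawDist_comp_le (measurable_edge hT hγ ⟨0, hr⟩) (measurable_edge hS hδ ⟨0, hr⟩)
        Prod.fst).trans (hD _)
    have h2 : (Fintype.card Λ : ℝ) ≤ (Fintype.card Λ : ℝ) ^ 2 := by
      exact_mod_cast Nat.le_self_pow two_ne_zero _
    rw [hE]
    gcongr
  have hE0 : 0 ≤ E := (abs_nonneg _).trans hvert
  rw [bigF_eq hT hγ, bigF_eq hS hδ]
  have : (1 - 2 * (r : ℝ)) * shannon μ γ + ∑ i, shannon μ (edge T γ i) -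
      ((1 - 2 * (r : ℝ)) * shannon ν δ + ∑ i, shannon ν (edge S δ i)) =
      (1 - 2 * (r : ℝ)) * (shannon μ γ - shannon ν δ) +
        ∑ i, (shannon μ (edge T γ i) - shannon ν (edge S δ i)) := by
    rw [Finset.sum_sub_distrib]; ring
  rw [this]
  have hr' : (1 : ℝ) ≤ r := by exact_mod_cast hr
  calc _ ≤ |(1 - 2 * (r : ℝ)) * (shannon μ γ - shannon ν δ)| +
        |∑ i, (shannon μ (edge T γ i) - shannon ν (edge S δ i))| := abs_add_le _ _
    _ ≤ (2 * r + 1) * E + ∑ _i : Fin r, E := by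
        rw [abs_mul]
        gcongr
        · rw [abs_le]; constructor <;> linarith
        · exact (Finset.abs_sum_le_sum_abs _ _).trans (Finset.sum_le_sum fun i _ => hedge i)
    _ = (3 * r + 1) * E := by simp; ring

end Edge

/-! ### Balls -/

section Balls

variable {r : ℕ}

theorem mem_ball {h g : Gp r} {k : ℕ} : g ∈ ball h k ↔ FreeGroup.norm (g * h⁻¹) ≤ k := by
  simp [ball]

theorem mem_ball_one {g : Gp r} {k : ℕ} : g ∈ ball 1 k ↔ FreeGroup.norm g ≤ k := by
  simp [mem_ball]

theorem one_mem_ball (k : ℕ) : (1 : Gp r) ∈ ball 1 k := by simp [mem_ball_one]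

theorem mem_ball_iff {h g : Gp r} {k : ℕ} : g ∈ ball h k ↔ g * h⁻¹ ∈ ball 1 k := by
  simp [mem_ball]

theorem ball_mono {k l : ℕ} (hkl : k ≤ l) (h : Gp r) : ball h k ⊆ ball h l := fun g hg => by
  rw [mem_ball] at *; omega

theorem mk_mem_ball {L : List (Fin r × Bool)} {k : ℕ} (h : L.length ≤ k) :
    (FreeGroup.mk L : Gp r) ∈ ball 1 k :=
  mem_ball_one.2 (FreeGroup.norm_mk_le.trans h)

theorem exists_mk_of_mem_ball {g : Gp r} {k : ℕ} (h : g ∈ ball 1 k) :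
    ∃ L : List (Fin r × Bool), L.length ≤ k ∧ FreeGroup.mk L = g :=
  ⟨g.toWord, mem_ball_one.1 h, FreeGroup.mk_toWord⟩

/-- Right multiplication is the relevant side: since `T (g s) x = T g (T s x)`, translating a
pattern by a letter on the right is reading it at a neighboring point. -/
theorem ball_succ (k : ℕ) : ball (1 : Gp r) (k + 1) = ball 1 k ∪
    (Finset.univ : Finset (Fin r × Bool)).biUnion
      fun l => (ball (1 : Gp r) k).image (· * FreeGroup.mk [l]) := by
  ext g
  simp only [Finset.mem_union, Finset.mem_biUnion, Finset.mem_univ, true_and, Finset.mem_image]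
  constructor
  · intro hg
    obtain ⟨L, hL, rfl⟩ := exists_mk_of_mem_ball hg
    rcases List.eq_nil_or_concat L with rfl | ⟨L', l, rfl⟩
    · exact Or.inl (mk_mem_ball (by simp))
    · refine Or.inr ⟨l, FreeGroup.mk L', mk_mem_ball ?_, ?_⟩
      · simpa using hL
      · rw [FreeGroup.mul_mk]; simp
  · rintro (hg | ⟨l, g, hg, rfl⟩)
    · exact ball_mono (Nat.le_succ k) 1 hg
    · rw [mem_ball_one] at *
      have h1 := FreeGroup.norm_mul_le g (FreeGroup.mk [l])
      have h2 : FreeGroup.norm (FreeGroup.mk [l]) ≤ 1 := FreeGroup.norm_mk_le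
      omega

theorem card_ball_le (k : ℕ) : (ball (1 : Gp r) k).card ≤ (2 * r + 1) ^ k := by
  induction k with
  | zero =>
    have : ball (1 : Gp r) 0 ⊆ {1} := fun g hg => by
      simpa [mem_ball_one, FreeGroup.norm_eq_zero] using hg
    simpa using Finset.card_le_card this
  | succ k ih =>
    rw [ball_succ]
    refine (Finset.card_union_le _ _).trans ?_
    have h1 := Finset.card_biUnion_le (s := (Finset.univ : Finset (Fin r × Bool)))
      (t := fun l => (ball (1 : Gp r) k).image (· * FreeGroup.mk [l]))
    have h2 : ∑ l : Fin r × Bool, ((ball (1 : Gp r) k).image (· * FreeGroup.mk [l])).card ≤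
        ∑ _l : Fin r × Bool, (2 * r + 1) ^ k :=
      Finset.sum_le_sum fun l _ => Finset.card_image_le.trans ih
    simp only [Finset.sum_const, Finset.card_univ, Fintype.card_prod, Fintype.card_fin,
      Fintype.card_bool, smul_eq_mul] at h2
    rw [pow_succ]
    linarith

end Balls

/-! ### Splittings decrease `F` -/

section Splitting

theorem shannon_comp_measurePreserving {X Λ : Type*} [MeasurableSpace X] {μ : Measure X}
    [Fintype Λ] [MeasurableSpace Λ] [MeasurableSingletonClass Λ] {γ : X → Λ} (hγ : Measurable γ)
    {τ : X → X}
    (hτ : MeasurePreserving τ μ μ) : shannon μ (γ ∘ τ) = shannon μ γ := by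
  simp only [shannon_eq_sum_law, law_comp_measurePreserving hγ hτ]

variable {r : ℕ} {X : Type*} [MeasurableSpace X] {μ : Measure X} [IsProbabilityMeasure μ]
  {Λ Λ' Λ'' : Type*} [Fintype Λ] [Fintype Λ'] [Fintype Λ'']
  [MeasurableSpace Λ] [MeasurableSpace Λ'] [MeasurableSpace Λ'']
  [MeasurableSingletonClass Λ] [MeasurableSingletonClass Λ'] [MeasurableSingletonClass Λ'']

/-- Conditioning on a finer observable does not increase entropy: this is `H(a | c') ≤ H(a | c)`
with the conditional entropies expanded. -/
theorem shannon_joint_add_le_of_factor {a : X → Λ} {c : X → Λ'} {c' : X → Λ''}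
    (ha : Measurable a) (hc : Measurable c) (hc' : Measurable c')
    (h : ∀ x y, c' x = c' y → c x = c y) :
    shannon μ (joint a c') + shannon μ c ≤ shannon μ (joint a c) + shannon μ c' := by
  have := shannon_submodular (μ := μ) ha hc' hc
  rw [shannon_joint_of_factor hc' hc h] at this
  refine le_trans (le_of_eq ?_) this
  congr 1
  refine shannon_congr (ha.prodMk hc') (ha.prodMk (hc'.prodMk hc)) fun x y => ?_
  simp only [joint, Prod.mk.injEq]
  exact ⟨fun hh => ⟨hh.1, hh.2, h _ _ hh.2⟩, fun hh => ⟨hh.1, hh.2.1⟩⟩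

/-- Passing to a simple splitting in the direction of a generator or its inverse does not
increase `F`. -/
theorem bigF_le_of_splitting {T : Gp r →* Equiv.Perm X} (hT : ∀ g, MeasurePreserving (T g) μ μ)
    {γ : X → Λ} (hγ : Measurable γ) {γ' : X → Λ'} (hγ' : Measurable γ')
    (href : ∀ x y, γ' x = γ' y → γ x = γ y) (i : Fin r)
    (hi : (∀ x y, edge T γ i x = edge T γ i y → γ' x = γ' y) ∨
      ∀ x y, edge T γ i x = edge T γ i y →
        γ' (T (FreeGroup.of i) x) = γ' (T (FreeGroup.of i) y)) :
    bigF μ T γ' ≤ bigF μ T γ := by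
  have hTm : ∀ g, Measurable (T g) := fun g => (hT g).measurable
  have inv : ∀ j, shannon μ (γ ∘ T (FreeGroup.of j)) = shannon μ γ :=
    fun j => shannon_comp_measurePreserving hγ (hT _)
  have inv' : ∀ j, shannon μ (γ' ∘ T (FreeGroup.of j)) = shannon μ γ' :=
    fun j => shannon_comp_measurePreserving hγ' (hT _)
  have right : ∀ j, shannon μ (joint γ' (γ' ∘ T (FreeGroup.of j))) + shannon μ γ ≤
      shannon μ (joint γ' (γ ∘ T (FreeGroup.of j))) + shannon μ γ' := by
    intro j
    rw [← inv j, ← inv' j]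
    exact shannon_joint_add_le_of_factor hγ' (hγ.comp (hTm _)) (hγ'.comp (hTm _))
      fun x y => href _ _
  have left : ∀ j, shannon μ (joint γ' (γ ∘ T (FreeGroup.of j))) + shannon μ γ ≤
      shannon μ (edge T γ j) + shannon μ γ' := by
    intro j
    have hm := hγ.comp (hTm (FreeGroup.of j))
    have := shannon_joint_add_le_of_factor (μ := μ) hm hγ hγ' href
    rw [shannon_joint_comm hm hγ', shannon_joint_comm hm hγ] at this
    exact this
  -- The two ends of an edge are refined one after the other, each refinement costing at most `H(γ')
  -- - H(γ)`.
  have gen : ∀ j, shannon μ (edge T γ' j) - shannon μ (edge T γ j) ≤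
      2 * (shannon μ γ' - shannon μ γ) := by
    intro j
    have h1 := right j
    have h2 := left j
    change shannon μ (edge T γ' j) + _ ≤ _ at h1
    linarith
  -- In the distinguished direction one of the two refinements is free, being already determined by
  -- the edge observable of `γ`.
  have spec : shannon μ (edge T γ' i) - shannon μ (edge T γ i) ≤
      shannon μ γ' - shannon μ γ := by
    have hm := hγ.comp (hTm (FreeGroup.of i))
    have hm' := hγ'.comp (hTm (FreeGroup.of i))
    rcases hi with hi | hi
    · have h1 : shannon μ (edge T γ' i) = shannon μ (joint γ (γ' ∘ T (FreeGroup.of i))) := by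
        refine shannon_congr (measurable_edge hTm hγ' i) (hγ.prodMk hm') fun x y => ?_
        simp only [edge, joint, Prod.mk.injEq, Function.comp]
        refine ⟨fun h => ⟨href _ _ h.1, h.2⟩, fun h => ⟨hi x y ?_, h.2⟩⟩
        simp only [edge, Prod.mk.injEq]
        exact ⟨h.1, href _ _ h.2⟩
      have h2 := shannon_joint_add_le_of_factor (μ := μ) hγ hm hm' fun x y => href _ _
      rw [inv, inv'] at h2
      change _ ≤ shannon μ (edge T γ i) + _ at h2
      linarith
    · have h1 : shannon μ (edge T γ' i) = shannon μ (joint γ' (γ ∘ T (FreeGroup.of i))) := by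
        refine shannon_congr (measurable_edge hTm hγ' i) (hγ'.prodMk hm) fun x y => ?_
        simp only [edge, joint, Prod.mk.injEq, Function.comp]
        refine ⟨fun h => ⟨h.1, href _ _ h.2⟩, fun h => ⟨h.1, hi x y ?_⟩⟩
        simp only [edge, Prod.mk.injEq]
        exact ⟨href _ _ h.1, h.2⟩
      have h2 := left i
      linarith
  -- Here `2 (r - 1) + 1 = 2 r - 1`, which exactly offsets the coefficient `1 - 2 r` of the vertex
  -- entropy.
  have hsum : ∑ j, (shannon μ (edge T γ' j) - shannon μ (edge T γ j)) ≤
      (2 * r - 1) * (shannon μ γ' - shannon μ γ) := by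
    rw [← Finset.add_sum_erase _ _ (Finset.mem_univ i)]
    have h3 := Finset.sum_le_sum fun j (_ : j ∈ Finset.univ.erase i) => gen j
    have hr : 1 ≤ r := i.pos
    rw [Finset.sum_const, Finset.card_erase_of_mem (Finset.mem_univ i), Finset.card_univ,
      Fintype.card_fin, nsmul_eq_mul, Nat.cast_sub hr] at h3
    push_cast at h3
    linarith
  rw [bigF_eq hTm hγ, bigF_eq hTm hγ']
  rw [Finset.sum_sub_distrib] at hsum
  linarith

end Splitting

/-! ### Monotonicity along balls -/

section Monotone

variable {r : ℕ} {X : Type*} [MeasurableSpace X] {μ : Measure X} [IsProbabilityMeasure μ]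
  {Λ B : Type*} [Fintype Λ] [Fintype B] [MeasurableSpace Λ] [MeasurableSpace B]
  [MeasurableSingletonClass Λ] [MeasurableSingletonClass B]
  {T : Gp r →* Equiv.Perm X}

/-- Patterns on the translate of `K` by a generator can be read at the far end of the edge, where
`H` already records them; for an inverse generator the near end supplies what is new at the far end.
Allowing `K ⊆ H` lets the letters be adjoined one at a time. -/
theorem bigF_joint_union_image_le (hT : ∀ g, MeasurePreserving (T g) μ μ) {δ : X → Λ}
    (hδ : Measurable δ) {β : X → B} (hβ : Measurable β) {K H : Finset (Gp r)} (hKH : K ⊆ H)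
    (l : Fin r × Bool) :
    bigF μ T (joint δ (itinOn T β (H ∪ K.image (· * FreeGroup.mk [l])))) ≤
      bigF μ T (joint δ (itinOn T β H)) := by
  have hTm : ∀ g, Measurable (T g) := fun g => (hT g).measurable
  refine bigF_le_of_splitting hT (hδ.prodMk (measurable_itinOn hTm hβ _))
    (hδ.prodMk (measurable_itinOn hTm hβ _)) ?_ l.1 ?_
  · intro x y h
    simp only [joint, Prod.mk.injEq, funext_iff, itinOn, Subtype.forall] at h ⊢
    exact ⟨h.1, fun g hg => h.2 g (Finset.mem_union_left _ hg)⟩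
  · obtain ⟨i, b⟩ := l
    cases b
    · right
      intro x y h
      simp only [edge, joint, Prod.mk.injEq, funext_iff, itinOn, Subtype.forall] at h ⊢
      refine ⟨h.2.1, fun g hg => ?_⟩
      rcases Finset.mem_union.1 hg with hg | hg
      · exact h.2.2 g hg
      · obtain ⟨g', hg', rfl⟩ := Finset.mem_image.1 hg
        have : (FreeGroup.mk [(i, false)] : Gp r) = (FreeGroup.of i)⁻¹ := rfl
        rw [this, ← Equiv.Perm.mul_apply, ← Equiv.Perm.mul_apply, ← map_mul,
          inv_mul_cancel_right]
        exact h.1.2 g' (hKH hg')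
    · left
      intro x y h
      simp only [edge, joint, Prod.mk.injEq, funext_iff, itinOn, Subtype.forall] at h ⊢
      refine ⟨h.1.1, fun g hg => ?_⟩
      rcases Finset.mem_union.1 hg with hg | hg
      · exact h.1.2 g hg
      · obtain ⟨g', hg', rfl⟩ := Finset.mem_image.1 hg
        have : (FreeGroup.mk [(i, true)] : Gp r) = FreeGroup.of i := rfl
        rw [this, map_mul, Equiv.Perm.mul_apply, Equiv.Perm.mul_apply]
        exact h.2.2 g' (hKH hg')

theorem bigF_joint_itinBall_antitone (hT : ∀ g, MeasurePreserving (T g) μ μ) {δ : X → Λ}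
    (hδ : Measurable δ) {β : X → B} (hβ : Measurable β) :
    Antitone fun k => bigF μ T (joint δ (itinBall T β k)) := by
  refine antitone_nat_of_succ_le fun k => ?_
  have key : ∀ S : Finset (Fin r × Bool), bigF μ T (joint δ (itinOn T β (ball 1 k ∪
      S.biUnion fun l => (ball (1 : Gp r) k).image (· * FreeGroup.mk [l])))) ≤
      bigF μ T (joint δ (itinOn T β (ball 1 k))) := by
    intro S
    induction S using Finset.induction_on with
    | empty => rw [Finset.biUnion_empty, Finset.union_empty]
    | insert l S _ ih =>
      rw [Finset.biUnion_insert, Finset.union_comm (Finset.image _ _), ← Finset.union_assoc]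
      exact (bigF_joint_union_image_le hT hδ hβ Finset.subset_union_left l).trans ih
  have := key Finset.univ
  rw [← ball_succ] at this
  exact this

theorem bigF_itinBall_antitone (hT : ∀ g, MeasurePreserving (T g) μ μ)
    {β : X → B} (hβ : Measurable β) : Antitone fun k => bigF μ T (itinBall T β k) := by
  have hTm : ∀ g, Measurable (T g) := fun g => (hT g).measurable
  have := bigF_joint_itinBall_antitone hT (measurable_const (a := ())) hβ
  convert this using 2 with k
  refine bigF_congr hTm (measurable_itinOn hTm hβ _)
    (measurable_const.prodMk (measurable_itinOn hTm hβ _)) fun x y => ?_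
  simp [itinBall, joint]

end Monotone

/-! ### Counting functions with prescribed value counts -/

section Counting

variable {S L Λ : Type*}

/-- The number of arguments at which `f` takes the value `a`. -/
def cnt (f : S → L) (a : L) : ℕ := Nat.card {s // f s = a}

theorem cnt_comp_equiv {S' : Type*} (f : S → L) (e : S' ≃ S) : cnt (f ∘ e) = cnt f := by
  funext a
  exact Nat.card_congr (e.subtypeEquiv fun _ => Iff.rfl)

theorem cnt_eq_card_filter [Fintype S] [DecidableEq L] (f : S → L) (a : L) :
    cnt f a = (Finset.univ.filter fun s => f s = a).card := by
  rw [cnt, Nat.card_eq_fintype_card, Fintype.card_subtype]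

variable [Finite S]

theorem sum_cnt [Fintype L] (f : S → L) : ∑ a, cnt f a = Nat.card S := by
  classical
  have := Fintype.ofFinite S
  simp only [cnt_eq_card_filter]
  rw [← Finset.card_eq_sum_card_fiberwise (f := f) (s := Finset.univ) (t := Finset.univ)
    (fun x _ => by simp), Finset.card_univ, Nat.card_eq_fintype_card]

theorem cnt_comp [Fintype L] [DecidableEq Λ] (f : S → L) (φ : L → Λ) (b : Λ) :
    cnt (φ ∘ f) b = ∑ a with φ a = b, cnt f a := by
  classical
  have := Fintype.ofFinite S
  simp only [cnt_eq_card_filter]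
  rw [Finset.card_eq_sum_card_fiberwise (f := f) (t := Finset.univ.filter fun a => φ a = b)
    (fun x hx => by simpa using hx)]
  refine Finset.sum_congr rfl fun a ha => ?_
  congr 1
  ext x
  simp only [Finset.mem_filter, Finset.mem_univ, true_and, Function.comp] at ha ⊢
  constructor
  · exact fun h => h.2
  · rintro rfl; exact ⟨ha, rfl⟩

theorem cnt_comp_congr [Finite L] {S' : Type*} [Finite S'] {f : S → L} {g : S' → L}
    (h : cnt f = cnt g) (φ : L → Λ) : cnt (φ ∘ f) = cnt (φ ∘ g) := by
  classical
  have := Fintype.ofFinite L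
  funext b
  rw [cnt_comp, cnt_comp, h]

theorem exists_perm_of_cnt_eq {u u' : S → L} (h : cnt u = cnt u') :
    ∃ π : Equiv.Perm S, u ∘ π = u' := by
  have e : ∀ c, {s // u' s = c} ≃ {s // u s = c} := fun c =>
    Classical.choice (Finite.card_eq.1 (congrFun h c).symm)
  exact ⟨Equiv.ofFiberEquiv e, funext fun s => Equiv.ofFiberEquiv_map e s⟩

/-- The solutions form a coset of the stabilizer of `u`, a product of symmetric groups on its level
sets. -/
theorem card_perm_comp_eq [Fintype L] {u u' : S → L} (h : cnt u = cnt u') :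
    Nat.card {π : Equiv.Perm S // u ∘ π = u'} = ∏ l, (cnt u l).factorial := by
  classical
  have := Fintype.ofFinite S
  obtain ⟨π₀, rfl⟩ := exists_perm_of_cnt_eq h
  have e : {π : Equiv.Perm S // u ∘ π = u ∘ π₀} ≃ {π : Equiv.Perm S // u ∘ π = u} :=
    (Equiv.mulRight π₀⁻¹).subtypeEquiv fun π => by
      simp only [Equiv.coe_mulRight, Equiv.Perm.coe_mul]
      constructor
      · intro hh
        rw [← Function.comp_assoc, hh]
        ext x; simp
      · intro hh
        rw [← Function.comp_assoc] at hh
        conv_rhs => rw [← hh]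
        ext x; simp
  rw [Nat.card_congr e, Nat.card_eq_fintype_card, DomMulAct.stabilizer_card]
  simp only [cnt, Nat.card_eq_fintype_card]

variable [Fintype L] [Fintype Λ]

/-- Orbit and stabilizer for the permutations of `S`; this and the following counts are stated as
products so as to avoid division of natural numbers. -/
theorem card_cnt_eq_mul (z₀ : S → L) :
    Nat.card {z : S → L // cnt z = cnt z₀} * ∏ a, (cnt z₀ a).factorial =
      (Nat.card S).factorial := by
  classical
  have := Fintype.ofFinite S
  have e : Equiv.Perm S ≃ Σ z : {z : S → L // cnt z = cnt z₀}, {π : Equiv.Perm S // z₀ ∘ π = z} :=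
    { toFun := fun π => ⟨⟨z₀ ∘ π, cnt_comp_equiv _ _⟩, π, rfl⟩
      invFun := fun p => p.2.1
      left_inv := fun π => rfl
      right_inv := by
        rintro ⟨⟨z, hz⟩, π, hπ⟩
        obtain rfl : z₀ ∘ π = z := hπ
        rfl }
  have h := Nat.card_congr e
  rw [Nat.card_perm, Nat.card_sigma,
    Finset.sum_congr rfl fun z _ => card_perm_comp_eq z.2.symm] at h
  rw [h, Finset.sum_const, smul_eq_mul, Finset.card_univ, Nat.card_eq_fintype_card]

theorem card_cnt_joint_eq_mul (z : S → L) (w₀ : S → Λ) :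
    Nat.card {w : S → Λ // cnt (joint z w) = cnt (joint z w₀)} *
      ∏ a, (cnt (joint z w₀) a).factorial = ∏ a, (cnt z a).factorial := by
  classical
  have := Fintype.ofFinite S
  have e : {π : Equiv.Perm S // z ∘ π = z} ≃
      Σ w : {w : S → Λ // cnt (joint z w) = cnt (joint z w₀)},
        {π : Equiv.Perm S // joint z w₀ ∘ π = joint z w} :=
    { toFun := fun π => ⟨⟨w₀ ∘ π, by
          rw [← cnt_comp_equiv (joint z w₀) π.1]
          congr 1
          funext s
          exact Prod.ext (congrFun π.2 s).symm rfl⟩, π.1, by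
          funext s
          exact Prod.ext (congrFun π.2 s) rfl⟩
      invFun := fun p => ⟨p.2.1, funext fun s => congrArg Prod.fst (congrFun p.2.2 s)⟩
      left_inv := fun π => rfl
      right_inv := by
        rintro ⟨⟨w, hw⟩, π, hπ⟩
        obtain rfl : w₀ ∘ π = w := funext fun s => congrArg Prod.snd (congrFun hπ s)
        rfl }
  have h := Nat.card_congr e
  rw [Nat.card_sigma, Finset.sum_congr rfl fun w _ => card_perm_comp_eq w.2.symm,
    card_perm_comp_eq rfl] at h
  rw [h, Finset.sum_const, smul_eq_mul, Finset.card_univ, Nat.card_eq_fintype_card]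

/-- Permutations are grouped by `w = z ∘ π`. Every admissible `w` has the value counts of `z` and is
therefore reached by the same number of permutations, while the `w` themselves are counted by
`card_cnt_joint_eq_mul`. -/
theorem card_perm_cnt_joint_eq_mul (z : S → L) (π₀ : Equiv.Perm S) :
    Nat.card {π : Equiv.Perm S // cnt (joint z (z ∘ π)) = cnt (joint z (z ∘ π₀))} *
      ∏ a, (cnt (joint z (z ∘ π₀)) a).factorial = (∏ a, (cnt z a).factorial) ^ 2 := by
  classical
  have := Fintype.ofFinite S
  have hsnd : ∀ w : S → L, cnt (joint z w) = cnt (joint z (z ∘ π₀)) → cnt z = cnt w := by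
    intro w hw
    have := cnt_comp_congr hw Prod.snd
    exact (this.trans (cnt_comp_equiv z π₀)).symm
  have e : {π : Equiv.Perm S // cnt (joint z (z ∘ π)) = cnt (joint z (z ∘ π₀))} ≃
      Σ w : {w : S → L // cnt (joint z w) = cnt (joint z (z ∘ π₀))},
        {π : Equiv.Perm S // z ∘ π = w} :=
    { toFun := fun π => ⟨⟨z ∘ π.1, π.2⟩, π.1, rfl⟩
      invFun := fun p => ⟨p.2.1, by rw [p.2.2]; exact p.1.2⟩
      left_inv := fun π => rfl
      right_inv := by
        rintro ⟨⟨w, hw⟩, π, hπ⟩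
        obtain rfl : z ∘ π = w := hπ
        rfl }
  have h := Nat.card_congr e
  rw [Nat.card_sigma, Finset.sum_congr rfl fun w _ => card_perm_comp_eq (hsnd w.1 w.2),
    Finset.sum_const, smul_eq_mul, Finset.card_univ, ← Nat.card_eq_fintype_card] at h
  rw [h, mul_right_comm, card_cnt_joint_eq_mul, sq]

end Counting

/-! ### Counting pairs of homomorphisms and labelings with prescribed edge counts -/

section Class

variable {r : ℕ} {S Λ : Type*}

/-- The pairs `(σ, z)` with the same edge counts as `(σ₀, z₀)`. -/
def edgeClass (σ₀ : Gp r →* Equiv.Perm S) (z₀ : S → Λ) :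
    Set ((Gp r →* Equiv.Perm S) × (S → Λ)) :=
  {p | ∀ i, cnt (edge p.1 p.2 i) = cnt (edge σ₀ z₀ i)}

theorem self_mem_edgeClass (σ₀ : Gp r →* Equiv.Perm S) (z₀ : S → Λ) :
    (σ₀, z₀) ∈ edgeClass σ₀ z₀ := fun _ => rfl

variable [Finite S] [Fintype Λ]

theorem cnt_eq_of_mem_edgeClass (hr : 1 ≤ r) {σ₀ : Gp r →* Equiv.Perm S} {z₀ : S → Λ}
    {p : (Gp r →* Equiv.Perm S) × (S → Λ)} (hp : p ∈ edgeClass σ₀ z₀) : cnt p.2 = cnt z₀ :=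
  cnt_comp_congr (hp ⟨0, hr⟩) Prod.fst

instance : Finite (Gp r →* Equiv.Perm S) := Finite.of_equiv _ FreeGroup.lift

/-- Choose `z` first; by freeness the permutations assigned to the generators are then arbitrary and
independent, each subject only to its own edge condition. -/
theorem card_edgeClass_mul (hr : 1 ≤ r) (σ₀ : Gp r →* Equiv.Perm S) (z₀ : S → Λ) :
    Nat.card (edgeClass σ₀ z₀) * (∏ i, ∏ a, (cnt (edge σ₀ z₀ i) a).factorial) *
      ∏ a, (cnt z₀ a).factorial =
      (Nat.card S).factorial * ((∏ a, (cnt z₀ a).factorial) ^ 2) ^ r := by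
  classical
  have := Fintype.ofFinite S
  have e : edgeClass σ₀ z₀ ≃ Σ z : {z : S → Λ // cnt z = cnt z₀},
      ∀ i : Fin r, {π : Equiv.Perm S // cnt (joint z.1 (z.1 ∘ π)) = cnt (edge σ₀ z₀ i)} :=
    { toFun := fun p => ⟨⟨p.1.2, cnt_eq_of_mem_edgeClass hr p.2⟩,
        fun i => ⟨p.1.1 (FreeGroup.of i), p.2 i⟩⟩
      invFun := fun q => ⟨(FreeGroup.lift fun i => (q.2 i).1, q.1.1), fun i => by
        have := (q.2 i).2
        simp only
        convert this using 2
        funext s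
        simp [edge, joint]⟩
      left_inv := by
        rintro ⟨⟨σ, z⟩, h⟩
        ext1
        refine Prod.ext ?_ rfl
        exact FreeGroup.lift.apply_symm_apply σ
      right_inv := by
        rintro ⟨⟨z, hz⟩, π⟩
        simp }
  have hz : ∀ (z : {z : S → Λ // cnt z = cnt z₀}) (i : Fin r),
      Nat.card {π : Equiv.Perm S // cnt (joint z.1 (z.1 ∘ π)) = cnt (edge σ₀ z₀ i)} *
        ∏ a, (cnt (edge σ₀ z₀ i) a).factorial = (∏ a, (cnt z₀ a).factorial) ^ 2 := by
    rintro ⟨z, hz⟩ i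
    obtain ⟨τ, rfl⟩ := exists_perm_of_cnt_eq hz.symm
    -- For `z = z₀ ∘ τ`, the conjugate of `σ₀ sᵢ` by `τ` realizes the prescribed counts, so the
    -- number of choices is the same for every `z`.
    have h1 : cnt (edge σ₀ z₀ i) =
        cnt (joint (z₀ ∘ τ) ((z₀ ∘ τ) ∘ (τ⁻¹ * σ₀ (FreeGroup.of i) * τ : Equiv.Perm S))) := by
      rw [← cnt_comp_equiv _ τ]
      congr 1
      funext s
      simp [edge, joint]
    rw [h1, card_perm_cnt_joint_eq_mul, hz]
  rw [Nat.card_congr e, Nat.card_sigma, Finset.sum_mul]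
  have : ∀ z : {z : S → Λ // cnt z = cnt z₀}, Nat.card (∀ i : Fin r,
      {π : Equiv.Perm S // cnt (joint z.1 (z.1 ∘ π)) = cnt (edge σ₀ z₀ i)}) *
        (∏ i, ∏ a, (cnt (edge σ₀ z₀ i) a).factorial) =
      ((∏ a, (cnt z₀ a).factorial) ^ 2) ^ r := by
    intro z
    rw [Nat.card_pi, ← Finset.prod_mul_distrib, Finset.prod_congr rfl fun i _ => hz z i]
    simp
  rw [Finset.sum_congr rfl fun z _ => this z, Finset.sum_const, smul_eq_mul, Finset.card_univ,
    ← Nat.card_eq_fintype_card, mul_right_comm, card_cnt_eq_mul]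

theorem log_card_edgeClass (hr : 1 ≤ r) (σ₀ : Gp r →* Equiv.Perm S) (z₀ : S → Λ) :
    Real.log (Nat.card (edgeClass σ₀ z₀)) = Real.log ((Nat.card S).factorial) +
      (2 * r - 1) * ∑ a, Real.log ((cnt z₀ a).factorial) -
      ∑ i, ∑ a, Real.log ((cnt (edge σ₀ z₀ i) a).factorial) := by
  have h := congrArg (fun k : ℕ => Real.log k) (card_edgeClass_mul hr σ₀ z₀)
  have hne : Nonempty (edgeClass σ₀ z₀) := ⟨_, self_mem_edgeClass σ₀ z₀⟩
  have h0 : (Nat.card (edgeClass σ₀ z₀) : ℝ) ≠ 0 := by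
    exact_mod_cast Nat.card_pos.ne'
  have hf : ∀ k : ℕ, (k.factorial : ℝ) ≠ 0 := fun k => by exact_mod_cast k.factorial_ne_zero
  have hv : ∏ a, ((cnt z₀ a).factorial : ℝ) ≠ 0 := Finset.prod_ne_zero_iff.2 fun a _ => hf _
  have hc : ∀ i, ∏ a, ((cnt (edge σ₀ z₀ i) a).factorial : ℝ) ≠ 0 := fun i =>
    Finset.prod_ne_zero_iff.2 fun a _ => hf _
  have hc' := Finset.prod_ne_zero_iff.2 fun i (_ : i ∈ Finset.univ) => hc i
  push_cast at h
  rw [Real.log_mul (mul_ne_zero h0 hc') hv, Real.log_mul h0 hc', Real.log_mul (hf _)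
    (pow_ne_zero _ (pow_ne_zero _ hv)), Real.log_pow, Real.log_pow,
    Real.log_prod fun a _ => hf _, Real.log_prod fun i _ => hc i,
    Finset.sum_congr rfl fun i _ => Real.log_prod fun a _ => hf _] at h
  push_cast at h
  linarith

end Class

/-! ### The uniform measure on `Fin n` -/

section Uniform

variable {n : ℕ} {Λ : Type*} [MeasurableSpace Λ]

/-- The uniform distribution on `Fin n`. -/
abbrev unif (n : ℕ) : Measure (Fin n) := ProbabilityTheory.uniformOn Set.univ

instance [NeZero n] : IsProbabilityMeasure (unif n) :=
  ProbabilityTheory.isProbabilityMeasure_uniformOn Set.finite_univ Set.univ_nonempty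

theorem unif_real (s : Set (Fin n)) : (unif n).real s = Nat.card s / n := by
  classical
  rw [measureReal_def, ProbabilityTheory.uniformOn_univ, ENNReal.toReal_div,
    Measure.count_apply s.toFinite.measurableSet]
  simp [Set.encard, ENat.card_eq_coe_fintype_card]

theorem law_unif [MeasurableSingletonClass Λ] (z : Fin n → Λ) (a : Λ) :
    law (unif n) z a = cnt z a / n := by
  rw [law_eq (measurable_of_finite z), unif_real]
  rfl

theorem measurePreserving_unif (π : Equiv.Perm (Fin n)) :
    MeasurePreserving π (unif n) (unif n) := by
  refine ⟨measurable_of_finite _, ?_⟩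
  ext s hs
  rw [Measure.map_apply (measurable_of_finite _) hs, ProbabilityTheory.uniformOn_univ,
    ProbabilityTheory.uniformOn_univ, Measure.count_apply (measurable_of_finite _ hs),
    Measure.count_apply hs, ← Equiv.image_symm_eq_preimage, Set.encard, Set.encard,
    ENat.card_congr (Equiv.image π.symm s).symm]

theorem cnt_eq_iff_lawDist [Fintype Λ] [MeasurableSingletonClass Λ] [NeZero n]
    (z w : Fin n → Λ) : lawDist (unif n) z (unif n) w = 0 ↔ cnt z = cnt w := by
  have hn : (n : ℝ) ≠ 0 := by exact_mod_cast NeZero.ne n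
  rw [lawDist, Finset.sum_eq_zero_iff_of_nonneg fun _ _ => abs_nonneg _, funext_iff]
  simp only [Finset.mem_univ, true_imp_iff, abs_eq_zero, sub_eq_zero, law_unif]
  refine forall_congr' fun a => ?_
  rw [div_left_inj' hn]
  exact Nat.cast_inj

theorem mul_shannon_unif [Fintype Λ] [MeasurableSingletonClass Λ] [NeZero n] (z : Fin n → Λ) :
    n * shannon (unif n) z = n * Real.log n - ∑ a, (cnt z a : ℝ) * Real.log (cnt z a) := by
  have hn : (n : ℝ) ≠ 0 := by exact_mod_cast NeZero.ne n
  rw [shannon_eq_sum_law, Finset.mul_sum]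
  have h : ∀ a, n * Real.negMulLog (law (unif n) z a) =
      cnt z a * Real.log n - cnt z a * Real.log (cnt z a) := by
    intro a
    rw [law_unif, Real.negMulLog]
    rcases eq_or_ne (cnt z a) 0 with h0 | h0
    · simp [h0]
    · rw [Real.log_div (by exact_mod_cast h0) hn]
      field_simp
      ring
  rw [Finset.sum_congr rfl fun a _ => h a, Finset.sum_sub_distrib, ← Finset.sum_mul,
    ← Nat.cast_sum, sum_cnt, Nat.card_fin]

end Uniform

/-! ### The size of an edge class -/

section Stirling

theorem mul_log_sub_le_log_factorial (k : ℕ) : k * Real.log k - k ≤ Real.log k.factorial := by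
  rcases Nat.eq_zero_or_pos k with rfl | hk
  · simp
  have hk' : (0 : ℝ) < k := by exact_mod_cast hk
  have h := Real.pow_div_factorial_le_exp (k : ℝ) hk'.le k
  have h2 := Real.log_le_log (by positivity) h
  rw [Real.log_exp, Real.log_div (by positivity) (by positivity), Real.log_pow] at h2
  linarith

theorem log_factorial_le (k : ℕ) :
    Real.log k.factorial ≤ k * Real.log k - k + (Real.log (k + 1) + 1) := by
  rcases Nat.eq_zero_or_pos k with rfl | hk
  · simp
  suffices h : Real.log k.factorial ≤ k * Real.log k - k + (Real.log k + 1) by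
    have : Real.log k ≤ Real.log (k + 1) := Real.log_le_log (by positivity) (by linarith)
    linarith
  induction k, hk using Nat.le_induction with
  | base => simp
  | succ k hk ih =>
    have hk' : (0 : ℝ) < k := by exact_mod_cast hk
    rw [Nat.factorial_succ]
    push_cast
    rw [Real.log_mul (by positivity) (by positivity)]
    have h := Real.one_sub_inv_le_log_of_pos (x := (k + 1) / k) (by positivity)
    rw [Real.log_div (by positivity) hk'.ne'] at h
    have h2 := mul_le_mul_of_nonneg_left h (show (0 : ℝ) ≤ k + 1 by positivity)
    have h3 : ((k : ℝ) + 1) * (1 - ((k + 1) / k : ℝ)⁻¹) = 1 := by field_simp; ring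
    rw [h3] at h2
    linarith

theorem abs_log_factorial_sub_le {k n : ℕ} (hk : k ≤ n) :
    |Real.log k.factorial - (k * Real.log k - k)| ≤ Real.log (n + 1) + 1 := by
  have h1 := mul_log_sub_le_log_factorial k
  have h2 := log_factorial_le k
  have h3 : Real.log (k + 1) ≤ Real.log (n + 1) :=
    Real.log_le_log (by positivity) (by exact_mod_cast Nat.succ_le_succ hk)
  rw [abs_le]
  constructor <;> linarith

variable {r n : ℕ} {Λ : Type*} [Fintype Λ] [MeasurableSpace Λ] [MeasurableSingletonClass Λ]

theorem cnt_le {L : Type*} (z : Fin n → L) (a : L) : cnt z a ≤ n := by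
  have := Finite.card_subtype_le fun s => z s = a
  rwa [Nat.card_fin] at this

/-- The error term in the estimate of the size of an edge class. -/
def classErr (r n N : ℕ) : ℝ :=
  (Real.log (n + 1) + 1) * (1 + (2 * r + 1) * N + r * (N : ℝ) ^ 2)

theorem abs_sum_log_factorial_sub_le {L : Type*} [Fintype L] [MeasurableSpace L]
    [MeasurableSingletonClass L] [NeZero n] (z : Fin n → L) :
    |∑ a, Real.log ((cnt z a).factorial) - (n * Real.log n - n - n * shannon (unif n) z)| ≤
      Fintype.card L * (Real.log (n + 1) + 1) := by
  have h : n * Real.log n - n - n * shannon (unif n) z =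
      ∑ a, ((cnt z a : ℝ) * Real.log (cnt z a) - cnt z a) := by
    rw [mul_shannon_unif, Finset.sum_sub_distrib, ← Nat.cast_sum, sum_cnt, Nat.card_fin]
    ring
  rw [h, ← Finset.sum_sub_distrib]
  refine (Finset.abs_sum_le_sum_abs _ _).trans ?_
  refine (Finset.sum_le_sum fun a _ => abs_log_factorial_sub_le (cnt_le z a)).trans ?_
  rw [Finset.sum_const, Finset.card_univ, nsmul_eq_mul]

/-- Stirling's formula in each factorial. The main terms `n log n - n` occur `1 + (2 r - 1) - r = r`
times, and the entropies combine to `n F`. -/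
theorem abs_log_card_edgeClass_sub_le [NeZero n] (hr : 1 ≤ r) (σ₀ : Gp r →* Equiv.Perm (Fin n))
    (z₀ : Fin n → Λ) :
    |Real.log (Nat.card (edgeClass σ₀ z₀)) - (r * (n * Real.log n - n) +
      n * bigF (unif n) σ₀ z₀)| ≤ classErr r n (Fintype.card Λ) := by
  set ℓ := Real.log (n + 1) + 1
  have h0 : |Real.log n.factorial - (n * Real.log n - n)| ≤ ℓ := abs_log_factorial_sub_le le_rfl
  have hv := abs_sum_log_factorial_sub_le z₀
  have hℓ : 0 ≤ ℓ := (abs_nonneg _).trans h0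
  have hE : |∑ i, (∑ a, Real.log ((cnt (edge σ₀ z₀ i) a).factorial) -
      (n * Real.log n - n - n * shannon (unif n) (edge σ₀ z₀ i)))| ≤
      r * (Fintype.card Λ : ℝ) ^ 2 * ℓ := by
    refine (Finset.abs_sum_le_sum_abs _ _).trans ?_
    refine (Finset.sum_le_sum fun i _ => abs_sum_log_factorial_sub_le (edge σ₀ z₀ i)).trans ?_
    rw [Finset.sum_const, Finset.card_univ, Fintype.card_fin, nsmul_eq_mul, Fintype.card_prod,
      Nat.cast_mul, sq]
    linarith
  rw [log_card_edgeClass hr, Nat.card_fin,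
    bigF_eq (fun g => (measurePreserving_unif (σ₀ g)).measurable) (measurable_of_finite z₀)]
  rw [Finset.sum_sub_distrib, Finset.sum_sub_distrib, Finset.sum_const, Finset.card_univ,
    Fintype.card_fin, nsmul_eq_mul, ← Finset.mul_sum] at hE
  have hr' : (1 : ℝ) ≤ r := by exact_mod_cast hr
  have hv2 : |(2 * r - 1 : ℝ) * (∑ a, Real.log ((cnt z₀ a).factorial) -
      (n * Real.log n - n - n * shannon (unif n) z₀))| ≤
      (2 * r + 1) * (Fintype.card Λ * ℓ) := by
    rw [abs_mul]
    gcongr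
    rw [abs_le]; constructor <;> linarith
  have := abs_sub (Real.log n.factorial - (n * Real.log n - n) +
    (2 * r - 1 : ℝ) * (∑ a, Real.log ((cnt z₀ a).factorial) -
      (n * Real.log n - n - n * shannon (unif n) z₀)))
    (∑ i, ∑ a, Real.log ((cnt (edge σ₀ z₀ i) a).factorial) -
      (r * (n * Real.log n - n) - n * ∑ i, shannon (unif n) (edge σ₀ z₀ i)))
  have h3 := abs_add_le (Real.log n.factorial - (n * Real.log n - n))
    ((2 * r - 1 : ℝ) * (∑ a, Real.log ((cnt z₀ a).factorial) -
      (n * Real.log n - n - n * shannon (unif n) z₀)))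
  have h4 : classErr r n (Fintype.card Λ) = ℓ + (2 * r + 1) * (Fintype.card Λ * ℓ) +
      r * (Fintype.card Λ : ℝ) ^ 2 * ℓ := by
    rw [classErr]; ring
  rw [h4]
  refine le_trans (le_of_eq ?_) (this.trans (by linarith))
  congr 1
  ring

/-- The method of types: at most `(n + 1) ^ (r |Λ|²)` edge classes meet `P`. One `classErr` pays for
Stirling's formula and the other for the number of classes. -/
theorem card_le_of_bigF_le [NeZero n] (hr : 1 ≤ r)
    (P : Set ((Gp r →* Equiv.Perm (Fin n)) × (Fin n → Λ))) {c : ℝ}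
    (hP : ∀ p ∈ P, bigF (unif n) p.1 p.2 ≤ c) :
    (Nat.card P : ℝ) ≤ Real.exp (r * (n * Real.log n - n) + n * c +
      2 * classErr r n (Fintype.card Λ)) := by
  classical
  have := Fintype.ofFinite ((Gp r →* Equiv.Perm (Fin n)) × (Fin n → Λ))
  set M := Real.exp (r * (n * Real.log n - n) + n * c + classErr r n (Fintype.card Λ)) with hM
  let f : ((Gp r →* Equiv.Perm (Fin n)) × (Fin n → Λ)) → (Fin r → Λ × Λ → Fin (n + 1)) :=
    fun p i a => ⟨cnt (edge p.1 p.2 i) a, Nat.lt_succ_of_le (cnt_le _ _)⟩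
  have hf : ∀ p q, f p = f q → p ∈ edgeClass q.1 q.2 := by
    intro p q h i
    funext a
    exact congrArg Fin.val (congrFun (congrFun h i) a)
  have hcls : ∀ p ∈ P, (Nat.card (edgeClass p.1 p.2) : ℝ) ≤ M := by
    intro p hp
    have h1 := (abs_le.1 (abs_log_card_edgeClass_sub_le hr p.1 p.2)).2
    have hne : Nonempty (edgeClass p.1 p.2) := ⟨_, self_mem_edgeClass _ _⟩
    have h0 : (0 : ℝ) < Nat.card (edgeClass p.1 p.2) := by exact_mod_cast Nat.card_pos
    rw [← Real.exp_log h0, hM]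
    apply Real.exp_le_exp.2
    have h3 : n * bigF (unif n) p.1 p.2 ≤ n * c :=
      mul_le_mul_of_nonneg_left (hP p hp) n.cast_nonneg
    linarith
  have hcard := Finset.card_le_mul_card_image (f := f) P.toFinset ⌊M⌋₊ (by
    intro a ha
    obtain ⟨q, hq, rfl⟩ := Finset.mem_image.1 ha
    apply Nat.le_floor
    refine le_trans ?_ (hcls q (Set.mem_toFinset.1 hq))
    rw [Nat.cast_le, Nat.card_eq_card_toFinset (edgeClass q.1 q.2)]
    apply Finset.card_le_card
    intro p hp
    rw [Set.mem_toFinset]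
    exact hf _ _ (Finset.mem_filter.1 hp).2)
  have himg : (P.toFinset.image f).card ≤ (n + 1) ^ (r * Fintype.card Λ ^ 2) := by
    refine (Finset.card_le_univ _).trans (le_of_eq ?_)
    simp only [Fintype.card_fun, Fintype.card_fin, Fintype.card_prod]
    rw [← pow_mul]
    congr 1
    ring
  have h1 : (Nat.card P : ℝ) ≤ M * ((n : ℝ) + 1) ^ (r * Fintype.card Λ ^ 2) := by
    rw [Nat.card_eq_card_toFinset P]
    calc ((P.toFinset.card : ℕ) : ℝ) ≤ ((⌊M⌋₊ * (P.toFinset.image f).card : ℕ) : ℝ) := by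
          exact_mod_cast hcard
      _ ≤ M * ((n : ℝ) + 1) ^ (r * Fintype.card Λ ^ 2) := by
          push_cast
          gcongr
          · exact Nat.floor_le (Real.exp_pos _).le
          · exact_mod_cast himg
  refine h1.trans ?_
  have h2 : ((n : ℝ) + 1) ^ (r * Fintype.card Λ ^ 2) =
      Real.exp ((r * (Fintype.card Λ : ℝ) ^ 2) * Real.log (n + 1)) := by
    rw [mul_comm (_ * _) (Real.log _), Real.exp_mul, Real.exp_log (by positivity),
      ← Real.rpow_natCast]
    push_cast
    rfl
  rw [h2, hM, ← Real.exp_add]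
  apply Real.exp_le_exp.2
  have hl : 0 ≤ Real.log ((n : ℝ) + 1) := Real.log_nonneg (by linarith [n.cast_nonneg (α := ℝ)])
  have h5 : (r * (Fintype.card Λ : ℝ) ^ 2) * Real.log (n + 1) ≤ classErr r n (Fintype.card Λ) := by
    rw [classErr, mul_comm]
    gcongr
    · linarith
    · have : (0 : ℝ) ≤ (2 * r + 1) * (Fintype.card Λ : ℝ) := by positivity
      linarith
  linarith

end Stirling

/-! ### Recovering a labeling from its lift to balls -/

section Consistency

variable {r : ℕ} {X A : Type*}

/-- The pairs of patterns on a ball which agree where the second is a shift of the first. -/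
def shiftCompatible (r k : ℕ) (A : Type*) (i : Fin r) :
    Set ((ball (1 : Gp r) k → A) × (ball (1 : Gp r) k → A)) :=
  {p | ∀ (g : Gp r) (hg : g ∈ ball 1 k) (hgs : g * FreeGroup.of i ∈ ball 1 k),
    p.2 ⟨g, hg⟩ = p.1 ⟨g * FreeGroup.of i, hgs⟩}

theorem edge_itinBall_mem_shiftCompatible (T : Gp r →* Equiv.Perm X) (α : X → A) (k : ℕ)
    (i : Fin r) (x : X) : edge T (itinBall T α k) i x ∈ shiftCompatible r k A i := by
  intro g hg hgs
  simp [edge, itinBall, itinOn]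

/-- The labeling by the value at the identity. -/
def root {k : ℕ} (Z : X → ball (1 : Gp r) k → A) (x : X) : A := Z x ⟨1, one_mem_ball k⟩

theorem root_itinBall (T : Gp r →* Equiv.Perm X) (α : X → A) (k : ℕ) :
    root (itinBall T α k) = α := by
  funext x
  simp [root, itinBall, itinOn]

/-- Write `g` as a word and transfer its letters one by one from the position in the pattern to the
base point: each compatible edge allows one transfer. At the end, `Z x` at `g` has become the value
of `Z (T g x)` at the identity. -/
theorem eq_itinBall_of_forall_mem_shiftCompatible {T : Gp r →* Equiv.Perm X} {k : ℕ}
    {Z : X → ball (1 : Gp r) k → A} {x : X}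
    (h : ∀ g ∈ ball (1 : Gp r) (k + 1), ∀ i, edge T Z i (T g x) ∈ shiftCompatible r k A i) :
    Z x = itinBall T (root Z) k x := by
  have key : ∀ L₂ L₁ : List (Fin r × Bool), L₁.length + L₂.length ≤ k →
      ∀ (g : Gp r) (hg : g ∈ ball 1 k), g = FreeGroup.mk (L₁ ++ L₂) →
      ∀ (g₁ : Gp r) (hg₁ : g₁ ∈ ball 1 k), g₁ = FreeGroup.mk L₁ →
      Z x ⟨g, hg⟩ = Z (T (FreeGroup.mk L₂) x) ⟨g₁, hg₁⟩ := by
    intro L₂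
    induction L₂ with
    | nil =>
      rintro L₁ hL g hg rfl g₁ hg₁ rfl
      simp [← FreeGroup.one_eq_mk]
    | cons s L₂ ih =>
      rintro L₁ hL g hg rfl g₁ hg₁ rfl
      simp only [List.length_cons] at hL
      have hmem : (FreeGroup.mk (L₁ ++ [s]) : Gp r) ∈ ball 1 k :=
        mk_mem_ball (by simp only [List.length_append, List.length_singleton]; omega)
      rw [ih (L₁ ++ [s]) (by simp only [List.length_append, List.length_singleton]; omega) _ hg
        (by simp) _ hmem rfl]
      have hsplit : (FreeGroup.mk (s :: L₂) : Gp r) = FreeGroup.mk [s] * FreeGroup.mk L₂ := by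
        rw [FreeGroup.mul_mk]; rfl
      have hsplit' : (FreeGroup.mk (L₁ ++ [s]) : Gp r) = FreeGroup.mk L₁ * FreeGroup.mk [s] := by
        rw [FreeGroup.mul_mk]
      obtain ⟨i, b⟩ := s
      cases b
      · have hs : (FreeGroup.mk [(i, false)] : Gp r) = (FreeGroup.of i)⁻¹ := rfl
        have hb : (FreeGroup.mk ((i, false) :: L₂) : Gp r) ∈ ball 1 (k + 1) :=
          mk_mem_ball (by simp only [List.length_cons]; omega)
        have hT : T (FreeGroup.of i) (T (FreeGroup.mk ((i, false) :: L₂)) x) =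
            T (FreeGroup.mk L₂) x := by
          rw [← Equiv.Perm.mul_apply, ← map_mul, hsplit, hs, mul_inv_cancel_left]
        have e : (FreeGroup.mk (L₁ ++ [(i, false)]) : Gp r) * FreeGroup.of i =
            FreeGroup.mk L₁ := by
          rw [hsplit', hs, inv_mul_cancel_right]
        have hc := h _ hb i _ hmem (by rw [e]; exact hg₁)
        simp only [edge, hT, e] at hc
        exact hc
      · have hs : (FreeGroup.mk [(i, true)] : Gp r) = FreeGroup.of i := rfl
        have hb : (FreeGroup.mk L₂ : Gp r) ∈ ball 1 (k + 1) := mk_mem_ball (by omega)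
        have e : (FreeGroup.mk (L₁ ++ [(i, true)]) : Gp r) =
            FreeGroup.mk L₁ * FreeGroup.of i := by rw [hsplit', hs]
        have hc := h _ hb i (FreeGroup.mk L₁) hg₁ (by rw [← e]; exact hmem)
        simp only [edge] at hc
        rw [hsplit, map_mul, Equiv.Perm.mul_apply, hs, hc]
        simp only [e]
  funext ⟨g, hg⟩
  obtain ⟨L, hL, rfl⟩ := exists_mk_of_mem_ball hg
  exact key L [] (by simpa using hL) _ hg rfl 1 (one_mem_ball k) FreeGroup.one_eq_mk

/-- A union bound: failure at `j` forces an incompatible edge at some `σ g j` with `g` in the ball,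
and since `σ g` is a bijection each `g` contributes the same number of points. -/
theorem card_ne_itinBall_le {S : Type*} [Finite S] (σ : Gp r →* Equiv.Perm S) {k : ℕ}
    (Z : S → ball (1 : Gp r) k → A) :
    Nat.card {j // Z j ≠ itinBall σ (root Z) k j} ≤ (ball (1 : Gp r) (k + 1)).card *
      ∑ i, Nat.card {j // edge σ Z i j ∉ shiftCompatible r k A i} := by
  classical
  have := Fintype.ofFinite S
  have hfil : ∀ (p : S → Prop) [DecidablePred p], Nat.card {j // p j} =
      (Finset.univ.filter p).card := fun p _ => by
    rw [Nat.card_eq_fintype_card, Fintype.card_subtype]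
  have hsub : (Finset.univ.filter fun j => Z j ≠ itinBall σ (root Z) k j) ⊆
      (ball (1 : Gp r) (k + 1)).biUnion fun g => Finset.univ.biUnion fun i =>
        Finset.univ.filter fun j => edge σ Z i (σ g j) ∉ shiftCompatible r k A i := by
    intro j hj
    simp only [Finset.mem_filter, Finset.mem_univ, true_and] at hj
    by_contra hc
    refine hj (eq_itinBall_of_forall_mem_shiftCompatible fun g hg i => ?_)
    by_contra hb
    refine hc (Finset.mem_biUnion.2 ⟨g, hg, Finset.mem_biUnion.2 ⟨i, Finset.mem_univ _, ?_⟩⟩)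
    simpa using hb
  rw [hfil]
  refine (Finset.card_le_card hsub).trans (Finset.card_biUnion_le.trans ?_)
  rw [← smul_eq_mul, ← Finset.sum_const]
  refine Finset.sum_le_sum fun g _ => Finset.card_biUnion_le.trans (Finset.sum_le_sum fun i _ => ?_)
  rw [← hfil]
  exact (Nat.card_congr ((σ g).subtypeEquiv (p := fun j => edge σ Z i (σ g j) ∉ _)
    (q := fun j => edge σ Z i j ∉ shiftCompatible r k A i) fun j => Iff.rfl)).le

theorem eq_itinBall_of_mem_shiftCompatible {T : Gp r →* Equiv.Perm X} {k : ℕ}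
    {Z : X → ball (1 : Gp r) k → A} (h : ∀ i x, edge T Z i x ∈ shiftCompatible r k A i) :
    Z = itinBall T (root Z) k :=
  funext fun _ => eq_itinBall_of_forall_mem_shiftCompatible fun _ _ i => h i _

theorem exists_eq_of_cnt_eq {S S' L : Type*} [Finite S] {f : S → L} {g : S' → L}
    (h : cnt f = cnt g) (s : S) : ∃ s', g s' = f s := by
  have h1 : cnt f (f s) ≠ 0 := by
    have : Nonempty {s' // f s' = f s} := ⟨s, rfl⟩
    exact Nat.card_pos.ne'
  rw [h] at h1
  obtain ⟨⟨s', hs'⟩⟩ := (Nat.card_ne_zero.1 h1).1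
  exact ⟨s', hs'⟩

/-- A pair with the edge counts of a lifted labeling is a lifted labeling. -/
theorem eq_itinBall_of_mem_edgeClass {S : Type*} [Finite S] {σ₀ : Gp r →* Equiv.Perm S}
    {k : ℕ} {y₀ : S → A} {σ : Gp r →* Equiv.Perm S} {Y : S → ball (1 : Gp r) k → A}
    (h : (σ, Y) ∈ edgeClass σ₀ (itinBall σ₀ y₀ k)) : Y = itinBall σ (root Y) k := by
  refine eq_itinBall_of_mem_shiftCompatible fun i j => ?_
  -- Equal counts mean that every edge pattern of `Y` occurs in the true lift, hence is compatible.
  obtain ⟨j', hj'⟩ := exists_eq_of_cnt_eq (h i) j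
  rw [← hj']
  exact edge_itinBall_mem_shiftCompatible _ _ _ _ _

end Consistency

/-! ### Hamming distance -/

section Hamming

variable {n : ℕ}

/-- A Chernoff bound. Give each disagreement weight `t`: a point of the Hamming ball has weight at
least `t ^ d`, and the total weight is at most `(1 + |A| t) ^ n`. -/
theorem card_ne_le_rpow_mul_exp {A : Type*} [Fintype A] (x₀ : Fin n → A) {d t : ℝ} (ht : 0 < t)
    (ht1 : t ≤ 1) :
    (Nat.card {x : Fin n → A // (Nat.card {j // x j ≠ x₀ j} : ℝ) ≤ d} : ℝ) ≤
      Real.exp (d * Real.log t⁻¹ + Fintype.card A * t * n) := by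
  classical
  set w : (Fin n → A) → ℝ := fun x => ∏ j, if x j = x₀ j then 1 else t with hw
  have hw0 : ∀ x, 0 ≤ w x := fun x => Finset.prod_nonneg fun j _ => by split_ifs <;> positivity
  have htot : ∑ x, w x ≤ Real.exp (Fintype.card A * t * n) := by
    have h1 : ∑ x, w x = ∏ j, ∑ a, if a = x₀ j then 1 else t := by
      rw [Finset.prod_univ_sum, Fintype.piFinset_univ]
    have h2 : ∀ j, (∑ a, if a = x₀ j then (1 : ℝ) else t) ≤ Real.exp (Fintype.card A * t) := by
      intro j
      have : (∑ a, if a = x₀ j then (1 : ℝ) else t) ≤ ∑ a, ((if a = x₀ j then 1 else 0) + t) := by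
        refine Finset.sum_le_sum fun a _ => ?_
        split_ifs <;> linarith
      refine this.trans ?_
      rw [Finset.sum_add_distrib]
      simp only [Finset.sum_ite_eq', Finset.mem_univ, if_true, Finset.sum_const,
        Finset.card_univ, nsmul_eq_mul]
      linarith [Real.add_one_le_exp (Fintype.card A * t)]
    rw [h1]
    refine (Finset.prod_le_prod (fun j _ => Finset.sum_nonneg fun a _ => ?_)
      fun j _ => h2 j).trans ?_
    · split_ifs <;> positivity
    · rw [Finset.prod_const, Finset.card_univ, Fintype.card_fin, ← Real.exp_nat_mul]
      exact (congrArg Real.exp (by ring)).le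
  have hw1 : ∀ x, (Nat.card {j // x j ≠ x₀ j} : ℝ) ≤ d → Real.exp (-(d * Real.log t⁻¹)) ≤ w x := by
    intro x hx
    have : w x = Real.exp (-(Nat.card {j // x j ≠ x₀ j} * Real.log t⁻¹)) := by
      rw [hw]
      simp only [Finset.prod_ite, Finset.prod_const_one, one_mul, Finset.prod_const]
      rw [Nat.card_eq_fintype_card, Fintype.card_subtype, Real.log_inv, mul_neg, neg_neg,
        Real.exp_nat_mul, Real.exp_log ht]
    rw [this]
    apply Real.exp_le_exp.2
    have hl : 0 ≤ Real.log t⁻¹ := Real.log_nonneg ((one_le_inv₀ ht).2 ht1)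
    exact neg_le_neg (mul_le_mul_of_nonneg_right hx hl)
  have hmain : (Nat.card {x : Fin n → A // (Nat.card {j // x j ≠ x₀ j} : ℝ) ≤ d} : ℝ) *
      Real.exp (-(d * Real.log t⁻¹)) ≤ ∑ x, w x := by
    rw [Nat.card_eq_fintype_card, Fintype.card_subtype, ← nsmul_eq_mul, ← Finset.sum_const]
    refine (Finset.sum_le_sum fun x hx => hw1 x (Finset.mem_filter.1 hx).2).trans ?_
    exact Finset.sum_le_sum_of_subset_of_nonneg (Finset.filter_subset _ _) fun x _ _ => hw0 x
  have h3 := hmain.trans htot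
  rw [Real.exp_neg, ← div_eq_mul_inv, div_le_iff₀ (Real.exp_pos _), ← Real.exp_add] at h3
  rwa [add_comm]

variable {Λ : Type*} [Fintype Λ] [MeasurableSpace Λ] [MeasurableSingletonClass Λ]

theorem lawDist_unif_le [NeZero n] (z w : Fin n → Λ) :
    lawDist (unif n) z (unif n) w ≤ 2 * Nat.card {j // z j ≠ w j} / n := by
  classical
  have hc : ∀ (z : Fin n → Λ) a, (cnt z a : ℝ) = ∑ j, if z j = a then (1 : ℝ) else 0 := by
    intro z a
    rw [cnt_eq_card_filter]; simp
  have h : ∀ a, |law (unif n) z a - law (unif n) w a| ≤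
      (∑ j, |(if z j = a then (1 : ℝ) else 0) - if w j = a then 1 else 0|) / n := by
    intro a
    rw [law_unif, law_unif, ← sub_div, abs_div, Nat.abs_cast, hc, hc, ← Finset.sum_sub_distrib]
    gcongr
    exact Finset.abs_sum_le_sum_abs _ _
  unfold lawDist
  refine (Finset.sum_le_sum fun a _ => h a).trans ?_
  rw [← Finset.sum_div, Finset.sum_comm, Nat.card_eq_fintype_card, Fintype.card_subtype]
  gcongr
  rw [mul_comm, ← nsmul_eq_mul, ← Finset.sum_const, Finset.sum_filter]
  refine Finset.sum_le_sum fun j _ => ?_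
  split_ifs with hj
  · refine (Finset.sum_le_sum fun a _ => abs_sub _ _).trans ?_
    rw [Finset.sum_add_distrib]
    simp only [apply_ite abs, abs_one, abs_zero, Finset.sum_ite_eq, Finset.mem_univ, if_true]
    norm_num
  · push Not at hj
    simp [hj]

/-- Patterns outside `C` have probability zero under `γ`, so their whole empirical mass appears in
the `ℓ¹` distance. -/
theorem card_not_mem_le [NeZero n] {X : Type*} [MeasurableSpace X] {μ : Measure X} {γ : X → Λ}
    (hγ : Measurable γ) {C : Set Λ} (hC : ∀ x, γ x ∈ C) (z : Fin n → Λ) :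
    (Nat.card {j // z j ∉ C} : ℝ) ≤ n * lawDist (unif n) z μ γ := by
  classical
  have hn : (n : ℝ) ≠ 0 := by exact_mod_cast NeZero.ne n
  have h1 : Nat.card {j // z j ∉ C} = ∑ a with a ∉ C, cnt z a := by
    rw [Nat.card_eq_fintype_card, Fintype.card_subtype,
      Finset.card_eq_sum_card_fiberwise (f := z) (t := Finset.univ.filter fun a => a ∉ C)
        (fun x hx => by simpa using hx)]
    refine Finset.sum_congr rfl fun a ha => ?_
    rw [cnt_eq_card_filter]
    congr 1
    ext x
    simp only [Finset.mem_filter, Finset.mem_univ, true_and] at ha ⊢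
    constructor
    · exact fun h => h.2
    · rintro rfl; exact ⟨ha, rfl⟩
  rw [h1, lawDist, Finset.mul_sum]
  push_cast
  refine (Finset.sum_le_sum fun a ha => ?_).trans (Finset.sum_le_sum_of_subset_of_nonneg
    (Finset.filter_subset _ _) fun a _ _ => mul_nonneg n.cast_nonneg (abs_nonneg _))
  have h0 : law μ γ a = 0 := by
    by_contra hne
    obtain ⟨x, rfl⟩ := law_pos_imp hγ hne
    exact (Finset.mem_filter.1 ha).2 (hC x)
  rw [h0, sub_zero, law_unif, abs_of_nonneg (by positivity)]
  exact (mul_div_cancel₀ _ hn).ge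

end Hamming

/-! ### Labelings with prescribed counts -/

section Extension

variable {S A B : Type*} [Finite S] [Fintype A]

/-- A partial labeling extends to a labeling with prescribed joint counts. -/
theorem exists_extension_cnt_eq [DecidableEq A] [DecidableEq B] (Y : S → B) (t : A × B → ℕ)
    (ht : ∀ b, ∑ a, t (a, b) = cnt Y b) (U : Finset S) (f : S → A)
    (hU : ∀ c, (U.filter fun s => joint f Y s = c).card ≤ t c) :
    ∃ f' : S → A, (∀ s ∈ U, f' s = f s) ∧ cnt (joint f' Y) = t := by
  classical
  have := Fintype.ofFinite S
  have hsum : ∀ (V : Finset S) (f : S → A) b,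
      ∑ a, (V.filter fun s => joint f Y s = (a, b)).card = (V.filter fun s => Y s = b).card := by
    intro V f b
    rw [Finset.card_eq_sum_card_fiberwise (f := f) (s := V.filter fun s => Y s = b)
      (t := Finset.univ) (fun x _ => by simp)]
    refine Finset.sum_congr rfl fun a _ => ?_
    rw [Finset.filter_filter]
    congr 1
    ext s
    simp only [joint, Prod.mk.injEq, and_comm]
  -- Induction on the number of points not yet labeled. An unlabeled point `s` shows that the quota
  -- over `Y s` is not exhausted, so some value `a` is still available.
  induction hk : (Finset.univ \ U).card using Nat.strong_induction_on generalizing U f with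
  | _ k ih =>
    by_cases hall : U = Finset.univ
    · subst hall
      refine ⟨f, fun _ _ => rfl, ?_⟩
      funext ⟨a, b⟩
      have h1 : ∑ a, (Finset.univ.filter fun s => joint f Y s = (a, b)).card = ∑ a, t (a, b) := by
        rw [hsum, ht, cnt_eq_card_filter]
      rw [cnt_eq_card_filter]
      exact (Finset.sum_eq_sum_iff_of_le fun a _ => hU (a, b)).1 h1 a (Finset.mem_univ a)
    · obtain ⟨s, hs⟩ : ∃ s, s ∉ U := by
        by_contra! hc
        exact hall (Finset.eq_univ_iff_forall.2 hc)
      have hlt : ∑ a, (U.filter fun u => joint f Y u = (a, Y s)).card < ∑ a, t (a, Y s) := by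
        rw [hsum, ht, cnt_eq_card_filter]
        refine Finset.card_lt_card ⟨Finset.filter_subset_filter _ (Finset.subset_univ _), ?_⟩
        intro hsub
        exact hs (Finset.mem_filter.1 (hsub (by simp : s ∈ _))).1
      obtain ⟨a, -, ha⟩ := Finset.exists_lt_of_sum_lt hlt
      have hne : ∀ u ∈ U, Function.update f s a u = f u := fun u hu =>
        Function.update_of_ne (by rintro rfl; exact hs hu) _ _
      have hcard : (Finset.univ \ insert s U).card < k := by
        rw [← hk]
        refine Finset.card_lt_card ⟨Finset.sdiff_subset_sdiff le_rfl (Finset.subset_insert _ _), ?_⟩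
        intro hsub
        have : s ∈ Finset.univ \ insert s U := hsub (by simpa using hs)
        simp at this
      have hfil : ∀ c, (U.filter fun u => joint (Function.update f s a) Y u = c) =
          U.filter fun u => joint f Y u = c := fun c =>
        Finset.filter_congr fun u hu => by simp only [joint, hne u hu]
      obtain ⟨f', hf', hcnt⟩ := ih _ hcard (insert s U) (Function.update f s a) (by
        intro c
        rw [Finset.filter_insert, hfil]
        split_ifs with hc
        · rw [Finset.card_insert_of_notMem (by simp [hs])]
          have hc' : c = (a, Y s) := by rw [← hc]; simp [joint]
          rw [hc']
          exact ha
        · exact hU c) rfl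
      exact ⟨f', fun u hu => (hf' u (Finset.mem_insert_of_mem hu)).trans (hne u hu), hcnt⟩

/-- There is a labeling with joint counts above prescribed lower bounds. -/
theorem exists_le_cnt [Nonempty A] (Y : S → B) (t : A × B → ℕ)
    (ht : ∀ b, ∑ a, t (a, b) ≤ cnt Y b) : ∃ f : S → A, ∀ c, t c ≤ cnt (joint f Y) c := by
  classical
  obtain ⟨a₀⟩ := ‹Nonempty A›
  -- All surplus is assigned to one default value, which makes the marginal counts exact.
  set t' : A × B → ℕ := fun c => t c + if c.1 = a₀ then cnt Y c.2 - ∑ a, t (a, c.2) else 0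
  obtain ⟨f, -, hf⟩ := exists_extension_cnt_eq Y t' (fun b => by
    simp only [t', Finset.sum_add_distrib, Finset.sum_ite_eq', Finset.mem_univ, if_true]
    have := ht b
    omega) ∅ (fun _ => a₀) (by simp)
  exact ⟨f, fun c => by rw [hf]; exact Nat.le_add_right _ _⟩

variable [Fintype B]

/-- A labeling can be changed at few points so as to have prescribed joint counts. -/
theorem exists_cnt_joint_eq_of_cnt_eq (Y Y' : S → B) (hY : cnt Y = cnt Y') (f g : S → A) :
    ∃ f' : S → A, cnt (joint f' Y) = cnt (joint g Y') ∧
      (Nat.card {s // f' s ≠ f s} : ℝ) ≤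
        ∑ c, |(cnt (joint f Y) c : ℝ) - cnt (joint g Y') c| := by
  classical
  have := Fintype.ofFinite S
  -- In each joint class, keep as many points as the target count allows; only the excess is
  -- relabeled.
  have hex : ∀ c : A × B, ∃ V ⊆ Finset.univ.filter fun s => joint f Y s = c,
      V.card = min (cnt (joint f Y) c) (cnt (joint g Y') c) := fun c =>
    Finset.exists_subset_card_eq (by rw [← cnt_eq_card_filter]; exact min_le_left _ _)
  choose V hV hVc using hex
  have hVmem : ∀ c s, s ∈ V c → joint f Y s = c := fun c s hs =>
    (Finset.mem_filter.1 (hV c hs)).2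
  set U : Finset S := Finset.univ.filter fun s => s ∈ V (joint f Y s) with hUdef
  have hUV : ∀ c, (U.filter fun s => joint f Y s = c) = V c := by
    intro c
    ext s
    simp only [hUdef, Finset.mem_filter, Finset.mem_univ, true_and]
    constructor
    · rintro ⟨h, rfl⟩; exact h
    · intro h
      have := hVmem c s h
      exact ⟨this ▸ h, this⟩
  obtain ⟨f', hf', hcnt⟩ := exists_extension_cnt_eq Y (cnt (joint g Y')) (fun b => by
    have := cnt_comp (joint g Y') Prod.snd b
    change cnt Y' b = _ at this
    rw [hY, this, Finset.sum_filter, Fintype.sum_prod_type]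
    simp only [Finset.sum_ite_eq', Finset.mem_univ, if_true]) U f (fun c => by
    rw [hUV, hVc]; exact min_le_right _ _)
  refine ⟨f', hcnt, ?_⟩
  have hsub : (Finset.univ.filter fun s => f' s ≠ f s) ⊆ Finset.univ \ U := by
    intro s hs
    simp only [Finset.mem_filter, Finset.mem_univ, true_and] at hs
    simp only [Finset.mem_sdiff, Finset.mem_univ, true_and]
    exact fun h => hs (hf' s h)
  have h1 : Nat.card {s // f' s ≠ f s} ≤ (Finset.univ \ U).card := by
    rw [Nat.card_eq_fintype_card, Fintype.card_subtype]
    exact Finset.card_le_card hsub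
  have h2 : (Finset.univ \ U).card = ∑ c, (cnt (joint f Y) c - (V c).card) := by
    rw [Finset.card_eq_sum_card_fiberwise (f := joint f Y) (t := Finset.univ) (fun x _ => by simp)]
    refine Finset.sum_congr rfl fun c _ => ?_
    rw [cnt_eq_card_filter, ← Finset.card_sdiff_of_subset (hV c), ← hUV]
    congr 1
    ext s
    simp only [Finset.mem_filter, Finset.mem_sdiff, Finset.mem_univ, true_and]
    tauto
  have h3 : (Nat.card {s // f' s ≠ f s} : ℝ) ≤
      ∑ c, ((cnt (joint f Y) c - (V c).card : ℕ) : ℝ) := by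
    exact_mod_cast h1.trans h2.le
  refine h3.trans (Finset.sum_le_sum fun c _ => ?_)
  rw [hVc]
  rcases le_total (cnt (joint f Y) c) (cnt (joint g Y') c) with h | h
  · rw [min_eq_left h]; simp
  · rw [min_eq_right h, Nat.cast_sub h]
    exact le_abs_self _

end Extension

/-! ### Extending labelings of finite systems -/

section FiniteExtension

theorem lawDist_congr_cnt {n : ℕ} {X L : Type*} [MeasurableSpace X] {μ : Measure X}
    [Fintype L] [MeasurableSpace L]
    [MeasurableSingletonClass L] {z w : Fin n → L} (h : cnt z = cnt w) (γ : X → L) :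
    lawDist (unif n) z μ γ = lawDist (unif n) w μ γ := by
  simp only [lawDist, law_unif, h]

variable {n : ℕ} [NeZero n] {X A B : Type*} [MeasurableSpace X]
  [Fintype A] [MeasurableSpace A] [MeasurableSingletonClass A]
  [Fintype B] [MeasurableSpace B] [MeasurableSingletonClass B]
  {μ : Measure X} [IsProbabilityMeasure μ]

/-- Over each value of `Y`, distribute labels according to the conditional law of `a` given `b`,
rounded down. The rounding costs at most one point per joint value. -/
theorem exists_lawDist_joint_le [Nonempty A] (Y : Fin n → B) {a : X → A} (ha : Measurable a)
    {b : X → B} (hb : Measurable b) :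
    ∃ x : Fin n → A, lawDist (unif n) (joint x Y) μ (joint a b) ≤
      2 * lawDist (unif n) Y μ b + 2 * (Fintype.card A * Fintype.card B) / n := by
  classical
  have hn : (0 : ℝ) < n := by exact_mod_cast NeZero.pos n
  have hab : Measurable (joint a b) := ha.prodMk hb
  set p := law μ (joint a b) with hp
  set pB := law μ b with hpB
  have hp0 : ∀ c, 0 ≤ p c := law_nonneg _ _
  have hpB0 : ∀ c, 0 ≤ pB c := law_nonneg _ _
  have hmarg : ∀ y, pB y = ∑ x, p (x, y) := by
    intro y
    have : law μ b y = _ := law_comp hab (Prod.snd : A × B → B) y (μ := μ)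
    rw [hpB, this, Finset.sum_filter, Fintype.sum_prod_type]
    simp only [Finset.sum_ite_eq', Finset.mem_univ, if_true, hp]
  -- The conditional law; it is zero where `pB` vanishes, and there `p` vanishes too, so `p = q pB`
  -- everywhere.
  set q : A × B → ℝ := fun c => p c / pB c.2 with hq
  have hq0 : ∀ c, 0 ≤ q c := fun c => div_nonneg (hp0 c) (hpB0 _)
  have hq1 : ∀ y, ∑ x, q (x, y) ≤ 1 := by
    intro y
    simp only [hq, ← Finset.sum_div, ← hmarg]
    exact div_self_le_one _
  have hpq : ∀ c, p c = q c * pB c.2 := by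
    rintro ⟨x, y⟩
    rcases eq_or_ne (pB y) 0 with h | h
    · have h1 : p (x, y) ≤ pB y := by
        rw [hmarg]
        exact Finset.single_le_sum (f := fun x => p (x, y)) (fun _ _ => hp0 _) (Finset.mem_univ x)
      simp only [h, mul_zero]
      exact le_antisymm (h ▸ h1) (hp0 _)
    · simp only [hq]
      field_simp
  obtain ⟨x, hx⟩ := exists_le_cnt Y (fun c : A × B => ⌊(cnt Y c.2 : ℝ) * q c⌋₊) (fun y => by
    have h1 : (∑ x, (⌊(cnt Y y : ℝ) * q (x, y)⌋₊ : ℝ)) ≤ cnt Y y := by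
      calc _ ≤ ∑ x, (cnt Y y : ℝ) * q (x, y) := Finset.sum_le_sum fun x _ =>
            Nat.floor_le (mul_nonneg (Nat.cast_nonneg _) (hq0 _))
        _ = cnt Y y * ∑ x, q (x, y) := by rw [Finset.mul_sum]
        _ ≤ cnt Y y := mul_le_of_le_one_right (Nat.cast_nonneg _) (hq1 y)
    exact_mod_cast h1)
  refine ⟨x, ?_⟩
  set c' := law (unif n) (joint x Y) with hc'
  have hdef : ∀ c, p c - c' c ≤ q c * |law (unif n) Y c.2 - pB c.2| + 1 / n := by
    intro c
    have h1 : (cnt Y c.2 : ℝ) * q c - 1 ≤ cnt (joint x Y) c := by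
      have h2 := Nat.lt_floor_add_one ((cnt Y c.2 : ℝ) * q c)
      have h3 : ((⌊(cnt Y c.2 : ℝ) * q c⌋₊ : ℕ) : ℝ) ≤ cnt (joint x Y) c := by
        exact_mod_cast hx c
      linarith
    have h4 : q c * law (unif n) Y c.2 - 1 / n ≤ c' c := by
      rw [hc', law_unif, law_unif, le_div_iff₀ hn]
      have : (q c * (cnt Y c.2 / n) - 1 / n) * n = cnt Y c.2 * q c - 1 := by field_simp
      rw [this]; exact h1
    have h5 : q c * (pB c.2 - law (unif n) Y c.2) ≤ q c * |law (unif n) Y c.2 - pB c.2| := by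
      rw [abs_sub_comm]
      exact mul_le_mul_of_nonneg_left (le_abs_self _) (hq0 c)
    rw [hpq]
    linarith
  -- Only the deficit `p - c'` is controlled. Both laws have mass one, so the signed term sums to
  -- zero and the full distance is at most twice the total deficit bound.
  have habs : ∀ c, |c' c - p c| ≤
      2 * (q c * |law (unif n) Y c.2 - pB c.2| + 1 / n) - (p c - c' c) := by
    intro c
    have h0 : 0 ≤ q c * |law (unif n) Y c.2 - pB c.2| + 1 / n :=
      add_nonneg (mul_nonneg (hq0 c) (abs_nonneg _)) (by positivity)
    have := hdef c
    rw [abs_le]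
    constructor <;> linarith
  have hsum1 : ∑ c, p c = 1 := sum_law hab
  have hsum2 : ∑ c, c' c = 1 := sum_law (measurable_of_finite _)
  have hsumq : ∑ c, q c * |law (unif n) Y c.2 - pB c.2| ≤ lawDist (unif n) Y μ b := by
    rw [Fintype.sum_prod_type, Finset.sum_comm]
    refine Finset.sum_le_sum fun y _ => ?_
    simp only [← Finset.sum_mul]
    exact mul_le_of_le_one_left (abs_nonneg _) (hq1 y)
  calc lawDist (unif n) (joint x Y) μ (joint a b) = ∑ c, |c' c - p c| := rfl
    _ ≤ ∑ c, (2 * (q c * |law (unif n) Y c.2 - pB c.2| + 1 / n) - (p c - c' c)) :=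
        Finset.sum_le_sum fun c _ => habs c
    _ = 2 * ∑ c, q c * |law (unif n) Y c.2 - pB c.2| +
        2 * (Fintype.card A * Fintype.card B) / n := by
        rw [Finset.sum_sub_distrib, Finset.sum_sub_distrib, hsum1, hsum2, ← Finset.mul_sum,
          Finset.sum_add_distrib, Finset.sum_const, Finset.card_univ, Fintype.card_prod]
        simp only [nsmul_eq_mul, Nat.cast_mul]
        ring
    _ ≤ _ := by linarith

theorem sum_abs_cnt_sub_eq {L : Type*} [Fintype L] [MeasurableSpace L]
    [MeasurableSingletonClass L] (z w : Fin n → L) :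
    ∑ c, |(cnt z c : ℝ) - cnt w c| = n * lawDist (unif n) z (unif n) w := by
  have hn : (0 : ℝ) < n := by exact_mod_cast NeZero.pos n
  rw [lawDist, Finset.mul_sum]
  refine Finset.sum_congr rfl fun c _ => ?_
  rw [law_unif, law_unif, ← sub_div, abs_div, Nat.abs_cast]
  field_simp

variable {r : ℕ}

/-- Given a labeled finite system whose edge statistics are close to those of a factor `b`, there
are a homomorphism with the same edge statistics and an extension of the labeling for which the
edge statistics are close to those of `(a, b)`. -/
theorem exists_edge_extension [Nonempty A] (hr : 1 ≤ r) (σ : Gp r →* Equiv.Perm (Fin n))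
    (Y : Fin n → B) {T : Gp r →* Equiv.Perm X} (hT : ∀ g, MeasurePreserving (T g) μ μ)
    {a : X → A} (ha : Measurable a) {b : X → B} (hb : Measurable b) {Δ : ℝ}
    (hΔ : ∀ i, lawDist (unif n) (edge σ Y i) μ (edge T b i) ≤ Δ) :
    ∃ (σ' : Gp r →* Equiv.Perm (Fin n)) (x : Fin n → A),
      (∀ i, cnt (edge σ' Y i) = cnt (edge σ Y i)) ∧
      ∀ i, lawDist (unif n) (edge σ' (joint x Y) i) μ (edge T (joint a b) i) ≤
        9 * (2 * Δ + 2 * ((Fintype.card A : ℝ) * Fintype.card B) ^ 2 / n) := by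
  have hn : (0 : ℝ) < n := by exact_mod_cast NeZero.pos n
  have hTm : ∀ g, Measurable (T g) := fun g => (hT g).measurable
  have hab : Measurable (joint a b) := ha.prodMk hb
  have hσm : ∀ g, Measurable (σ g) := fun g => measurable_of_finite _
  -- One bound for vertex and edge labelings alike: the square is the size of the alphabet of pairs
  -- of joint labels.
  set Δ₁ := 2 * Δ + 2 * ((Fintype.card A : ℝ) * Fintype.card B) ^ 2 / n with hΔ₁
  obtain ⟨x, hx⟩ : ∃ x : Fin n → A, lawDist (unif n) (joint x Y) μ (joint a b) ≤ Δ₁ := by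
    obtain ⟨x, hx⟩ := exists_lawDist_joint_le (μ := μ) Y ha hb
    refine ⟨x, hx.trans ?_⟩
    have h1 : lawDist (unif n) Y μ b ≤ Δ :=
      (lawDist_comp_le (measurable_edge hσm (measurable_of_finite Y) ⟨0, hr⟩)
        (measurable_edge hTm hb ⟨0, hr⟩) Prod.fst).trans (hΔ _)
    have h2 : ((Fintype.card A : ℝ) * Fintype.card B) ≤
        ((Fintype.card A : ℝ) * Fintype.card B) ^ 2 := by
      exact_mod_cast Nat.le_self_pow two_ne_zero _
    rw [hΔ₁]
    gcongr
  -- An edge labeling `e = (f, g)` models the pair of `a` values along generator `i`. By invariance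
  -- both `f` over `Y` and `g` over `Y ∘ σ sᵢ` have nearly the joint counts of `(x, Y)`; after a
  -- small correction they have exactly those, so both are rearrangements of `(x, Y)`, by `τ` and
  -- `ρ`.
  have hstep : ∀ i, ∃ τ ρ : Equiv.Perm (Fin n), Y ∘ τ = Y ∧ Y ∘ ρ = Y ∘ σ (FreeGroup.of i) ∧
      lawDist (unif n) (joint (joint x Y ∘ τ) (joint x Y ∘ ρ)) μ (edge T (joint a b) i) ≤
        9 * Δ₁ := by
    intro i
    obtain ⟨e, he⟩ := exists_lawDist_joint_le (μ := μ) (edge σ Y i) (measurable_edge hTm ha i)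
      (measurable_edge hTm hb i)
    have he1 : lawDist (unif n) (joint e (edge σ Y i)) μ (joint (edge T a i) (edge T b i)) ≤
        Δ₁ := by
      refine he.trans ?_
      rw [hΔ₁, Fintype.card_prod, Fintype.card_prod]
      have h3 : ((Fintype.card A * Fintype.card A : ℕ) : ℝ) * (Fintype.card B * Fintype.card B : ℕ)
          = ((Fintype.card A : ℝ) * Fintype.card B) ^ 2 := by push_cast; ring
      rw [h3]
      have := hΔ i
      linarith
    have hmE : Measurable (joint (edge T a i) (edge T b i)) :=
      (measurable_edge hTm ha i).prodMk (measurable_edge hTm hb i)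
    have hmF : Measurable (joint e (edge σ Y i)) := measurable_of_finite _
    set f : Fin n → A := fun j => (e j).1
    set g : Fin n → A := fun j => (e j).2
    have hf : lawDist (unif n) (joint f Y) μ (joint a b) ≤ Δ₁ :=
      (lawDist_comp_le hmF hmE (fun z : (A × A) × (B × B) => (z.1.1, z.2.1))).trans he1
    have hg : lawDist (unif n) (joint g (Y ∘ σ (FreeGroup.of i))) μ (joint a b) ≤ Δ₁ := by
      have h4 : lawDist (unif n) (joint g (Y ∘ σ (FreeGroup.of i))) μ
          (joint a b ∘ T (FreeGroup.of i)) ≤ Δ₁ :=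
        (lawDist_comp_le hmF hmE (fun z : (A × A) × (B × B) => (z.1.2, z.2.2))).trans he1
      simpa only [lawDist, law_comp_measurePreserving hab (hT _)] using h4
    have hE : lawDist (unif n) (joint (joint f Y) (joint g (Y ∘ σ (FreeGroup.of i)))) μ
        (edge T (joint a b) i) ≤ Δ₁ :=
      (lawDist_comp_le hmF hmE
        (fun z : (A × A) × (B × B) => ((z.1.1, z.2.1), (z.1.2, z.2.2)))).trans he1
    obtain ⟨f', hf', hfc⟩ := exists_cnt_joint_eq_of_cnt_eq Y Y rfl f x
    obtain ⟨g', hg', hgc⟩ := exists_cnt_joint_eq_of_cnt_eq (Y ∘ σ (FreeGroup.of i)) Y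
      (cnt_comp_equiv _ _) g x
    rw [sum_abs_cnt_sub_eq] at hfc hgc
    have hx' := hx
    rw [lawDist_comm] at hx'
    have hfc' : (Nat.card {j // f' j ≠ f j} : ℝ) ≤ n * (2 * Δ₁) := hfc.trans <|
      mul_le_mul_of_nonneg_left ((lawDist_triangle _ _ μ (joint a b) _ _).trans (by linarith))
        hn.le
    have hgc' : (Nat.card {j // g' j ≠ g j} : ℝ) ≤ n * (2 * Δ₁) := hgc.trans <|
      mul_le_mul_of_nonneg_left ((lawDist_triangle _ _ μ (joint a b) _ _).trans (by linarith))
        hn.le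
    obtain ⟨τ, hτ⟩ := exists_perm_of_cnt_eq hf'.symm
    obtain ⟨ρ, hρ⟩ := exists_perm_of_cnt_eq hg'.symm
    refine ⟨τ, ρ, congrArg (Prod.snd ∘ ·) hτ, congrArg (Prod.snd ∘ ·) hρ, ?_⟩
    rw [hτ, hρ]
    refine (lawDist_triangle _ _ (unif n)
      (joint (joint f Y) (joint g (Y ∘ σ (FreeGroup.of i)))) _ _).trans ?_
    have hham : (Nat.card {j // joint (joint f' Y) (joint g' (Y ∘ σ (FreeGroup.of i))) j ≠
        joint (joint f Y) (joint g (Y ∘ σ (FreeGroup.of i))) j} : ℝ) ≤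
        Nat.card {j // f' j ≠ f j} + Nat.card {j // g' j ≠ g j} := by
      classical
      simp only [Nat.card_eq_fintype_card, Fintype.card_subtype]
      rw [← Nat.cast_add, Nat.cast_le]
      refine le_trans (Finset.card_le_card ?_) (Finset.card_union_le _ _)
      intro j hj
      simp only [Finset.mem_union, Finset.mem_filter, Finset.mem_univ, true_and, joint, ne_eq,
        Prod.mk.injEq, and_true] at hj ⊢
      tauto
    have h5 := lawDist_unif_le (joint (joint f' Y) (joint g' (Y ∘ σ (FreeGroup.of i))))
      (joint (joint f Y) (joint g (Y ∘ σ (FreeGroup.of i))))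
    -- Each correction changes at most `2 Δ₁ n` points, so the pair changes at `4 Δ₁ n` points, and
    -- the distance of laws doubles this. With the original `Δ₁` the total is `9 Δ₁`.
    have h6 : lawDist (unif n) (joint (joint f' Y) (joint g' (Y ∘ σ (FreeGroup.of i)))) (unif n)
        (joint (joint f Y) (joint g (Y ∘ σ (FreeGroup.of i)))) ≤ 8 * Δ₁ := by
      refine h5.trans ?_
      rw [div_le_iff₀ hn]
      linarith
    linarith
  choose τ ρ hτ hρ hlaw using hstep
  -- This permutation joins the two ends of each modeled edge. As `τ` fixes `Y` and `Y ∘ ρ = Y ∘ σ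
  -- sᵢ`, the edge counts of `Y` are unchanged.
  set σ' : Gp r →* Equiv.Perm (Fin n) := FreeGroup.lift fun i => ρ i * (τ i)⁻¹ with hσ'
  refine ⟨σ', x, fun i => ?_, fun i => ?_⟩
  · have hedge : edge σ' Y i ∘ τ i = edge σ Y i := by
      funext j
      have h1 := congrFun (hτ i) j
      have h2 := congrFun (hρ i) j
      simp only [Function.comp] at h1 h2
      simp [edge, hσ', h1, h2]
    rw [← cnt_comp_equiv (edge σ' Y i) (τ i), hedge]
  · have hedge : edge σ' (joint x Y) i ∘ τ i = joint (joint x Y ∘ τ i) (joint x Y ∘ ρ i) := by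
      funext j
      simp [edge, joint, hσ']
    rw [← lawDist_congr_cnt (cnt_comp_equiv (edge σ' (joint x Y) i) (τ i)), hedge]
    exact hlaw i

end FiniteExtension

/-! ### The pseudometrics in terms of edge laws -/

section DStar

theorem measurable_restrict {r : ℕ} {A : Type*} [MeasurableSpace A] (H : Finset (Gp r)) :
    Measurable (H.restrict : (Gp r → A) → H → A) :=
  measurable_pi_lambda _ fun _ => measurable_pi_apply _

variable {r : ℕ} {X Z A : Type*} [MeasurableSpace X] [MeasurableSpace Z] [Fintype A]
  [MeasurableSpace A] [MeasurableSingletonClass A]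

theorem dOn_eq_lawDist {r : ℕ} {A : Type*} [Fintype A] [MeasurableSpace A]
    (H : Finset (Gp r)) (P Q : Measure (Gp r → A)) :
    dOn H P Q = 1 / 2 * lawDist P H.restrict Q H.restrict := rfl

theorem dOn_nonneg {r : ℕ} {A : Type*} [Fintype A] [MeasurableSpace A] (H : Finset (Gp r))
    (P Q : Measure (Gp r → A)) :
    0 ≤ dOn H P Q :=
  mul_nonneg (by norm_num) (lawDist_nonneg _ _ _ _)

theorem law_restrict_map_itin {X A : Type*} [MeasurableSpace X] [MeasurableSpace A]
    {μ : Measure X} {T : Gp r →* Equiv.Perm X}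
    (hT : ∀ g, Measurable (T g)) {α : X → A} (hα : Measurable α) (H : Finset (Gp r)) :
    law (μ.map (itin T α)) H.restrict = law μ (itinOn T α H) := by
  funext a
  unfold law
  rw [Measure.map_map (measurable_restrict H) (measurable_itin hT hα)]
  rfl

/-- The pair of ball patterns contained in a pattern on `B(e, k) ∪ B(sᵢ, k)`. -/
def pairOfPattern {A : Type*} (k : ℕ) (i : Fin r)
    (a : (ball 1 k ∪ ball (FreeGroup.of i) k : Finset (Gp r)) → A) :
    (ball (1 : Gp r) k → A) × (ball (1 : Gp r) k → A) :=
  (fun g => a ⟨g, Finset.mem_union_left _ g.2⟩,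
    fun g => a ⟨g * FreeGroup.of i, Finset.mem_union_right _
      (by rw [mem_ball_iff, mul_inv_cancel_right]; exact g.2)⟩)

/-- The pattern on `B(e, k) ∪ B(sᵢ, k)` determined by a pair of ball patterns. -/
def patternOfPair {A : Type*} (k : ℕ) (i : Fin r)
    (p : (ball (1 : Gp r) k → A) × (ball (1 : Gp r) k → A))
    (g : (ball 1 k ∪ ball (FreeGroup.of i) k : Finset (Gp r))) : A :=
  if h : g.1 ∈ ball (1 : Gp r) k then p.1 ⟨g, h⟩ else
    p.2 ⟨g * (FreeGroup.of i)⁻¹, mem_ball_iff.1 ((Finset.mem_union.1 g.2).resolve_left h)⟩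

theorem edge_itinBall_eq_comp {X A : Type*} (T : Gp r →* Equiv.Perm X) (α : X → A) (k : ℕ)
    (i : Fin r) : edge T (itinBall T α k) i =
      pairOfPattern k i ∘ itinOn T α (ball 1 k ∪ ball (FreeGroup.of i) k) := by
  funext x
  refine Prod.ext rfl ?_
  funext g
  simp [edge, itinBall, itinOn, pairOfPattern]

theorem itinOn_eq_comp_edge {X A : Type*} (T : Gp r →* Equiv.Perm X) (α : X → A) (k : ℕ)
    (i : Fin r) : itinOn T α (ball 1 k ∪ ball (FreeGroup.of i) k) =
      patternOfPair k i ∘ edge T (itinBall T α k) i := by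
  funext x g
  by_cases h : g.1 ∈ ball (1 : Gp r) k
  · simp [edge, itinBall, itinOn, patternOfPair, h]
  · simp only [edge, itinBall, itinOn, Function.comp, patternOfPair, h, dite_false]
    rw [← Equiv.Perm.mul_apply, ← map_mul, inv_mul_cancel_right]

/-- Since `B(sᵢ, k) = B(e, k) sᵢ`, a pattern on the union of the two balls and the pair of ball
patterns at the ends of an edge determine each other. -/
theorem lawDist_edge_itinBall_eq {μ : Measure X} [IsProbabilityMeasure μ] {ν : Measure Z}
    [IsProbabilityMeasure ν] {T : Gp r →* Equiv.Perm X} (hT : ∀ g, Measurable (T g))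
    {S : Gp r →* Equiv.Perm Z} (hS : ∀ g, Measurable (S g)) {α : X → A} (hα : Measurable α)
    {δ : Z → A} (hδ : Measurable δ) (k : ℕ) (i : Fin r) :
    lawDist μ (edge T (itinBall T α k) i) ν (edge S (itinBall S δ k) i) =
      lawDist μ (itinOn T α (ball 1 k ∪ ball (FreeGroup.of i) k)) ν
        (itinOn S δ (ball 1 k ∪ ball (FreeGroup.of i) k)) := by
  apply le_antisymm
  · rw [edge_itinBall_eq_comp, edge_itinBall_eq_comp]
    exact lawDist_comp_le (measurable_itinOn hT hα _) (measurable_itinOn hS hδ _) _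
  · rw [itinOn_eq_comp_edge, itinOn_eq_comp_edge]
    exact lawDist_comp_le (measurable_edge hT (measurable_itinOn hT hα _) i)
      (measurable_edge hS (measurable_itinOn hS hδ _) i) _

theorem dStar_map_itin {μ : Measure X} [IsProbabilityMeasure μ] {ν : Measure Z}
    [IsProbabilityMeasure ν] {T : Gp r →* Equiv.Perm X} (hT : ∀ g, Measurable (T g))
    {S : Gp r →* Equiv.Perm Z} (hS : ∀ g, Measurable (S g)) {α : X → A} (hα : Measurable α)
    {δ : Z → A} (hδ : Measurable δ) (k : ℕ) :
    dStar k (μ.map (itin T α)) (ν.map (itin S δ)) =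
      1 / 2 * ∑ i, lawDist μ (edge T (itinBall T α k) i) ν (edge S (itinBall S δ k) i) := by
  rw [dStar, Finset.mul_sum]
  refine Finset.sum_congr rfl fun i _ => ?_
  rw [dOn_eq_lawDist, lawDist_edge_itinBall_eq hT hS hα hδ]
  simp only [lawDist, law_restrict_map_itin hT hα, law_restrict_map_itin hS hδ]

/-- This is what makes the stochastic block model countable: its defining condition is membership of
the lifted labeling in an edge class. -/
theorem dStar_empirical_eq_zero_iff {n : ℕ} [NeZero n] (k : ℕ) (σ σ₀ : Gp r →* Equiv.Perm (Fin n))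
    (y y₀ : Fin n → A) : dStar k (empirical σ y) (empirical σ₀ y₀) = 0 ↔
      (σ, itinBall σ y k) ∈ edgeClass σ₀ (itinBall σ₀ y₀ k) := by
  have hm : ∀ (σ : Gp r →* Equiv.Perm (Fin n)) g, Measurable (σ g) :=
    fun σ g => measurable_of_finite _
  rw [empirical, empirical, dStar_map_itin (hm σ) (hm σ₀) (measurable_of_finite _)
    (measurable_of_finite _), mul_eq_zero, or_iff_right (by norm_num),
    Finset.sum_eq_zero_iff_of_nonneg fun _ _ => lawDist_nonneg _ _ _ _]
  simp only [Finset.mem_univ, true_imp_iff, cnt_eq_iff_lawDist]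
  rfl

end DStar

/-! ### Weak neighborhoods of laws of itineraries -/

section Weak

theorem isClopen_restrict_preimage {r : ℕ} {A : Type*} [Finite A] [TopologicalSpace A]
    [DiscreteTopology A] (H : Finset (Gp r)) (s : Set (H → A)) :
    IsClopen ((H.restrict : (Gp r → A) → H → A) ⁻¹' s) :=
  (isClopen_discrete s).preimage (continuous_pi fun _ => continuous_apply _)

variable {r : ℕ} {A : Type*} [Fintype A] [TopologicalSpace A] [DiscreteTopology A]
  [MeasurableSpace A] [DiscreteMeasurableSpace A]

theorem continuous_law_restrict (H : Finset (Gp r)) (a : H → A) :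
    Continuous fun P : ProbabilityMeasure (Gp r → A) =>
      law (P : Measure (Gp r → A)) H.restrict a := by
  rw [continuous_iff_continuousAt]
  intro P
  have h := ProbabilityMeasure.tendsto_measure_of_isClopen_of_tendsto
    (tendsto_id (α := ProbabilityMeasure (Gp r → A)) (x := 𝓝 P))
    (isClopen_restrict_preimage H {a})
  have h2 := (NNReal.tendsto_coe.2 h)
  simp only [law_eq (measurable_restrict H), ContinuousAt]
  exact h2

theorem isOpen_dStar_lt (k : ℕ) (Q : Measure (Gp r → A)) (ε : ℝ) :
    IsOpen {P : ProbabilityMeasure (Gp r → A) | dStar k (P : Measure (Gp r → A)) Q < ε} := by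
  refine isOpen_lt ?_ continuous_const
  refine continuous_finsetSum _ fun i _ => ?_
  exact continuous_const.mul (continuous_finsetSum _ fun a _ =>
    ((continuous_law_restrict _ a).sub continuous_const).abs)

theorem abs_real_preimage_sub_le_lawDist {X Z Λ : Type*} [MeasurableSpace X] [MeasurableSpace Z]
    [Fintype Λ] [MeasurableSpace Λ] [MeasurableSingletonClass Λ] {μ : Measure X}
    [IsFiniteMeasure μ] {ν : Measure Z} [IsFiniteMeasure ν] {γ : X → Λ} (hγ : Measurable γ)
    {δ : Z → Λ} (hδ : Measurable δ) (s : Set Λ) :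
    |μ.real (γ ⁻¹' s) - ν.real (δ ⁻¹' s)| ≤ lawDist μ γ ν δ := by
  classical
  have h1 : μ.real (γ ⁻¹' s) = ∑ a with a ∈ s, law μ γ a := by
    rw [Finset.sum_congr rfl fun a _ => law_eq hγ a,
      sum_measureReal_preimage_singleton _ fun a _ => hγ (measurableSet_singleton a)]
    congr 1; ext x; simp
  have h2 : ν.real (δ ⁻¹' s) = ∑ a with a ∈ s, law ν δ a := by
    rw [Finset.sum_congr rfl fun a _ => law_eq hδ a,
      sum_measureReal_preimage_singleton _ fun a _ => hδ (measurableSet_singleton a)]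
    congr 1; ext x; simp
  rw [h1, h2, ← Finset.sum_sub_distrib]
  exact (Finset.abs_sum_le_sum_abs _ _).trans (Finset.sum_le_sum_of_subset_of_nonneg
    (Finset.filter_subset _ _) fun _ _ _ => abs_nonneg _)

theorem lawDist_ball_le_dStar {A : Type*} [Fintype A] [MeasurableSpace A]
    [DiscreteMeasurableSpace A] (hr : 1 ≤ r) {k l : ℕ} (hkl : k ≤ l)
    (P Q : Measure (Gp r → A)) [IsProbabilityMeasure P] [IsProbabilityMeasure Q] :
    lawDist P (ball 1 k).restrict Q (ball 1 k).restrict ≤ 2 * dStar l P Q := by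
  have h1 : dOn (ball 1 l ∪ ball (FreeGroup.of (⟨0, hr⟩ : Fin r)) l) P Q ≤ dStar l P Q :=
    Finset.single_le_sum (f := fun i => dOn (ball 1 l ∪ ball (FreeGroup.of i) l) P Q)
      (fun _ _ => dOn_nonneg _ _ _) (Finset.mem_univ _)
  have hsub : ball (1 : Gp r) k ⊆ ball 1 l ∪ ball (FreeGroup.of (⟨0, hr⟩ : Fin r)) l :=
    (ball_mono hkl 1).trans Finset.subset_union_left
  have h2 := lawDist_comp_le (μ := P) (ν := Q) (measurable_restrict (A := A) _)
    (measurable_restrict (A := A) _) (Finset.restrict₂ (π := fun _ => A) hsub)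
  rw [Finset.restrict₂_comp_restrict] at h2
  rw [dOn_eq_lawDist] at h1
  linarith

/-- Otherwise some `P k` outside `O` would satisfy `dStar k (P k) Q < 1 / (k + 1)`. Its
probabilities converge on all cylinders over balls, a π-system containing arbitrarily small
neighborhoods of each point, so `P k` converges weakly to `Q`. -/
theorem exists_dStar_lt_subset (hr : 1 ≤ r) {O : Set (ProbabilityMeasure (Gp r → A))}
    (hO : IsOpen O) {Q : ProbabilityMeasure (Gp r → A)} (hQ : Q ∈ O) :
    ∃ k : ℕ, ∃ ε > 0, ∀ P : ProbabilityMeasure (Gp r → A),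
      dStar k (P : Measure (Gp r → A)) Q < ε → P ∈ O := by
  by_contra! hc
  choose P hP hPO using fun k : ℕ => hc k (1 / ((k : ℝ) + 1)) (by positivity)
  have hlim : Tendsto P atTop (𝓝 Q) := by
    refine IsPiSystem.tendsto_probabilityMeasure_of_tendsto_of_mem
      (S := {s | ∃ k, ∃ t : Set (ball (1 : Gp r) k → A), s = (ball 1 k).restrict ⁻¹' t})
      ?_ ?_ ?_ ?_
    · rintro _ ⟨k, t, rfl⟩ _ ⟨l, u, rfl⟩ -
      refine ⟨max k l, Finset.restrict₂ (π := fun _ => A) (ball_mono (le_max_left k l) 1) ⁻¹' t ∩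
        Finset.restrict₂ (π := fun _ => A) (ball_mono (le_max_right k l) 1) ⁻¹' u, ?_⟩
      rw [Set.preimage_inter, ← Set.preimage_comp, ← Set.preimage_comp,
        Finset.restrict₂_comp_restrict, Finset.restrict₂_comp_restrict]
    · rintro _ ⟨k, t, rfl⟩
      exact measurable_restrict _ t.toFinite.measurableSet
    · intro u hu x hx
      obtain ⟨I, v, hv, hI⟩ := isOpen_pi_iff.1 hu x hx
      set k := I.sup FreeGroup.norm with hk
      have hIk : ∀ g ∈ I, g ∈ ball (1 : Gp r) k := fun g hg =>
        mem_ball_one.2 (Finset.le_sup (f := FreeGroup.norm) hg)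
      refine ⟨(ball 1 k).restrict ⁻¹' {(ball 1 k).restrict x}, ⟨k, _, rfl⟩,
        (isClopen_restrict_preimage _ _).isOpen.mem_nhds rfl, fun z hz => hI fun g hg => ?_⟩
      have : z g = x g := congrFun hz ⟨g, hIk g hg⟩
      rw [this]
      exact (hv g hg).2
    · rintro _ ⟨k, t, rfl⟩
      rw [← NNReal.tendsto_coe]
      rw [tendsto_iff_dist_tendsto_zero]
      have hlim0 : Tendsto (fun j : ℕ => 2 * (1 / ((j : ℝ) + 1))) atTop (𝓝 0) := by
        simpa using (tendsto_one_div_add_atTop_nhds_zero_nat (𝕜 := ℝ)).const_mul 2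
      refine squeeze_zero' (Eventually.of_forall fun _ => dist_nonneg) ?_ hlim0
      filter_upwards [eventually_ge_atTop k] with j hj
      rw [Real.dist_eq]
      refine (abs_real_preimage_sub_le_lawDist (μ := (P j : Measure (Gp r → A)))
        (ν := (Q : Measure (Gp r → A))) (measurable_restrict _) (measurable_restrict _) t).trans ?_
      refine (lawDist_ball_le_dStar hr hj _ _).trans ?_
      have := (hP j).le
      linarith
  obtain ⟨j, hj⟩ := (hlim.eventually (hO.mem_nhds hQ)).exists
  exact hPO j hj

end Weak

/-! ### Symmetrization of the expected number of extensions -/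

section Symmetrization

variable {r n : ℕ} {A B Λ : Type*}

/-- The conjugate `g ↦ τ⁻¹ σ(g) τ`. -/
def conjHom {S : Type*} (τ : Equiv.Perm S) (σ : Gp r →* Equiv.Perm S) : Gp r →* Equiv.Perm S :=
  (MulAut.conj τ⁻¹).toMonoidHom.comp σ

theorem conjHom_apply {S : Type*} (τ : Equiv.Perm S) (σ : Gp r →* Equiv.Perm S) (g : Gp r) :
    conjHom τ σ g = τ⁻¹ * σ g * τ := by
  simp [conjHom]

theorem conjHom_injective {S : Type*} (τ : Equiv.Perm S) :
    Function.Injective (conjHom (r := r) τ) := by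
  intro σ σ' h
  ext1 i
  have := DFunLike.congr_fun h (FreeGroup.of i)
  simpa only [conjHom_apply, mul_left_inj, mul_right_inj] using this

theorem empirical_conjHom [MeasurableSpace Λ] (τ : Equiv.Perm (Fin n))
    (σ : Gp r →* Equiv.Perm (Fin n)) (z : Fin n → Λ) :
    empirical (conjHom τ σ) (z ∘ τ) = empirical σ z := by
  have h : itin (conjHom τ σ) (z ∘ τ) = itin σ z ∘ τ := by
    funext j g
    simp [itin, conjHom_apply]
  have hm : Measurable (itin σ z) := measurable_of_finite _
  rw [empirical, h, ← Measure.map_map hm (measurePreserving_unif τ).measurable,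
    (measurePreserving_unif τ).map_eq, empirical]

/-- Conjugating and relabeling by `τ` maps the fiber over `y` injectively to the fiber over `y ∘ τ`.
Permutations act transitively on labelings with equal counts, so all fibers have the same size. -/
theorem card_eq_mul_card_fiber [Finite B] [Finite Λ] (π : Λ → B) (y₀ : Fin n → B)
    (P : Set ((Gp r →* Equiv.Perm (Fin n)) × (Fin n → Λ)))
    (hinv : ∀ p ∈ P, ∀ τ : Equiv.Perm (Fin n), (conjHom τ p.1, p.2 ∘ τ) ∈ P)
    (hcnt : ∀ p ∈ P, cnt (π ∘ p.2) = cnt y₀) :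
    Nat.card P = Nat.card {y : Fin n → B // cnt y = cnt y₀} *
      Nat.card {p // p ∈ P ∧ π ∘ p.2 = y₀} := by
  classical
  have := Fintype.ofFinite B
  have hle : ∀ (y : Fin n → B) (τ : Equiv.Perm (Fin n)),
      Nat.card {p // p ∈ P ∧ π ∘ p.2 = y} ≤ Nat.card {p // p ∈ P ∧ π ∘ p.2 = y ∘ τ} := by
    intro y τ
    refine Nat.card_le_card_of_injective (fun p => ⟨(conjHom τ p.1.1, p.1.2 ∘ τ),
      hinv _ p.2.1 τ, by rw [← Function.comp_assoc, p.2.2]⟩) ?_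
    rintro ⟨⟨σ, z⟩, hp⟩ ⟨⟨σ', z'⟩, hp'⟩ h
    simp only [Subtype.mk.injEq, Prod.mk.injEq] at h ⊢
    exact ⟨conjHom_injective τ h.1, τ.surjective.injective_comp_right h.2⟩
  have heq : ∀ y : {y : Fin n → B // cnt y = cnt y₀},
      Nat.card {p // p ∈ P ∧ π ∘ p.2 = y.1} = Nat.card {p // p ∈ P ∧ π ∘ p.2 = y₀} := by
    rintro ⟨y, hy⟩
    obtain ⟨τ, rfl⟩ := exists_perm_of_cnt_eq hy.symm
    refine le_antisymm ?_ (hle y₀ τ)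
    have := hle (y₀ ∘ τ) τ⁻¹
    rwa [show (y₀ ∘ τ) ∘ (τ⁻¹ : Equiv.Perm (Fin n)) = y₀ by funext j; simp] at this
  have e : P ≃ Σ y : {y : Fin n → B // cnt y = cnt y₀}, {p // p ∈ P ∧ π ∘ p.2 = y.1} :=
    { toFun := fun p => ⟨⟨π ∘ p.1.2, hcnt _ p.2⟩, p.1, p.2, rfl⟩
      invFun := fun q => ⟨q.2.1, q.2.2.1⟩
      left_inv := fun p => rfl
      right_inv := by
        rintro ⟨⟨y, hy⟩, p, hp, hpy⟩
        obtain rfl : π ∘ p.2 = y := hpy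
        rfl }
  rw [Nat.card_congr e, Nat.card_sigma, Finset.sum_congr rfl fun y _ => heq y, Finset.sum_const,
    smul_eq_mul, Finset.card_univ, ← Nat.card_eq_fintype_card]

variable [Fintype A] [MeasurableSpace A]
  [Fintype B] [MeasurableSpace B] [MeasurableSingletonClass B]

/-- The pairs of a homomorphism and a joint labeling that is good for the neighborhood `O` and
whose second coordinate has the same statistics as a given labeling. -/
def goodPairs (σ₀ : Gp r →* Equiv.Perm (Fin n)) (y₀ : Fin n → B) (k : ℕ)
    (O : Set (ProbabilityMeasure (Gp r → A × B))) :
    Set ((Gp r →* Equiv.Perm (Fin n)) × (Fin n → A × B)) :=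
  {p | dStar k (empirical p.1 (Prod.snd ∘ p.2)) (empirical σ₀ y₀) = 0 ∧ p.2 ∈ goodModels p.1 O}

/-- The pairs of a homomorphism and a labeling with given statistics. -/
def statPairs (σ₀ : Gp r →* Equiv.Perm (Fin n)) (y₀ : Fin n → B) (k : ℕ) :
    Set ((Gp r →* Equiv.Perm (Fin n)) × (Fin n → B)) :=
  {p | dStar k (empirical p.1 p.2) (empirical σ₀ y₀) = 0}

theorem cnt_eq_of_dStar_eq_zero [NeZero n] (hr : 1 ≤ r) {k : ℕ}
    {σ σ₀ : Gp r →* Equiv.Perm (Fin n)} {y y₀ : Fin n → B}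
    (h : dStar k (empirical σ y) (empirical σ₀ y₀) = 0) : cnt y = cnt y₀ := by
  have h1 := cnt_eq_of_mem_edgeClass hr ((dStar_empirical_eq_zero_iff k σ σ₀ y y₀).1 h)
  have h2 := cnt_comp_congr h1 fun a : ball (1 : Gp r) k → B => a ⟨1, one_mem_ball k⟩
  have h3 := root_itinBall σ y k
  have h4 := root_itinBall σ₀ y₀ k
  rw [← h3, ← h4]
  exact h2

theorem card_goodPairs [NeZero n] (hr : 1 ≤ r) (σ₀ : Gp r →* Equiv.Perm (Fin n))
    (y₀ : Fin n → B) (k : ℕ) (O : Set (ProbabilityMeasure (Gp r → A × B))) :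
    Nat.card (goodPairs σ₀ y₀ k O) = Nat.card {y : Fin n → B // cnt y = cnt y₀} *
      Nat.card (Σ σ : {σ // dStar k (empirical σ y₀) (empirical σ₀ y₀) = 0},
        {x : Fin n → A // joint x y₀ ∈ goodModels σ.1 O}) := by
  rw [card_eq_mul_card_fiber Prod.snd y₀]
  · congr 1
    refine Nat.card_congr
      { toFun := fun p => ⟨⟨p.1.1, by
          have := p.2.1.1
          rwa [p.2.2] at this⟩, Prod.fst ∘ p.1.2, by
          have := p.2.1.2
          have e : joint (Prod.fst ∘ p.1.2) y₀ = p.1.2 :=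
            funext fun j => Prod.ext rfl (congrFun p.2.2 j).symm
          rwa [e]⟩
        invFun := fun q => ⟨(q.1.1, joint q.2.1 y₀), ⟨q.1.2, q.2.2⟩, rfl⟩
        left_inv := ?_
        right_inv := fun q => rfl }
    rintro ⟨⟨σ, z⟩, hp, rfl⟩
    rfl
  · rintro ⟨σ, z⟩ ⟨h1, P, hP, h2⟩ τ
    refine ⟨?_, P, hP, ?_⟩
    · rw [← Function.comp_assoc, empirical_conjHom]; exact h1
    · rw [empirical_conjHom]; exact h2
  · rintro ⟨σ, z⟩ ⟨h1, -⟩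
    exact cnt_eq_of_dStar_eq_zero hr h1

theorem card_statPairs [NeZero n] (hr : 1 ≤ r) (σ₀ : Gp r →* Equiv.Perm (Fin n))
    (y₀ : Fin n → B) (k : ℕ) :
    Nat.card (statPairs σ₀ y₀ k) = Nat.card {y : Fin n → B // cnt y = cnt y₀} *
      Nat.card {σ // dStar k (empirical σ y₀) (empirical σ₀ y₀) = 0} := by
  rw [card_eq_mul_card_fiber id y₀]
  · congr 1
    refine Nat.card_congr
      { toFun := fun p => ⟨p.1.1, by
          obtain ⟨⟨σ, z⟩, hp, rfl⟩ := p
          exact hp⟩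
        invFun := fun q => ⟨(q.1, y₀), q.2, rfl⟩
        left_inv := ?_
        right_inv := fun q => rfl }
    rintro ⟨⟨σ, z⟩, hp, rfl⟩
    rfl
  · rintro ⟨σ, z⟩ h τ
    simp only [statPairs, Set.mem_ofPred_eq, empirical_conjHom] at h ⊢
    exact h
  · rintro ⟨σ, z⟩ h
    exact cnt_eq_of_dStar_eq_zero hr h

theorem lintegral_uniformOn {Ω : Type*} [Finite Ω] [MeasurableSpace Ω]
    [MeasurableSingletonClass Ω] (s : Set Ω) (f : Ω → ENNReal) :
    ∫⁻ ω, f ω ∂ProbabilityTheory.uniformOn s = (∑' ω : s, f ω) / Nat.card s := by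
  rw [ProbabilityTheory.uniformOn, ProbabilityTheory.cond, lintegral_smul_measure,
    smul_eq_mul, lintegral_countable f s.to_countable, mul_comm, div_eq_mul_inv,
    Measure.count_apply s.toFinite.measurableSet, Set.encard, ENat.card_eq_coe_natCard]
  simp only [Measure.count_singleton, mul_one, ENat.toENNReal_coe]

/-- The number of labelings with the counts of `y₀` is a common factor of both cardinalities and
cancels. Fixing `y₀` thus costs nothing. -/
theorem expectedExtensions_eq [NeZero n] (hr : 1 ≤ r) (σ₀ : Gp r →* Equiv.Perm (Fin n))
    (y₀ : Fin n → B) (k : ℕ) (O : Set (ProbabilityMeasure (Gp r → A × B))) :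
    expectedExtensions (sbm σ₀ y₀ k) y₀ O =
      (Nat.card (goodPairs σ₀ y₀ k O) : ENNReal) / Nat.card (statPairs σ₀ y₀ k) := by
  have hne : Nonempty {y : Fin n → B // cnt y = cnt y₀} := ⟨y₀, rfl⟩
  have hV : Nat.card {y : Fin n → B // cnt y = cnt y₀} ≠ 0 := Nat.card_pos.ne'
  rw [card_goodPairs hr, card_statPairs hr]
  push_cast
  rw [ENNReal.mul_div_mul_left _ _ (by exact_mod_cast hV) (ENNReal.natCast_ne_top _),
    expectedExtensions, sbm, lintegral_uniformOn]
  congr 1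
  have := Fintype.ofFinite {σ | dStar k (empirical σ y₀) (empirical σ₀ y₀) = 0}
  rw [tsum_fintype]
  have h := Nat.card_sigma (α := {σ | dStar k (empirical σ y₀) (empirical σ₀ y₀) = 0})
    (β := fun σ => {x : Fin n → A // joint x y₀ ∈ goodModels σ.1 O})
  exact_mod_cast h.symm

end Symmetrization

/-! ### From cardinality estimates to exponential rates -/

section Rates

theorem log_div_div_le {N D : ℕ} {n : ℕ} (hn : 0 < n) {a b : ℝ} (hN : (N : ℝ) ≤ Real.exp a)
    (hD : Real.exp b ≤ D) :
    ENNReal.log ((N : ENNReal) / D) / (n : EReal) ≤ (((a - b) / n : ℝ) : EReal) := by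
  have hD0 : (0 : ℝ) < D := (Real.exp_pos b).trans_le hD
  have h1 : (N : ENNReal) / D = ENNReal.ofReal ((N : ℝ) / D) := by
    rw [ENNReal.ofReal_div_of_pos hD0, ENNReal.ofReal_natCast, ENNReal.ofReal_natCast]
  have h2 : (N : ℝ) / D ≤ Real.exp (a - b) := by
    rw [Real.exp_sub]
    exact div_le_div₀ (Real.exp_pos _).le hN (Real.exp_pos _) hD
  have h3 : ENNReal.log ((N : ENNReal) / D) ≤ ((a - b : ℝ) : EReal) := by
    rw [h1]
    refine (ENNReal.log_monotone (ENNReal.ofReal_le_ofReal h2)).trans (le_of_eq ?_)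
    rw [ENNReal.log_ofReal_of_pos (Real.exp_pos _), Real.log_exp]
  refine (EReal.monotone_div_right_of_nonneg (by exact_mod_cast hn.le) h3).trans (le_of_eq ?_)
  rw [EReal.coe_div]
  rfl

theorem le_log_div_div {N D : ℕ} {n : ℕ} (hn : 0 < n) {a b : ℝ} (hN : Real.exp a ≤ N)
    (hD : (D : ℝ) ≤ Real.exp b) (hD0 : 0 < D) :
    (((a - b) / n : ℝ) : EReal) ≤ ENNReal.log ((N : ENNReal) / D) / (n : EReal) := by
  have hD0' : (0 : ℝ) < D := by exact_mod_cast hD0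
  have h1 : (N : ENNReal) / D = ENNReal.ofReal ((N : ℝ) / D) := by
    rw [ENNReal.ofReal_div_of_pos hD0', ENNReal.ofReal_natCast, ENNReal.ofReal_natCast]
  have h2 : Real.exp (a - b) ≤ (N : ℝ) / D := by
    rw [Real.exp_sub]
    exact div_le_div₀ ((Real.exp_pos _).le.trans hN) hN hD0' hD
  have h3 : ((a - b : ℝ) : EReal) ≤ ENNReal.log ((N : ENNReal) / D) := by
    rw [h1]
    refine (le_of_eq ?_).trans (ENNReal.log_monotone (ENNReal.ofReal_le_ofReal h2))
    rw [ENNReal.log_ofReal_of_pos (Real.exp_pos _), Real.log_exp]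
  refine (le_of_eq ?_).trans (EReal.monotone_div_right_of_nonneg (by exact_mod_cast hn.le) h3)
  rw [EReal.coe_div]
  rfl

end Rates

/-! ### Upper and lower bounds on the numbers of pairs -/

section Bounds

theorem measurable_itinBall {r : ℕ} {X A : Type*} [MeasurableSpace X] [MeasurableSpace A]
    {T : Gp r →* Equiv.Perm X} (hT : ∀ g, Measurable (T g)) {α : X → A} (hα : Measurable α)
    (k : ℕ) : Measurable (itinBall T α k) :=
  measurable_itinOn hT hα _

theorem joint_itinBall_eq_comp {r : ℕ} {S A B : Type*} (σ : Gp r →* Equiv.Perm S)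
    (z : S → A × B) {k₁ k₂ k : ℕ}
    (h₁ : k₁ ≤ k) (h₂ : k₂ ≤ k) :
    joint (itinBall σ (Prod.fst ∘ z) k₁) (itinBall σ (Prod.snd ∘ z) k₂) =
      (fun p : ball (1 : Gp r) k → A × B =>
        ((fun g : ball (1 : Gp r) k₁ => (p ⟨g, ball_mono h₁ 1 g.2⟩).1),
          fun g : ball (1 : Gp r) k₂ => (p ⟨g, ball_mono h₂ 1 g.2⟩).2)) ∘ itinBall σ z k := rfl

variable {r n : ℕ} {A B : Type*} [Fintype A] [MeasurableSpace A] [MeasurableSingletonClass A]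
  [Fintype B] [MeasurableSpace B] [MeasurableSingletonClass B] [NeZero n]

/-- The main term of the logarithm of the number of homomorphisms. -/
def homTerm (r n : ℕ) : ℝ := r * (n * Real.log n - n)

/-- Passing to ball patterns is a bijection onto the edge class, because every member of the class
is an exact lift of its root. -/
theorem card_statPairs_eq (σ₀ : Gp r →* Equiv.Perm (Fin n)) (y₀ : Fin n → B) (k : ℕ) :
    Nat.card (statPairs σ₀ y₀ k) = Nat.card (edgeClass σ₀ (itinBall σ₀ y₀ k)) := by
  refine Nat.card_congr
    { toFun := fun p => ⟨(p.1.1, itinBall p.1.1 p.1.2 k),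
        (dStar_empirical_eq_zero_iff k _ _ _ _).1 p.2⟩
      invFun := fun q => ⟨(q.1.1, root q.1.2), (dStar_empirical_eq_zero_iff k _ _ _ _).2 (by
        have h := eq_itinBall_of_mem_edgeClass (σ := q.1.1) (Y := q.1.2) q.2
        rw [← h]
        exact q.2)⟩
      left_inv := fun p => Subtype.ext (Prod.ext rfl (root_itinBall _ _ _))
      right_inv := fun q => Subtype.ext (Prod.ext rfl
        (eq_itinBall_of_mem_edgeClass (σ := q.1.1) (Y := q.1.2) q.2).symm) }

theorem statPairs_card_pos (σ₀ : Gp r →* Equiv.Perm (Fin n)) (y₀ : Fin n → B) (k : ℕ) :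
    0 < Nat.card (statPairs σ₀ y₀ k) := by
  rw [card_statPairs_eq]
  have : Nonempty (edgeClass σ₀ (itinBall σ₀ y₀ k)) := ⟨_, self_mem_edgeClass _ _⟩
  exact Nat.card_pos

theorem exp_le_card_edgeClass {Λ : Type*} [Fintype Λ] [MeasurableSpace Λ]
    [MeasurableSingletonClass Λ] (hr : 1 ≤ r) (σ₀ : Gp r →* Equiv.Perm (Fin n)) (z₀ : Fin n → Λ) :
    Real.exp (homTerm r n + n * bigF (unif n) σ₀ z₀ - classErr r n (Fintype.card Λ)) ≤
      Nat.card (edgeClass σ₀ z₀) := by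
  have : Nonempty (edgeClass σ₀ z₀) := ⟨_, self_mem_edgeClass _ _⟩
  have h0 : (0 : ℝ) < Nat.card (edgeClass σ₀ z₀) := by exact_mod_cast Nat.card_pos
  rw [← Real.exp_log h0]
  apply Real.exp_le_exp.2
  have := (abs_le.1 (abs_log_card_edgeClass_sub_le hr σ₀ z₀)).1
  rw [homTerm]
  linarith

theorem card_edgeClass_le_exp {Λ : Type*} [Fintype Λ] [MeasurableSpace Λ]
    [MeasurableSingletonClass Λ] (hr : 1 ≤ r) (σ₀ : Gp r →* Equiv.Perm (Fin n)) (z₀ : Fin n → Λ) :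
    (Nat.card (edgeClass σ₀ z₀) : ℝ) ≤
      Real.exp (homTerm r n + n * bigF (unif n) σ₀ z₀ + classErr r n (Fintype.card Λ)) := by
  have : Nonempty (edgeClass σ₀ z₀) := ⟨_, self_mem_edgeClass _ _⟩
  have h0 : (0 : ℝ) < Nat.card (edgeClass σ₀ z₀) := by exact_mod_cast Nat.card_pos
  rw [← Real.exp_log h0]
  apply Real.exp_le_exp.2
  have := (abs_le.1 (abs_log_card_edgeClass_sub_le hr σ₀ z₀)).2
  rw [homTerm]
  linarith

variable {X : Type*} [MeasurableSpace X] {μ : Measure X} [IsProbabilityMeasure μ]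
  {T : Gp r →* Equiv.Perm X} {α : X → A} {β : X → B}

theorem lawDist_edge_le_dStar {Z : Type*} [MeasurableSpace Z] {ν : Measure Z}
    [IsProbabilityMeasure ν] (hT : ∀ g, Measurable (T g))
    {S : Gp r →* Equiv.Perm Z} (hS : ∀ g, Measurable (S g)) (hα : Measurable α)
    {δ : Z → A} (hδ : Measurable δ) (k : ℕ) (i : Fin r) :
    lawDist μ (edge T (itinBall T α k) i) ν (edge S (itinBall S δ k) i) ≤
      2 * dStar k (μ.map (itin T α)) (ν.map (itin S δ)) := by
  rw [dStar_map_itin hT hS hα hδ]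
  have := Finset.single_le_sum (f := fun i =>
    lawDist μ (edge T (itinBall T α k) i) ν (edge S (itinBall S δ k) i))
    (fun _ _ => lawDist_nonneg _ _ _ _) (Finset.mem_univ i)
  linarith

/-- The exact condition on the second coordinate is discarded and only closeness to the joint law is
kept. The lift to radii `k₁`, `k₂` is injective, and its alphabet depends on neither `m` nor `n`, so
the method of types applies. -/
theorem card_goodPairs_le (hr : 1 ≤ r) (hT : ∀ g, MeasurePreserving (T g) μ μ)
    (hα : Measurable α) (hβ : Measurable β) (σ₀ : Gp r →* Equiv.Perm (Fin n)) (y₀ : Fin n → B)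
    (m : ℕ) {k₁ k₂ k : ℕ} (h₁ : k₁ ≤ k) (h₂ : k₂ ≤ k) {ε L : ℝ} (hL : 0 ≤ L) :
    (Nat.card (goodPairs σ₀ y₀ m {P : ProbabilityMeasure (Gp r → A × B) |
      dStar k (P : Measure (Gp r → A × B)) (μ.map (itin T (joint α β))) < ε}) : ℝ) ≤
    Real.exp (homTerm r n + n * (bigF μ T (joint (itinBall T α k₁) (itinBall T β k₂)) +
      (3 * r + 1) * (L * (2 * ε) + (Fintype.card ((ball (1 : Gp r) k₁ → A) ×
        (ball (1 : Gp r) k₂ → B)) : ℝ) ^ 2 * Real.exp (-L))) +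
      2 * classErr r n (Fintype.card ((ball (1 : Gp r) k₁ → A) × (ball (1 : Gp r) k₂ → B)))) := by
  have hTm : ∀ g, Measurable (T g) := fun g => (hT g).measurable
  have hσm : ∀ (σ : Gp r →* Equiv.Perm (Fin n)) g, Measurable (σ g) :=
    fun σ g => measurable_of_finite _
  set G := goodPairs σ₀ y₀ m {P : ProbabilityMeasure (Gp r → A × B) |
      dStar k (P : Measure (Gp r → A × B)) (μ.map (itin T (joint α β))) < ε}
  let f : (Gp r →* Equiv.Perm (Fin n)) × (Fin n → A × B) → (Gp r →* Equiv.Perm (Fin n)) ×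
      (Fin n → (ball (1 : Gp r) k₁ → A) × (ball (1 : Gp r) k₂ → B)) := fun p =>
    (p.1, joint (itinBall p.1 (Prod.fst ∘ p.2) k₁) (itinBall p.1 (Prod.snd ∘ p.2) k₂))
  have hf : Function.Injective f := by
    rintro ⟨σ, z⟩ ⟨σ', z'⟩ h
    simp only [f, Prod.mk.injEq] at h
    obtain ⟨rfl, h⟩ := h
    have h1 : itinBall σ (Prod.fst ∘ z) k₁ = itinBall σ (Prod.fst ∘ z') k₁ :=
      funext fun j => congrArg Prod.fst (congrFun h j)
    have h2 : itinBall σ (Prod.snd ∘ z) k₂ = itinBall σ (Prod.snd ∘ z') k₂ :=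
      funext fun j => congrArg Prod.snd (congrFun h j)
    have h3 := congrArg root h1
    have h4 := congrArg root h2
    rw [root_itinBall, root_itinBall] at h3 h4
    exact Prod.ext rfl (funext fun j => Prod.ext (congrFun h3 j) (congrFun h4 j))
  rw [← Nat.card_image_of_injective hf]
  refine card_le_of_bigF_le hr _ ?_
  rintro _ ⟨⟨σ, z⟩, ⟨-, P, hP, hPz⟩, rfl⟩
  have hd : dStar k (empirical σ z) (μ.map (itin T (joint α β))) < ε := hPz ▸ hP
  have hab : Measurable (joint α β) := hα.prodMk hβ
  have hedge : ∀ i, lawDist (unif n) (edge σ (f (σ, z)).2 i) μ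
      (edge T (joint (itinBall T α k₁) (itinBall T β k₂)) i) ≤ 2 * ε := by
    intro i
    have h1 := joint_itinBall_eq_comp T (joint α β) h₁ h₂
    change joint (itinBall T α k₁) (itinBall T β k₂) = _ at h1
    simp only [f]
    rw [h1, joint_itinBall_eq_comp σ z h₁ h₂, edge_comp, edge_comp]
    refine (lawDist_comp_le (measurable_of_finite _)
      (measurable_edge hTm (measurable_itinOn hTm hab _) i) _).trans ?_
    refine (lawDist_edge_le_dStar (hσm σ) hTm (measurable_of_finite z) hab k i).trans ?_
    change 2 * dStar k (empirical σ z) _ ≤ _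
    linarith
  have := abs_bigF_sub_le hr (hσm σ) hTm (measurable_of_finite (f (σ, z)).2)
    (measurable_joint (measurable_itinBall hTm hα _) (measurable_itinBall hTm hβ _)) hedge hL
  have := (abs_le.1 this).2
  change bigF (unif n) σ (f (σ, z)).2 ≤ _
  linarith

/-- Start from the edge class of one approximate model of `(α^k, β^m)`, and send each member to its
labeling by roots. The result is good, and the last term of the exponent pays for the multiplicity
of this map. The parameters `t` and `L` are optimized later. -/
theorem le_card_goodPairs [Nonempty A] (hr : 1 ≤ r) (hT : ∀ g, MeasurePreserving (T g) μ μ)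
    (hα : Measurable α) (hβ : Measurable β) (σ₀ : Gp r →* Equiv.Perm (Fin n)) (y₀ : Fin n → B)
    {k m : ℕ} (hkm : k ≤ m) {Δ : ℝ}
    (hΔ : ∀ i, lawDist (unif n) (edge σ₀ (itinBall σ₀ y₀ m) i) μ (edge T (itinBall T β m) i) ≤ Δ)
    {O : Set (ProbabilityMeasure (Gp r → A × B))} {ε : ℝ}
    (hO : ∀ P : ProbabilityMeasure (Gp r → A × B),
      dStar k (P : Measure (Gp r → A × B)) (μ.map (itin T (joint α β))) < ε → P ∈ O)
    {N : ℕ} (hN : N = Fintype.card ((ball (1 : Gp r) k → A) × (ball (1 : Gp r) m → B)))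
    {η : ℝ} (hη : 9 * (2 * Δ + 2 * (N : ℝ) ^ 2 / n) ≤ η)
    (hε : r * (4 * ((ball (1 : Gp r) (k + 1)).card * r * η) + η) < ε) {t L : ℝ} (ht : 0 < t)
    (ht1 : t ≤ 1) (hL : 0 ≤ L) :
    Real.exp (homTerm r n + n * (bigF μ T (joint (itinBall T α k) (itinBall T β m)) -
      (3 * r + 1) * (L * η + (N : ℝ) ^ 2 * Real.exp (-L))) - classErr r n N -
      (n * ((ball (1 : Gp r) (k + 1)).card * r * η) * Real.log t⁻¹ +
        Fintype.card (ball (1 : Gp r) k → A) * t * n)) ≤ Nat.card (goodPairs σ₀ y₀ m O) := by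
  have hn : (0 : ℝ) < n := by exact_mod_cast NeZero.pos n
  have hTm : ∀ g, Measurable (T g) := fun g => (hT g).measurable
  have hσm : ∀ (σ : Gp r →* Equiv.Perm (Fin n)) g, Measurable (σ g) :=
    fun σ g => measurable_of_finite _
  set K : ℝ := (((ball (1 : Gp r) (k + 1)).card : ℕ) : ℝ) with hK
  have hαm := measurable_itinBall hTm hα k
  have hβm := measurable_itinBall hTm hβ m
  have hab : Measurable (joint α β) := hα.prodMk hβ
  have habm := measurable_joint hαm hβm
  obtain ⟨σ', X', hcnt, hdist⟩ := exists_edge_extension hr σ₀ (itinBall σ₀ y₀ m) hT hαm hβm hΔ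
  have hdist' : ∀ i, lawDist (unif n) (edge σ' (joint X' (itinBall σ₀ y₀ m)) i) μ
      (edge T (joint (itinBall T α k) (itinBall T β m)) i) ≤ η := by
    intro i
    refine (hdist i).trans (le_trans (le_of_eq ?_) hη)
    rw [hN, Fintype.card_prod, Nat.cast_mul]
  set Z' := joint X' (itinBall σ₀ y₀ m) with hZ'
  have hbig : bigF μ T (joint (itinBall T α k) (itinBall T β m)) -
      (3 * r + 1) * (L * η + (N : ℝ) ^ 2 * Real.exp (-L)) ≤ bigF (unif n) σ' Z' := by
    have := (abs_le.1 (abs_bigF_sub_le hr (hσm σ') hTm (measurable_of_finite Z') habm hdist'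
      hL)).1
    rw [← hN] at this
    linarith
  have hclass := exp_le_card_edgeClass hr σ' Z'
  rw [← hN] at hclass
  -- members of the class are lifts up to a small proportion of errors
  have hsnd : ∀ p ∈ edgeClass σ' Z', Prod.snd ∘ p.2 = itinBall p.1 (root (Prod.snd ∘ p.2)) m := by
    rintro ⟨σ, Z⟩ hp
    -- The second coordinate has exactly the edge counts of a genuine lift over `σ₀`, so it is a
    -- lift without any errors.
    refine eq_itinBall_of_mem_edgeClass (σ₀ := σ₀) (y₀ := y₀) (σ := σ) fun i => ?_
    have h1 := cnt_comp_congr (hp i) (Prod.map Prod.snd Prod.snd)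
    rw [← edge_comp, ← edge_comp] at h1
    exact h1.trans (hcnt i)
  have hham : ∀ p ∈ edgeClass σ' Z', (Nat.card {j // (Prod.fst ∘ p.2) j ≠
      itinBall p.1 (root (Prod.fst ∘ p.2)) k j} : ℝ) ≤ n * (K * r * η) := by
    rintro ⟨σ, Z⟩ hp
    have h1 : (Nat.card {j // (Prod.fst ∘ Z) j ≠ itinBall σ (root (Prod.fst ∘ Z)) k j} : ℝ) ≤
        K * ∑ i, (Nat.card {j // edge σ (Prod.fst ∘ Z) i j ∉ shiftCompatible r k A i} : ℝ) := by
      rw [hK]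
      exact_mod_cast card_ne_itinBall_le σ (Prod.fst ∘ Z)
    refine h1.trans ?_
    have h2 : ∀ i, (Nat.card {j // edge σ (Prod.fst ∘ Z) i j ∉ shiftCompatible r k A i} : ℝ) ≤
        n * η := by
      intro i
      refine (card_not_mem_le (μ := μ) (measurable_edge hTm hαm i)
        (edge_itinBall_mem_shiftCompatible T α k i) _).trans ?_
      have h3 := lawDist_comp_le (μ := unif n) (ν := μ) (measurable_of_finite (edge σ Z i))
        (measurable_edge hTm habm i) (Prod.map Prod.fst Prod.fst)
      rw [← edge_comp, ← edge_comp, lawDist_congr_cnt (hp i)] at h3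
      exact mul_le_mul_of_nonneg_left (h3.trans (hdist' i)) hn.le
    calc K * ∑ i, (Nat.card {j // edge σ (Prod.fst ∘ Z) i j ∉ shiftCompatible r k A i} : ℝ)
        ≤ K * ∑ _i : Fin r, (n * η) := by gcongr; exact h2 _
      _ = n * (K * r * η) := by simp; ring
  let f : (Gp r →* Equiv.Perm (Fin n)) × (Fin n → (ball (1 : Gp r) k → A) ×
      (ball (1 : Gp r) m → B)) → (Gp r →* Equiv.Perm (Fin n)) × (Fin n → A × B) :=
    fun p => (p.1, joint (root (Prod.fst ∘ p.2)) (root (Prod.snd ∘ p.2)))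
  have hfmem : ∀ p ∈ edgeClass σ' Z', f p ∈ goodPairs σ₀ y₀ m O := by
    rintro ⟨σ, Z⟩ hp
    constructor
    · change dStar m (empirical σ (root (Prod.snd ∘ Z))) _ = 0
      rw [dStar_empirical_eq_zero_iff]
      intro i
      simp only
      rw [← hsnd _ hp]
      have h1 := cnt_comp_congr (hp i) (Prod.map Prod.snd Prod.snd)
      rw [← edge_comp, ← edge_comp] at h1
      exact h1.trans (hcnt i)
    · have hprob : IsProbabilityMeasure (empirical σ (f (σ, Z)).2) :=
        Measure.isProbabilityMeasure_map (measurable_of_finite _).aemeasurable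
      refine ⟨⟨empirical σ (f (σ, Z)).2, hprob⟩, hO _ ?_, rfl⟩
      change dStar k (empirical σ (f (σ, Z)).2) _ < ε
      set W : Fin n → (ball (1 : Gp r) k → A) × (ball (1 : Gp r) m → B) :=
        joint (itinBall σ (root (Prod.fst ∘ Z)) k) (itinBall σ (root (Prod.snd ∘ Z)) m) with hW
      -- An edge sees two vertices, and the distance of laws is at most twice the proportion of
      -- changed edges; hence the factor `4`.
      have hWZ : ∀ i, lawDist (unif n) (edge σ W i) (unif n) (edge σ Z i) ≤ 4 * (K * r * η) := by
        intro i
        refine (lawDist_unif_le _ _).trans ?_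
        rw [div_le_iff₀ hn]
        have hne : ∀ j, W j ≠ Z j →
            (Prod.fst ∘ Z) j ≠ itinBall σ (root (Prod.fst ∘ Z)) k j := by
          intro j hj h
          refine hj (Prod.ext h.symm ?_)
          exact (congrFun (hsnd _ hp) j).symm
        have hc : Nat.card {j // edge σ W i j ≠ edge σ Z i j} ≤
            Nat.card {j // (Prod.fst ∘ Z) j ≠ itinBall σ (root (Prod.fst ∘ Z)) k j} +
            Nat.card {j // (Prod.fst ∘ Z) j ≠ itinBall σ (root (Prod.fst ∘ Z)) k j} := by
          classical
          have he : Nat.card {j // (Prod.fst ∘ Z) j ≠ itinBall σ (root (Prod.fst ∘ Z)) k j} =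
              Nat.card {j // (Prod.fst ∘ Z) (σ (FreeGroup.of i) j) ≠
                itinBall σ (root (Prod.fst ∘ Z)) k (σ (FreeGroup.of i) j)} :=
            (Nat.card_congr ((σ (FreeGroup.of i)).subtypeEquiv fun _ => Iff.rfl)).symm
          conv_rhs => rw [he]
          nth_rw 1 [← he]
          simp only [Nat.card_eq_fintype_card, Fintype.card_subtype]
          refine le_trans (Finset.card_le_card ?_) (Finset.card_union_le _ _)
          intro j hj
          simp only [Finset.mem_union, Finset.mem_filter, Finset.mem_univ, true_and] at hj ⊢
          by_contra hc
          push Not at hc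
          refine hj (Prod.ext ?_ ?_)
          · by_contra h
            exact hne j h hc.1
          · by_contra h
            exact hne _ h hc.2
        have hc' : (Nat.card {j // edge σ W i j ≠ edge σ Z i j} : ℝ) ≤
            n * (K * r * η) + n * (K * r * η) := by
          refine le_trans (by exact_mod_cast hc) (add_le_add (hham _ hp) (hham _ hp))
        linarith
      have hWT : ∀ i, lawDist (unif n) (edge σ W i) μ
          (edge T (joint (itinBall T α k) (itinBall T β m)) i) ≤ 4 * (K * r * η) + η := by
        intro i
        refine (lawDist_triangle _ _ (unif n) (edge σ Z i) _ _).trans (add_le_add (hWZ i) ?_)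
        rw [lawDist_congr_cnt (hp i)]
        exact hdist' i
      rw [empirical, dStar_map_itin (hσm σ) hTm (measurable_of_finite _) hab]
      let φ : (ball (1 : Gp r) k → A) × (ball (1 : Gp r) m → B) → ball (1 : Gp r) k → A × B :=
        fun q g => (q.1 g, q.2 ⟨g, ball_mono hkm 1 g.2⟩)
      have hφ : ∀ i, lawDist (unif n) (edge σ (itinBall σ (f (σ, Z)).2 k) i) μ
          (edge T (itinBall T (joint α β) k) i) ≤ 4 * (K * r * η) + η := by
        intro i
        have := lawDist_comp_le (μ := unif n) (ν := μ) (measurable_of_finite (edge σ W i))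
          (measurable_edge hTm habm i) (Prod.map φ φ)
        rw [← edge_comp, ← edge_comp] at this
        exact this.trans (hWT i)
      have hsum := Finset.sum_le_sum fun i (_ : i ∈ Finset.univ) => hφ i
      simp only [Finset.sum_const, Finset.card_univ, Fintype.card_fin, nsmul_eq_mul] at hsum
      have h0 : 0 ≤ ∑ i, lawDist (unif n) (edge σ (itinBall σ (f (σ, Z)).2 k) i) μ
          (edge T (itinBall T (joint α β) k) i) :=
        Finset.sum_nonneg fun _ _ => lawDist_nonneg _ _ _ _
      linarith
  -- multiplicity
  set M : ℝ := Real.exp (n * (K * r * η) * Real.log t⁻¹ +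
    Fintype.card (ball (1 : Gp r) k → A) * t * n) with hM
  -- Given the image, the second coordinate of `Z` is recovered as a lift of its root, and the first
  -- lies in a Hamming ball around the lift of its root.
  have hmult : (Nat.card (edgeClass σ' Z') : ℝ) ≤ Nat.card (goodPairs σ₀ y₀ m O) * M := by
    classical
    have := Fintype.ofFinite (goodPairs σ₀ y₀ m O)
    have hinj := Nat.card_le_card_of_injective (α := edgeClass σ' Z')
      (β := Σ q : goodPairs σ₀ y₀ m O, {x : Fin n → ball (1 : Gp r) k → A //
        (Nat.card {j // x j ≠ itinBall q.1.1 (Prod.fst ∘ q.1.2) k j} : ℝ) ≤ n * (K * r * η)})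
      (fun p => ⟨⟨f p.1, hfmem _ p.2⟩, Prod.fst ∘ p.1.2, hham _ p.2⟩) (by
        rintro ⟨⟨σ, Z⟩, hp⟩ ⟨⟨σ₂, Z₂⟩, hp₂⟩ h
        have h1 := congrArg (fun s => s.1.1.1) h
        have h2 := congrArg (fun s => Prod.snd ∘ s.1.1.2) h
        have h3 := congrArg (fun s => s.2.1) h
        change root (Prod.snd ∘ Z) = root (Prod.snd ∘ Z₂) at h2
        change Prod.fst ∘ Z = Prod.fst ∘ Z₂ at h3
        change σ = σ₂ at h1
        subst h1
        have h4 : Prod.snd ∘ Z = Prod.snd ∘ Z₂ := by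
          rw [hsnd _ hp, hsnd _ hp₂]
          simp only [h2]
        exact Subtype.ext (Prod.ext rfl (funext fun j =>
          Prod.ext (congrFun h3 j) (congrFun h4 j))))
    rw [Nat.card_sigma] at hinj
    calc (Nat.card (edgeClass σ' Z') : ℝ) ≤ ∑ q : goodPairs σ₀ y₀ m O,
          (Nat.card {x : Fin n → ball (1 : Gp r) k → A // (Nat.card {j // x j ≠
            itinBall q.1.1 (Prod.fst ∘ q.1.2) k j} : ℝ) ≤ n * (K * r * η)} : ℝ) := by
          exact_mod_cast hinj
      _ ≤ ∑ _q : goodPairs σ₀ y₀ m O, M :=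
          Finset.sum_le_sum fun q _ => card_ne_le_rpow_mul_exp _ ht ht1
      _ = Nat.card (goodPairs σ₀ y₀ m O) * M := by
          rw [Finset.sum_const, Finset.card_univ, nsmul_eq_mul, Nat.card_eq_fintype_card]
  have hfin : Real.exp (homTerm r n + n * bigF (unif n) σ' Z' - classErr r n N) / M ≤
      Nat.card (goodPairs σ₀ y₀ m O) := by
    rw [div_le_iff₀ (Real.exp_pos _)]
    exact hclass.trans hmult
  refine le_trans ?_ hfin
  rw [hM, ← Real.exp_sub]
  apply Real.exp_le_exp.2
  have := mul_le_mul_of_nonneg_left hbig hn.le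
  linarith

end Bounds

/-! ### Growth of the alphabets and of the error terms -/

section Asymptotics

theorem tendsto_log_natCast : Tendsto (fun n : ℕ => Real.log n) atTop atTop :=
  Real.tendsto_log_atTop.comp tendsto_natCast_atTop_atTop

theorem tendsto_sqrt_log_natCast : Tendsto (fun n : ℕ => √(Real.log n)) atTop atTop :=
  Real.tendsto_sqrt_atTop.comp tendsto_log_natCast

theorem tendsto_const_div_log (C : ℝ) : Tendsto (fun n : ℕ => C / Real.log n) atTop (𝓝 0) :=
  tendsto_const_nhds.div_atTop tendsto_log_natCast

theorem card_pattern_le {r : ℕ} {A : Type*} [Fintype A] (k : ℕ) :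
    (Fintype.card (ball (1 : Gp r) k → A) : ℝ) ≤
      Real.exp (Fintype.card A * ((2 * r + 1 : ℝ) ^ k)) := by
  rw [Fintype.card_fun, Fintype.card_coe, Nat.cast_pow]
  calc (Fintype.card A : ℝ) ^ (ball (1 : Gp r) k).card
      ≤ (Real.exp (Fintype.card A)) ^ (ball (1 : Gp r) k).card := by
        gcongr
        linarith [Real.add_one_le_exp (Fintype.card A : ℝ)]
    _ = Real.exp ((ball (1 : Gp r) k).card * Fintype.card A) := (Real.exp_nat_mul _ _).symm
    _ ≤ _ := by
        rw [mul_comm]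
        gcongr
        exact_mod_cast card_ball_le (r := r) k

/-- This is where `m n = o(log log n)` enters: balls of radius `m n` have exponential size in `m n`,
which must stay below `√(log n)`. -/
theorem eventually_pow_le_sqrt_log {m : ℕ → ℕ}
    (hm' : (fun n => (m n : ℝ)) =o[atTop] fun n : ℕ => Real.log (Real.log n)) {b : ℝ}
    (hb : 1 ≤ b) : ∀ᶠ n : ℕ in atTop, b ^ m n ≤ √(Real.log n) := by
  have hlb : 0 ≤ Real.log b := Real.log_nonneg hb
  have hc : 0 < 1 / (2 * (Real.log b + 1)) := by positivity
  filter_upwards [hm'.bound hc, tendsto_log_natCast.eventually_ge_atTop 1] with n h1 hn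
  have hl0 : 0 < Real.log n := by linarith
  have hll : 0 ≤ Real.log (Real.log n) := Real.log_nonneg hn
  rw [Real.norm_natCast, Real.norm_of_nonneg hll] at h1
  have hb0 : 0 < b := by linarith
  have h2 : m n * Real.log b ≤ Real.log (Real.log n) / 2 := by
    calc m n * Real.log b ≤ (1 / (2 * (Real.log b + 1)) * Real.log (Real.log n)) *
          (Real.log b + 1) := by gcongr; linarith
      _ = Real.log (Real.log n) / 2 := by field_simp
  rw [← Real.exp_log hb0, ← Real.exp_nat_mul, Real.sqrt_eq_rpow, Real.rpow_def_of_pos hl0]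
  apply Real.exp_le_exp.2
  linarith

theorem eventually_card_pattern_le {r : ℕ} {A B : Type*} [Fintype A] [Fintype B] {m : ℕ → ℕ}
    (hm' : (fun n => (m n : ℝ)) =o[atTop] fun n : ℕ => Real.log (Real.log n)) (k : ℕ) :
    ∃ c : ℝ, 0 ≤ c ∧ ∀ᶠ n : ℕ in atTop, (Fintype.card ((ball (1 : Gp r) k → A) ×
      (ball (1 : Gp r) (m n) → B)) : ℝ) ≤ Real.exp (c * √(Real.log n)) := by
  refine ⟨Fintype.card A * ((2 * r + 1 : ℝ) ^ k) + Fintype.card B, by positivity, ?_⟩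
  have hb : (1 : ℝ) ≤ 2 * r + 1 := by linarith [r.cast_nonneg (α := ℝ)]
  filter_upwards [eventually_pow_le_sqrt_log hm' hb,
    tendsto_sqrt_log_natCast.eventually_ge_atTop 1] with n h1 h2
  rw [Fintype.card_prod, Nat.cast_mul]
  refine (mul_le_mul (card_pattern_le k) (card_pattern_le (m n)) (Nat.cast_nonneg _)
    (Real.exp_pos _).le).trans ?_
  rw [← Real.exp_add]
  apply Real.exp_le_exp.2
  rw [add_mul]
  exact add_le_add (le_mul_of_one_le_right (by positivity) h2) (by gcongr)

variable {N : ℕ → ℕ} {c : ℝ}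

theorem eventually_sq_le_sqrt
    (hN : ∀ᶠ n : ℕ in atTop, (N n : ℝ) ≤ Real.exp (c * √(Real.log n))) :
    ∀ᶠ n : ℕ in atTop, (N n : ℝ) ^ 2 ≤ √(n : ℝ) := by
  filter_upwards [hN, tendsto_sqrt_log_natCast.eventually_ge_atTop (4 * c),
    tendsto_log_natCast.eventually_ge_atTop 1, eventually_gt_atTop 0] with n h1 h2 h3 h4
  have hn : (0 : ℝ) < n := by exact_mod_cast h4
  have hl : √(Real.log n) * √(Real.log n) = Real.log n := Real.mul_self_sqrt (by linarith)
  have h5 : 4 * c * √(Real.log n) ≤ Real.log n := by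
    calc 4 * c * √(Real.log n) ≤ √(Real.log n) * √(Real.log n) := by gcongr
      _ = Real.log n := hl
  calc (N n : ℝ) ^ 2 ≤ Real.exp (c * √(Real.log n)) ^ 2 := by gcongr
    _ = Real.exp (2 * (c * √(Real.log n))) := by rw [← Real.exp_nat_mul]; norm_num
    _ ≤ Real.exp (Real.log n * (1 / 2)) := Real.exp_le_exp.2 (by linarith)
    _ = √(n : ℝ) := by rw [Real.sqrt_eq_rpow, Real.rpow_def_of_pos hn]

theorem eventually_sq_div_le
    (hN : ∀ᶠ n : ℕ in atTop, (N n : ℝ) ≤ Real.exp (c * √(Real.log n))) :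
    ∀ᶠ n : ℕ in atTop, (N n : ℝ) ^ 2 / n ≤ 1 / Real.log n := by
  have h0 := (isLittleO_log_rpow_atTop (show (0 : ℝ) < 1 / 2 by norm_num)).bound one_pos
  filter_upwards [eventually_sq_le_sqrt hN, tendsto_natCast_atTop_atTop.eventually h0,
    tendsto_log_natCast.eventually_ge_atTop 1, eventually_gt_atTop 0] with n h1 h2 h3 h4
  have hn : (0 : ℝ) < n := by exact_mod_cast h4
  rw [one_mul, Real.norm_of_nonneg (by linarith), Real.norm_of_nonneg (by positivity),
    ← Real.sqrt_eq_rpow] at h2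
  rw [div_le_div_iff₀ hn (by linarith), one_mul]
  calc (N n : ℝ) ^ 2 * Real.log n ≤ √(n : ℝ) * √(n : ℝ) := by gcongr
    _ = n := Real.mul_self_sqrt hn.le

theorem tendsto_classErr_div (r : ℕ)
    (hN : ∀ᶠ n : ℕ in atTop, (N n : ℝ) ≤ Real.exp (c * √(Real.log n))) :
    Tendsto (fun n : ℕ => classErr r n (N n) / n) atTop (𝓝 0) := by
  have hlim : Tendsto (fun n : ℕ => (3 * r + 2 : ℝ) * ((Real.log n + 2) / √(n : ℝ))) atTop
      (𝓝 0) := by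
    rw [← mul_zero (3 * r + 2 : ℝ)]
    refine Tendsto.const_mul _ ?_
    have h1 : Tendsto (fun x : ℝ => Real.log x / √x) atTop (𝓝 0) := by
      have := (isLittleO_log_rpow_atTop (show (0 : ℝ) < 1 / 2 by norm_num)).tendsto_div_nhds_zero
      simpa only [Real.sqrt_eq_rpow] using this
    have h2 : Tendsto (fun x : ℝ => 2 / √x) atTop (𝓝 0) :=
      tendsto_const_nhds.div_atTop Real.tendsto_sqrt_atTop
    have h3 := (h1.add h2).comp tendsto_natCast_atTop_atTop (α := ℕ)
    simp only [add_zero] at h3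
    refine h3.congr fun n => ?_
    simp only [Function.comp, add_div]
  refine squeeze_zero' ?_ ?_ hlim
  · refine Eventually.of_forall fun n => div_nonneg ?_ n.cast_nonneg
    have : 0 ≤ Real.log ((n : ℝ) + 1) := Real.log_nonneg (by linarith [n.cast_nonneg (α := ℝ)])
    unfold classErr
    positivity
  · filter_upwards [eventually_sq_le_sqrt hN, eventually_ge_atTop 1] with n h1 h2
    have hn : (1 : ℝ) ≤ n := by exact_mod_cast h2
    have hs : 1 ≤ √(n : ℝ) := Real.one_le_sqrt.2 hn
    have hNN : (N n : ℝ) ≤ (N n : ℝ) ^ 2 := by exact_mod_cast Nat.le_self_pow two_ne_zero _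
    have hlog : Real.log ((n : ℝ) + 1) + 1 ≤ Real.log n + 2 := by
      have h4 : Real.log ((n : ℝ) + 1) ≤ Real.log (n * 2) :=
        Real.log_le_log (by linarith) (by linarith)
      rw [Real.log_mul (by linarith) (by norm_num)] at h4
      have := Real.log_two_lt_d9
      linarith
    have hl0 : 0 ≤ Real.log n := Real.log_nonneg hn
    have hss : √(n : ℝ) * √(n : ℝ) = n := Real.mul_self_sqrt (by linarith)
    have hbr : 1 + (2 * r + 1) * (N n : ℝ) + r * (N n : ℝ) ^ 2 ≤ (3 * r + 2) * √(n : ℝ) := by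
      have h6 : (2 * r + 1) * (N n : ℝ) ≤ (2 * r + 1) * √(n : ℝ) := by
        gcongr; linarith
      have h7 : r * (N n : ℝ) ^ 2 ≤ r * √(n : ℝ) := by gcongr
      linarith
    rw [classErr, div_le_iff₀ (by linarith)]
    have h0 : 0 ≤ Real.log ((n : ℝ) + 1) + 1 := by
      have : 0 ≤ Real.log ((n : ℝ) + 1) := Real.log_nonneg (by linarith)
      linarith
    calc _ ≤ (Real.log n + 2) * ((3 * r + 2) * √(n : ℝ)) := by gcongr
      _ = (3 * r + 2 : ℝ) * ((Real.log n + 2) / √(n : ℝ)) * (√(n : ℝ) * √(n : ℝ)) := by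
          field_simp
      _ = _ := by rw [hss]

/-- With `L = (2 c + 1) √(log n)`, the factor `exp (-L)` outweighs `N² ≤ exp (2 c √(log n))`, while
`L C / log n` is still of order `1 / √(log n)`. -/
theorem tendsto_entropy_modulus (r : ℕ) (C : ℝ)
    (hN : ∀ᶠ n : ℕ in atTop, (N n : ℝ) ≤ Real.exp (c * √(Real.log n))) :
    Tendsto (fun n : ℕ => (3 * r + 1 : ℝ) * ((2 * c + 1) * √(Real.log n) * (C / Real.log n) +
      (N n : ℝ) ^ 2 * Real.exp (-((2 * c + 1) * √(Real.log n))))) atTop (𝓝 0) := by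
  rw [← mul_zero (3 * r + 1 : ℝ)]
  refine Tendsto.const_mul _ ?_
  rw [← add_zero (0 : ℝ)]
  refine Tendsto.add ?_ ?_
  · have h1 : Tendsto (fun n : ℕ => (2 * c + 1) * C / √(Real.log n)) atTop (𝓝 0) :=
      tendsto_const_nhds.div_atTop tendsto_sqrt_log_natCast
    refine h1.congr' ?_
    filter_upwards [tendsto_log_natCast.eventually_ge_atTop 1] with n hn
    have hs : 0 < √(Real.log n) := Real.sqrt_pos.2 (by linarith)
    have hss : √(Real.log n) * √(Real.log n) = Real.log n := Real.mul_self_sqrt (by linarith)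
    conv_rhs => rw [← hss]
    rw [hss]
    field_simp
    rw [Real.sq_sqrt (by linarith)]
  · have h2 : Tendsto (fun n : ℕ => Real.exp (-√(Real.log n))) atTop (𝓝 0) :=
      Real.tendsto_exp_neg_atTop_nhds_zero.comp tendsto_sqrt_log_natCast
    refine squeeze_zero' (Eventually.of_forall fun n => by positivity) ?_ h2
    filter_upwards [hN] with n hn
    calc (N n : ℝ) ^ 2 * Real.exp (-((2 * c + 1) * √(Real.log n)))
        ≤ Real.exp (c * √(Real.log n)) ^ 2 * Real.exp (-((2 * c + 1) * √(Real.log n))) := by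
          gcongr
      _ = Real.exp (-√(Real.log n)) := by
          rw [← Real.exp_nat_mul, ← Real.exp_add]
          congr 1
          push_cast
          ring

end Asymptotics

/-! ### Exponential rates -/

section ExponentialRates

variable {r : ℕ} {X : Type*} [MeasurableSpace X] {μ : Measure X} [IsProbabilityMeasure μ]
  {T : Gp r →* Equiv.Perm X} {A B : Type*}
  [Fintype A] [TopologicalSpace A] [DiscreteTopology A] [MeasurableSpace A]
  [DiscreteMeasurableSpace A]
  [Fintype B] [TopologicalSpace B] [DiscreteTopology B] [MeasurableSpace B]
  [DiscreteMeasurableSpace B]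
  {α : X → A} {β : X → B} {m : ℕ → ℕ} {y : ∀ n : ℕ, Fin n → B}
  {σ : ∀ n : ℕ, Gp r →* Equiv.Perm (Fin n)}

theorem exists_lawDist_le_div_log {B : Type*} [Fintype B] [MeasurableSpace B]
    [DiscreteMeasurableSpace B] {β : X → B} {y : ∀ n : ℕ, Fin n → B} (hT : ∀ g, Measurable (T g))
    (hβ : Measurable β)
    (hσ : (fun n => dStar (m n) (empirical (σ n) (y n)) (μ.map (itin T β)))
      =O[atTop] fun n : ℕ => 1 / Real.log n) :
    ∃ C : ℝ, 0 ≤ C ∧ ∀ᶠ n : ℕ in atTop, ∀ i,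
      lawDist (unif n) (edge (σ n) (itinBall (σ n) (y n) (m n)) i) μ
        (edge T (itinBall T β (m n)) i) ≤ C / Real.log n := by
  obtain ⟨C, hC0, hC⟩ := hσ.exists_nonneg
  refine ⟨2 * C, by positivity, ?_⟩
  filter_upwards [hC.bound, tendsto_log_natCast.eventually_ge_atTop 1, eventually_gt_atTop 0]
    with n h1 h2 h3 i
  have : NeZero n := ⟨h3.ne'⟩
  refine (lawDist_edge_le_dStar (fun g => measurable_of_finite _) hT (measurable_of_finite _) hβ
    (m n) i).trans ?_
  have h4 : (0 : ℝ) ≤ 1 / Real.log n := by positivity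
  rw [Real.norm_of_nonneg h4] at h1
  have h5 := (Real.le_norm_self _).trans h1
  rw [mul_one_div] at h5
  rw [mul_div_assoc]
  exact mul_le_mul_of_nonneg_left h5 two_pos.le

/-- Although the radius `m n` grows, the empirical `F` at that radius follows the true one; this
gives the exponent of the denominator for both bounds. -/
theorem exists_abs_bigF_sub_le {B : Type*} [Fintype B] [MeasurableSpace B]
    [DiscreteMeasurableSpace B] {β : X → B} {y : ∀ n : ℕ, Fin n → B} (hr : 1 ≤ r)
    (hT : ∀ g, Measurable (T g)) (hβ : Measurable β)
    (hm' : (fun n => (m n : ℝ)) =o[atTop] fun n : ℕ => Real.log (Real.log n))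
    (hσ : (fun n => dStar (m n) (empirical (σ n) (y n)) (μ.map (itin T β)))
      =O[atTop] fun n : ℕ => 1 / Real.log n) :
    ∃ e : ℕ → ℝ, Tendsto e atTop (𝓝 0) ∧ ∀ᶠ n : ℕ in atTop,
      |bigF (unif n) (σ n) (itinBall (σ n) (y n) (m n)) - bigF μ T (itinBall T β (m n))| +
        classErr r n (Fintype.card (ball (1 : Gp r) (m n) → B)) / n ≤ e n := by
  obtain ⟨C, hC0, hC⟩ := exists_lawDist_le_div_log hT hβ hσ
  -- The product alphabet with a trivial first factor is just the alphabet of ball patterns in `B`.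
  obtain ⟨c, hc0, hc⟩ := eventually_card_pattern_le (r := r) (A := Unit) (B := B) hm' 0
  have hc' : ∀ᶠ n : ℕ in atTop, (Fintype.card (ball (1 : Gp r) (m n) → B) : ℝ) ≤
      Real.exp (c * √(Real.log n)) := by
    filter_upwards [hc] with n hn
    simpa only [Fintype.card_prod, Fintype.card_unique, one_mul] using hn
  refine ⟨_, add_zero (0 : ℝ) ▸ (tendsto_entropy_modulus r C hc').add (tendsto_classErr_div r hc'),
    ?_⟩
  filter_upwards [hC, eventually_gt_atTop 0] with n h1 h2
  have : NeZero n := ⟨h2.ne'⟩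
  gcongr
  exact abs_bigF_sub_le hr (fun g => measurable_of_finite _) hT (measurable_of_finite _)
    (measurable_itinBall hT hβ _) h1 (by positivity)

theorem eventually_rate_le (hr : 1 ≤ r) (hT : ∀ g, MeasurePreserving (T g) μ μ)
    (hα : Measurable α) (hβ : Measurable β)
    (hm' : (fun n => (m n : ℝ)) =o[atTop] fun n : ℕ => Real.log (Real.log n))
    (hσ : (fun n => dStar (m n) (empirical (σ n) (y n)) (μ.map (itin T β)))
      =O[atTop] fun n : ℕ => 1 / Real.log n) (k₁ k₂ : ℕ) {δ : ℝ} (hδ : 0 < δ) :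
    ∃ O : Set (ProbabilityMeasure (Gp r → A × B)), IsOpen O ∧
      (∃ P ∈ O, (P : Measure (Gp r → A × B)) = μ.map (itin T (joint α β))) ∧
      ∀ᶠ n : ℕ in atTop,
        ENNReal.log (expectedExtensions (sbm (σ n) (y n) (m n)) (y n) O) / (n : EReal) ≤
          ((bigF μ T (joint (itinBall T α k₁) (itinBall T β k₂)) -
            bigF μ T (itinBall T β (m n)) + δ : ℝ) : EReal) := by
  have hTm : ∀ g, Measurable (T g) := fun g => (hT g).measurable
  have hab : Measurable (joint α β) := hα.prodMk hβ
  set M := Fintype.card ((ball (1 : Gp r) k₁ → A) × (ball (1 : Gp r) k₂ → B)) with hM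
  -- The alphabet is fixed here, so `L` can be chosen first to control its size, and `ε` afterwards
  -- depending on `L`.
  obtain ⟨L, hL0, hL⟩ : ∃ L : ℝ, 0 ≤ L ∧ (3 * r + 1) * ((M : ℝ) ^ 2 * Real.exp (-L)) < δ / 4 := by
    have h1 : Tendsto (fun L : ℝ => (3 * r + 1) * ((M : ℝ) ^ 2 * Real.exp (-L))) atTop (𝓝 0) := by
      simpa using (Real.tendsto_exp_neg_atTop_nhds_zero.const_mul ((M : ℝ) ^ 2)).const_mul
        (3 * r + 1 : ℝ)
    obtain ⟨L, h2, h3⟩ := ((h1.eventually_lt_const (by positivity : 0 < δ / 4)).and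
      (eventually_ge_atTop 0)).exists
    exact ⟨L, h3, h2⟩
  obtain ⟨ε, hε0, hε⟩ : ∃ ε : ℝ, 0 < ε ∧ (3 * r + 1) * (L * (2 * ε)) ≤ δ / 4 := by
    refine ⟨δ / (8 * (3 * r + 1) * (L + 1)), by positivity, ?_⟩
    calc (3 * r + 1) * (L * (2 * (δ / (8 * (3 * r + 1) * (L + 1)))))
        ≤ (3 * r + 1) * ((L + 1) * (2 * (δ / (8 * (3 * r + 1) * (L + 1))))) := by
          gcongr; linarith
      _ = δ / 4 := by field_simp; norm_num
  have hprob : IsProbabilityMeasure (μ.map (itin T (joint α β))) :=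
    Measure.isProbabilityMeasure_map (measurable_itin hTm hab).aemeasurable
  set k := max k₁ k₂
  refine ⟨{P | dStar k (P : Measure (Gp r → A × B)) (μ.map (itin T (joint α β))) < ε},
    isOpen_dStar_lt k _ ε, ⟨⟨_, hprob⟩, ?_, rfl⟩, ?_⟩
  · have h0 : dStar k (μ.map (itin T (joint α β))) (μ.map (itin T (joint α β))) = 0 := by
      simp [dStar, dOn]
    change dStar k (μ.map (itin T (joint α β))) (μ.map (itin T (joint α β))) < ε
    rwa [h0]
  obtain ⟨e, he, hbound⟩ := exists_abs_bigF_sub_le hr hTm hβ hm' hσ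
  have hMc : ∀ᶠ n : ℕ in atTop, (M : ℝ) ≤ Real.exp (M * √(Real.log n)) := by
    filter_upwards [tendsto_sqrt_log_natCast.eventually_ge_atTop 1] with n hn
    have h1 : (M : ℝ) ≤ M * √(Real.log n) := le_mul_of_one_le_right (Nat.cast_nonneg _) hn
    linarith [Real.add_one_le_exp (M * √(Real.log n))]
  have hcl := tendsto_classErr_div (N := fun _ => M) r hMc
  filter_upwards [hbound, he.eventually_lt_const (by positivity : 0 < δ / 4),
    hcl.eventually_lt_const (by positivity : 0 < δ / 8), eventually_gt_atTop 0] with n h1 h2 h3 h4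
  have : NeZero n := ⟨h4.ne'⟩
  have hn : (0 : ℝ) < n := by exact_mod_cast h4
  rw [expectedExtensions_eq hr]
  have hN := card_goodPairs_le hr hT hα hβ (σ n) (y n) (m n) (le_max_left k₁ k₂)
    (le_max_right k₁ k₂) (ε := ε) hL0
  have hD := exp_le_card_edgeClass hr (σ n) (itinBall (σ n) (y n) (m n))
  rw [← card_statPairs_eq] at hD
  refine (log_div_div_le h4 hN hD).trans (EReal.coe_le_coe_iff.2 ?_)
  have h5 := (abs_le.1 ((le_add_of_nonneg_right (div_nonneg (by
    have : 0 ≤ Real.log ((n : ℝ) + 1) := Real.log_nonneg (by linarith)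
    unfold classErr; positivity) hn.le)).trans h1)).1
  have h6 : classErr r n (Fintype.card (ball (1 : Gp r) (m n) → B)) / n ≤ e n :=
    (le_add_of_nonneg_left (abs_nonneg _)).trans h1
  have h7 : |bigF (unif n) (σ n) (itinBall (σ n) (y n) (m n)) - bigF μ T (itinBall T β (m n))| =
    |bigF μ T (itinBall T β (m n)) - bigF (unif n) (σ n) (itinBall (σ n) (y n) (m n))| :=
    abs_sub_comm _ _
  have h8 := le_abs_self
    (bigF μ T (itinBall T β (m n)) - bigF (unif n) (σ n) (itinBall (σ n) (y n) (m n)))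
  rw [← hM]
  have hsplit : ∀ h F w ce F₀ ceB : ℝ, (h + n * (F + w) + 2 * ce - (h + n * F₀ - ceB)) / n =
      F + w + 2 * (ce / n) - F₀ + ceB / n := by
    intro h F w ce F₀ ceB
    field_simp
    ring
  rw [hsplit]
  rw [mul_add]
  linarith

theorem eventually_le_rate {A : Type*} [Fintype A] [MeasurableSpace A] [DiscreteMeasurableSpace A]
    [Nonempty A] {B : Type*} [Fintype B] [MeasurableSpace B] [DiscreteMeasurableSpace B]
    {α : X → A} {β : X → B} {y : ∀ n : ℕ, Fin n → B} (hr : 1 ≤ r)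
    (hT : ∀ g, MeasurePreserving (T g) μ μ)
    (hα : Measurable α) (hβ : Measurable β) (hm : Tendsto m atTop atTop)
    (hm' : (fun n => (m n : ℝ)) =o[atTop] fun n : ℕ => Real.log (Real.log n))
    (hσ : (fun n => dStar (m n) (empirical (σ n) (y n)) (μ.map (itin T β)))
      =O[atTop] fun n : ℕ => 1 / Real.log n) {k : ℕ} {ε : ℝ} (hε : 0 < ε)
    {O : Set (ProbabilityMeasure (Gp r → A × B))}
    (hO : ∀ P : ProbabilityMeasure (Gp r → A × B),
      dStar k (P : Measure (Gp r → A × B)) (μ.map (itin T (joint α β))) < ε → P ∈ O)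
    {δ : ℝ} (hδ : 0 < δ) :
    ∀ᶠ n : ℕ in atTop,
      ((bigF μ T (joint (itinBall T α k) (itinBall T β (m n))) -
            bigF μ T (itinBall T β (m n)) - δ : ℝ) : EReal) ≤
        ENNReal.log (expectedExtensions (sbm (σ n) (y n) (m n)) (y n) O) / (n : EReal) := by
  have hTm : ∀ g, Measurable (T g) := fun g => (hT g).measurable
  obtain ⟨C, hC0, hC⟩ := exists_lawDist_le_div_log hTm hβ hσ
  obtain ⟨c, hc0, hc⟩ := eventually_card_pattern_le (r := r) (A := A) (B := B) hm' k
  obtain ⟨e, he, hbound⟩ := exists_abs_bigF_sub_le hr hTm hβ hm' hσ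
  set C' : ℝ := 9 * (2 * C + 2) with hC'
  set K : ℝ := (((ball (1 : Gp r) (k + 1)).card : ℕ) : ℝ) with hK
  set a : ℝ := ((Fintype.card (ball (1 : Gp r) k → A) : ℕ) : ℝ) with ha
  have ha1 : 0 < a + 1 := by positivity
  -- Five errors share `δ`: the entropy modulus, the Stirling error of the class, the two terms of
  -- the Hamming ball, and the denominator. A fixed small `t` suffices, since `η` tends to zero.
  obtain ⟨t, ht0, ht1, hta⟩ : ∃ t : ℝ, 0 < t ∧ t ≤ 1 ∧ a * t ≤ δ / 5 := by
    refine ⟨min 1 (δ / (5 * (a + 1))), by positivity, min_le_left _ _, ?_⟩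
    calc a * min 1 (δ / (5 * (a + 1))) ≤ (a + 1) * (δ / (5 * (a + 1))) := by
          gcongr
          · linarith
          · exact min_le_right _ _
      _ = δ / 5 := by field_simp
  have hη := tendsto_const_div_log C'
  have hη1 : Tendsto (fun n : ℕ => r * (4 * (K * r * (C' / Real.log n)) + C' / Real.log n)) atTop
      (𝓝 0) := by
    simpa using (((hη.const_mul (K * r)).const_mul 4).add hη).const_mul (r : ℝ)
  have hη2 : Tendsto (fun n : ℕ => K * r * (C' / Real.log n) * Real.log t⁻¹) atTop (𝓝 0) := by
    simpa using (hη.const_mul (K * r)).mul_const (Real.log t⁻¹)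
  have hmod := tendsto_entropy_modulus r C' hc
  have hcl := tendsto_classErr_div r hc
  have hδ5 : 0 < δ / 5 := by positivity
  filter_upwards [hC, hbound, he.eventually_lt_const hδ5, hη1.eventually_lt_const hε,
    hη2.eventually_lt_const hδ5, hmod.eventually_lt_const hδ5, hcl.eventually_lt_const hδ5,
    eventually_sq_div_le hc, hm.eventually_ge_atTop k, eventually_gt_atTop 0]
    with n g1 g2 g3 g4 g5 g6 g7 g8 g9 g10
  have : NeZero n := ⟨g10.ne'⟩
  have hn : (0 : ℝ) < n := by exact_mod_cast g10
  rw [expectedExtensions_eq hr]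
  have hN := le_card_goodPairs hr hT hα hβ (σ n) (y n) g9 g1 hO rfl (η := C' / Real.log n) (by
      rw [mul_div_assoc]
      calc _ ≤ 9 * (2 * (C / Real.log n) + 2 * (1 / Real.log n)) := by gcongr
        _ = C' / Real.log n := by rw [hC']; ring) g4 ht0 ht1
      (L := (2 * c + 1) * √(Real.log n)) (by positivity)
  have hD := card_edgeClass_le_exp hr (σ n) (itinBall (σ n) (y n) (m n))
  rw [← card_statPairs_eq] at hD
  refine le_trans (EReal.coe_le_coe_iff.2 ?_) (le_log_div_div g10 hN hD (statPairs_card_pos _ _ _))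
  have h8 := le_abs_self
    (bigF (unif n) (σ n) (itinBall (σ n) (y n) (m n)) - bigF μ T (itinBall T β (m n)))
  have hsplit : ∀ h F w ce q lt b F₀ ceB : ℝ,
      (h + n * (F - w) - ce - (n * q * lt + b * t * n) - (h + n * F₀ + ceB)) / n =
      F - w - ce / n - q * lt - b * t - F₀ - ceB / n := by
    intro h F w ce q lt b F₀ ceB
    field_simp
    ring
  rw [hsplit]
  linarith

end ExponentialRates

/-! ### The relative `f`-invariant as a growth rate -/

section GrowthRate

variable {r : ℕ} {X : Type*} [MeasurableSpace X] {μ : Measure X} [IsProbabilityMeasure μ]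
  {T : Gp r →* Equiv.Perm X} {A B : Type*}
  [Fintype A] [TopologicalSpace A] [DiscreteTopology A] [MeasurableSpace A]
  [DiscreteMeasurableSpace A]
  [Fintype B] [TopologicalSpace B] [DiscreteTopology B] [MeasurableSpace B]
  [DiscreteMeasurableSpace B]
  {α : X → A} {β : X → B} {m : ℕ → ℕ} {y : ∀ n : ℕ, Fin n → B}
  {σ : ∀ n : ℕ, Gp r →* Equiv.Perm (Fin n)}

theorem exists_tendsto_bigF_itinBall {B : Type*} [Fintype B] [MeasurableSpace B]
    [DiscreteMeasurableSpace B] {β : X → B} (hT : ∀ g, MeasurePreserving (T g) μ μ)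
    (hβ : Measurable β) (hf : ⊥ < fInv μ T β) :
    ∃ v : ℝ, (∀ k, v ≤ bigF μ T (itinBall T β k)) ∧
      Tendsto (fun k => bigF μ T (itinBall T β k)) atTop (𝓝 v) := by
  obtain ⟨c, -, hc⟩ := EReal.lt_iff_exists_real_btwn.1 hf
  have hbdd : BddBelow (Set.range fun k => bigF μ T (itinBall T β k)) := by
    refine ⟨c, ?_⟩
    rintro _ ⟨k, rfl⟩
    exact EReal.coe_le_coe_iff.1 (hc.le.trans (iInf_le _ k))
  exact ⟨_, fun k => ciInf_le hbdd k, tendsto_atTop_ciInf (bigF_itinBall_antitone hT hβ) hbdd⟩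

/-- The denominator satisfies `F_μ(T, β^{m n}) ≥ v`, whereas `F_μ(T, β^{k₂})` is close to `v` for
large `k₂`; the two radii may therefore be exchanged. -/
theorem iInf_limsup_rate_le_fRel (hr : 1 ≤ r) (hT : ∀ g, MeasurePreserving (T g) μ μ)
    (hα : Measurable α) (hβ : Measurable β)
    (hm' : (fun n => (m n : ℝ)) =o[atTop] fun n : ℕ => Real.log (Real.log n))
    (hσ : (fun n => dStar (m n) (empirical (σ n) (y n)) (μ.map (itin T β)))
      =O[atTop] fun n : ℕ => 1 / Real.log n) (hf : ⊥ < fInv μ T β) :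
    ⨅ (O : Set (ProbabilityMeasure (Gp r → A × B))) (_ : IsOpen O)
      (_ : ∃ P ∈ O, (P : Measure (Gp r → A × B)) = μ.map (itin T (joint α β))),
      limsup (fun n : ℕ => ENNReal.log
        (expectedExtensions (sbm (σ n) (y n) (m n)) (y n) O) / (n : EReal)) atTop ≤
    fRel μ T α β := by
  obtain ⟨v, hv, hlim⟩ := exists_tendsto_bigF_itinBall hT hβ hf
  refine le_iInf fun k₁ => ?_
  by_contra! hlt
  obtain ⟨c, hc, hlt⟩ := EReal.lt_iff_exists_real_btwn.1 hlt
  obtain ⟨c', hcc', hlt⟩ := EReal.lt_iff_exists_real_btwn.1 hlt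
  have hcc : c < c' := EReal.coe_lt_coe_iff.1 hcc'
  -- Two thirds of the gap are spent: one on `F_μ(T, β^{k₂}) < v + (c' - c) / 3`, one on the error
  -- in the rate.
  obtain ⟨k₂, h1, h2⟩ := ((eventually_lt_of_limsup_lt hc).and
    (hlim.eventually_lt_const (show v < v + (c' - c) / 3 by linarith))).exists
  replace h1 := EReal.coe_lt_coe_iff.1 h1
  rw [bigFRel] at h1
  obtain ⟨O, hO, hOP, hrate⟩ := eventually_rate_le hr hT hα hβ hm' hσ k₁ k₂
    (show 0 < (c' - c) / 3 by linarith)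
  refine absurd hlt (not_lt.2 ((iInf₂_le O hO).trans ((iInf_le _ hOP).trans
    (limsup_le_of_le (h := hrate.mono fun n hn => hn.trans (EReal.coe_le_coe_iff.2 ?_))))))
  linarith [hv (m n)]

theorem fRel_le_iInf_liminf_rate (hr : 1 ≤ r) (hT : ∀ g, MeasurePreserving (T g) μ μ)
    (hα : Measurable α) (hβ : Measurable β) (hm : Tendsto m atTop atTop)
    (hm' : (fun n => (m n : ℝ)) =o[atTop] fun n : ℕ => Real.log (Real.log n))
    (hσ : (fun n => dStar (m n) (empirical (σ n) (y n)) (μ.map (itin T β)))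
      =O[atTop] fun n : ℕ => 1 / Real.log n) (hf : ⊥ < fInv μ T β) :
    fRel μ T α β ≤
    ⨅ (O : Set (ProbabilityMeasure (Gp r → A × B))) (_ : IsOpen O)
      (_ : ∃ P ∈ O, (P : Measure (Gp r → A × B)) = μ.map (itin T (joint α β))),
      liminf (fun n : ℕ => ENNReal.log
        (expectedExtensions (sbm (σ n) (y n) (m n)) (y n) O) / (n : EReal)) atTop := by
  obtain ⟨v, hv, hlim⟩ := exists_tendsto_bigF_itinBall hT hβ hf
  have : Nonempty A := (nonempty_of_isProbabilityMeasure μ).map α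
  refine le_iInf fun O => le_iInf fun hO => le_iInf fun ⟨P, hP, hPQ⟩ => ?_
  obtain ⟨k, ε, hε, hsub⟩ := exists_dStar_lt_subset hr hO hP
  rw [hPQ] at hsub
  refine (iInf_le _ k).trans ?_
  by_contra! hlt
  obtain ⟨c, hc, hlt⟩ := EReal.lt_iff_exists_real_btwn.1 hlt
  obtain ⟨c', hcc', hlt⟩ := EReal.lt_iff_exists_real_btwn.1 hlt
  have hcc : c < c' := EReal.coe_lt_coe_iff.1 hcc'
  -- The upper limit exceeds `c'` only along some radii `l`, but those are arbitrarily large, and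
  -- monotonicity of `F` carries the bound down to every smaller radius, in particular to each `m
  -- n`.
  have hu : ∀ k₂, c' + v ≤ bigF μ T (joint (itinBall T α k) (itinBall T β k₂)) := by
    intro k₂
    obtain ⟨l, hl, h1⟩ := (frequently_atTop.1 (frequently_lt_of_lt_limsup (h := hlt))) k₂
    replace h1 := EReal.coe_lt_coe_iff.1 h1
    rw [bigFRel] at h1
    have h2 := bigF_joint_itinBall_antitone hT
      (measurable_itinBall (fun g => (hT g).measurable) hα k) hβ hl
    dsimp only at h2
    linarith [hv l]
  have hδ : 0 < (c' - c) / 2 := by linarith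
  refine absurd hc (not_lt.2 (le_liminf_of_le (h := ?_)))
  filter_upwards [eventually_le_rate hr hT hα hβ hm hm' hσ hε hsub hδ,
    hm.eventually (hlim.eventually_lt_const (show v < v + (c' - c) / 2 by linarith))] with n h1 h2
  refine le_trans (EReal.coe_le_coe_iff.2 ?_) h1
  linarith [hu (m n)]

end GrowthRate

end RelF

end

theorem theoremB {r : ℕ} (hr : 1 ≤ r)
    {X : Type*} [MeasurableSpace X] (μ : Measure X) [IsProbabilityMeasure μ]
    (T : RelF.Gp r →* Equiv.Perm X) (hT : ∀ g, MeasurePreserving (T g) μ μ)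
    {A B : Type*}
    [Fintype A] [TopologicalSpace A] [DiscreteTopology A]
    [MeasurableSpace A] [DiscreteMeasurableSpace A]
    [Fintype B] [TopologicalSpace B] [DiscreteTopology B]
    [MeasurableSpace B] [DiscreteMeasurableSpace B]
    (α : X → A) (hα : Measurable α) (β : X → B) (hβ : Measurable β)
    (m : ℕ → ℕ) (hm : Tendsto m atTop atTop)
    (hm' : (fun n => (m n : ℝ)) =o[atTop] fun n : ℕ => Real.log (Real.log n))
    (y : ∀ n : ℕ, Fin n → B) (σ : ∀ n : ℕ, RelF.Gp r →* Equiv.Perm (Fin n))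
    (hσ : (fun n => RelF.dStar (m n) (RelF.empirical (σ n) (y n)) (μ.map (RelF.itin T β)))
      =O[atTop] fun n : ℕ => 1 / Real.log n)
    (hf : ⊥ < RelF.fInv μ T β) :
    (RelF.fRel μ T α β =
      ⨅ (O : Set (ProbabilityMeasure (RelF.Gp r → A × B))) (_ : IsOpen O)
        (_ : ∃ P ∈ O, (P : Measure (RelF.Gp r → A × B)) =
          μ.map (RelF.itin T (RelF.joint α β))),
        limsup (fun n : ℕ => ENNReal.log
          (RelF.expectedExtensions (RelF.sbm (σ n) (y n) (m n)) (y n) O) / (n : EReal)) atTop) ∧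
    (RelF.fRel μ T α β =
      ⨅ (O : Set (ProbabilityMeasure (RelF.Gp r → A × B))) (_ : IsOpen O)
        (_ : ∃ P ∈ O, (P : Measure (RelF.Gp r → A × B)) =
          μ.map (RelF.itin T (RelF.joint α β))),
        liminf (fun n : ℕ => ENNReal.log
          (RelF.expectedExtensions (RelF.sbm (σ n) (y n) (m n)) (y n) O) / (n : EReal)) atTop) := by
  -- The lower bound is on the lower limit and the upper bound on the upper limit, so `liminf ≤
  -- limsup` forces both equalities.
  have h1 := RelF.iInf_limsup_rate_le_fRel hr hT hα hβ hm' hσ hf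
  have h2 := RelF.fRel_le_iInf_liminf_rate hr hT hα hβ hm hm' hσ hf
  have h3 := iInf_mono fun O : Set (ProbabilityMeasure (RelF.Gp r → A × B)) =>
    iInf_mono fun _ : IsOpen O => iInf_mono fun _ : ∃ P ∈ O, (P : Measure (RelF.Gp r → A × B)) =
        μ.map (RelF.itin T (RelF.joint α β)) =>
      liminf_le_limsup (f := atTop) (u := fun n : ℕ => ENNReal.log
        (RelF.expectedExtensions (RelF.sbm (σ n) (y n) (m n)) (y n) O) / (n : EReal))
  exact ⟨le_antisymm (h2.trans h3) h1, le_antisymm h2 (h3.trans h1)⟩
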